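/- Let $n\in\mathbb N$ and let $A$ be a germ at $0\in\mathbb C^n$ of a holomorphic map into $\mathbb C^n$ (not necessarily with $A(0)=0$) of generic rank $n$, i.e. arbitrarily close to $0$ there are points at which the Jacobian matrix $A'$ is invertible. For a germ at $0$ of a holomorphic map $f$ into $\mathbb C^n$, write $f=\sum_{k\ge 0}f_k$ for its decomposition into $\mathbb C^n$-valued homogeneous polynomials $f_k$ of degree $k$, and $j_0^k f=(\partial^\alpha f(0))_{|\alpha|\le k}\in J_0^k(\mathbb C^n)$ for its $k$-jet at $0$. For a bounded set $F\subset\mathbb C^n$ and $f=(f^1,\dots,f^n)$ put $\|f\|_F=\max_j\sup_{z\in F}|f^j(z)|$. Then there exist an integer $\ell_0\ge 0$ and, for every integer $\ell\ge 1$, a polynomial map $$p_\ell:\mathbb C^n\times \mathsf{GL}_n(\mathbb C)\times J_0^{\ell_0+\ell}(\mathbb C^n)\to\mathbb C^n$$ (polynomial in the coordinates of $z\in\mathbb C^n$, the matrix entries of $\lambda\in\mathsf{GL}_n(\mathbb C)$ and the jet coordinates), homogeneous of degree $\ell$ in its first variable, and an integer $\kappa(\ell)\ge 0$, all depending only on $A$,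 such that the following hold. (0) For every germ at $0$ of a holomorphic map $b$ into $\mathbb C^n$ and every germ of a biholomorphism $u:(\mathbb C^n,0)\to(\mathbb C^n,0)$ with $A(u(z))=b(z)$ for $z$ near $0$, one has for all $\ell\ge1$ and all $z\in\mathbb C^n$ $$u_\ell(z)=\frac{1}{(\det u'(0))^{\kappa(\ell)}}\;p_\ell\bigl(z,u'(0),j_0^{\ell_0+\ell}b\bigr).$$ (i) $\kappa(1)=0$, and $p_1(z,\lambda,j_0^{\ell_0+1}b)=\lambda z$ for every germ at $0$ of a holomorphic map $b$ into $\mathbb C^n$, every $\lambda\in\mathsf{GL}_n(\mathbb C)$ and every $z\in\mathbb C^n$. (ii) There exists a polydisc $\Delta\subset\mathbb C^n$ centered at the origin such that for every $C>0$ and every compact subset $L\subset\mathsf{GL}_n(\mathbb C)$ there exists $K>0$ with the following property: for every $\lambda\in L$ and every germ at $0$ of a holomorphic map $b$ into $\mathbb C^n$ with $\|b_k\|_\Delta\le C^k$ for all $k\ge 0$, one has for all $\ell\ge 1$ $$\left\|\frac{p_\ell(\cdot,\lambda,j_0^{\ell_0+\ell}b)}{(\det\lambda)^{\kappa(\ell)}}\right\|_\Delta\le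 K^\ell .$$ -/

import Mathlib

open Filter Topology
open scoped ENNReal Matrix Nat

/-- The Jacobian matrix `f'(z) = (∂f_i/∂z_j (z))_{i,j}` of a map `f : ℂⁿ → ℂⁿ`. -/
noncomputable def jacobian {n : ℕ} (f : (Fin n → ℂ) → (Fin n → ℂ)) (z : Fin n → ℂ) :
    Matrix (Fin n) (Fin n) ℂ :=
  LinearMap.toMatrix' (fderiv ℂ f z : (Fin n → ℂ) →ₗ[ℂ] (Fin n → ℂ))

/-- The germ at `0` of a holomorphic map `f` has generic rank `r`: the number `r` is the largest
rank that the Jacobian of `f` attains at points arbitrarily close to `0`. -/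
def HasGenericRank {n : ℕ} (f : (Fin n → ℂ) → (Fin n → ℂ)) (r : ℕ) : Prop :=
  (∀ᶠ z in 𝓝 (0 : Fin n → ℂ), (jacobian f z).rank ≤ r) ∧
    ∃ᶠ z in 𝓝 (0 : Fin n → ℂ), (jacobian f z).rank = r

/-- `u` represents a germ of a biholomorphism `(ℂⁿ, 0) → (ℂⁿ, 0)`: it is holomorphic near `0`,
fixes `0`, and has a holomorphic inverse germ. -/
def IsBiholomorphismGerm {n : ℕ} (u : (Fin n → ℂ) → (Fin n → ℂ)) : Prop :=
  AnalyticAt ℂ u 0 ∧ u 0 = 0 ∧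
    ∃ v : (Fin n → ℂ) → (Fin n → ℂ), AnalyticAt ℂ v 0 ∧ v 0 = 0 ∧
      (∀ᶠ z in 𝓝 (0 : Fin n → ℂ), v (u z) = z) ∧ (∀ᶠ z in 𝓝 (0 : Fin n → ℂ), u (v z) = z)

/-- The homogeneous part `f_k` of degree `k` of the Taylor expansion `f = ∑ f_k` at `0`:
`f_k(z) = D^k f(0)(z, …, z) / k!`. -/
noncomputable def homogeneousPart {n : ℕ} (f : (Fin n → ℂ) → (Fin n → ℂ)) (k : ℕ)
    (z : Fin n → ℂ) : Fin n → ℂ :=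
  ((k ! : ℕ) : ℂ)⁻¹ • iteratedFDeriv ℂ k f 0 (fun _ => z)

/-- The partial derivative `∂^α f (0)`, that is `D^{|α|} f(0)(e_{i₁}, …, e_{i_k})`, where the list
`i₁ ≤ … ≤ i_k` contains each index `i` exactly `α i` times. -/
noncomputable def partialAtZero {n : ℕ} (f : (Fin n → ℂ) → (Fin n → ℂ)) (α : Fin n →₀ ℕ) :
    Fin n → ℂ :=
  iteratedFDeriv ℂ ((Finsupp.toMultiset α).sort (· ≤ ·)).length f 0
    (fun m => Pi.single (((Finsupp.toMultiset α).sort (· ≤ ·)).get m) 1)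

/-- The multi-indices `α ∈ ℕⁿ` with `|α| ≤ k`. -/
abbrev JetIndex (n k : ℕ) : Type := {α : Fin n →₀ ℕ // α.degree ≤ k}

/-- The space `J_0^k(ℂⁿ)` of `k`-jets at `0` of holomorphic maps `ℂⁿ → ℂⁿ` (not necessarily
fixing `0`), in the coordinates `(Λ_α)_{|α| ≤ k}`. -/
abbrev JetSpace (n k : ℕ) : Type := JetIndex n k → Fin n → ℂ

/-- The `k`-jet `j_0^k f = (∂^α f (0))_{|α| ≤ k}`. -/
noncomputable def jetAtZero {n : ℕ} (k : ℕ) (f : (Fin n → ℂ) → (Fin n → ℂ)) : JetSpace n k :=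
  fun α => partialAtZero f α

/-- The coordinates on `ℂⁿ × M_n(ℂ) × J_0^k(ℂⁿ)`. -/
abbrev PolyVar (n k : ℕ) : Type := Fin n ⊕ ((Fin n × Fin n) ⊕ (JetIndex n k × Fin n))

/-- `ℂⁿ`-valued polynomial maps in the variables `(z, lam, Λ) ∈ ℂⁿ × M_n(ℂ) × J_0^k(ℂⁿ)`; their
restrictions to `ℂⁿ × GL_n(ℂ) × J_0^k(ℂⁿ)` are the polynomial maps on the latter space. -/
abbrev PolyMap (n k : ℕ) : Type := Fin n → MvPolynomial (PolyVar n k) ℂ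

/-- The value `p(z, lam, Λ)`. -/
noncomputable def PolyMap.value {n k : ℕ} (p : PolyMap n k) (z : Fin n → ℂ)
    (lam : Matrix (Fin n) (Fin n) ℂ) (Λ : JetSpace n k) : Fin n → ℂ :=
  fun j => MvPolynomial.eval
    (Sum.elim z (Sum.elim (fun i => lam i.1 i.2) (fun i => Λ i.1 i.2))) (p j)

/-- `p(z, lam, Λ)` is homogeneous of degree `d` in its first variable `z`: every monomial of every
component has total degree `d` in the coordinates of `z`. -/
def PolyMap.IsHomogeneousInFirst {n k : ℕ} (p : PolyMap n k) (d : ℕ) : Prop :=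
  ∀ j, MvPolynomial.IsWeightedHomogeneous
    (Sum.elim (fun _ => 1) (fun _ => 0) : PolyVar n k → ℕ) (p j) d

/-- The open polydisc in `ℂⁿ` centered at `0` with multiradius `ρ`. -/
def polydisc {n : ℕ} (ρ : Fin n → ℝ) : Set (Fin n → ℂ) := {z | ∀ j, ‖z j‖ < ρ j}

/-- `‖f‖_F = max_j sup_{z ∈ F} |f_j(z)|`, as an element of `[0, ∞]`. -/
noncomputable def supNorm {n : ℕ} (F : Set (Fin n → ℂ)) (f : (Fin n → ℂ) → (Fin n → ℂ)) : ℝ≥0∞ :=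
  ⨆ j, ⨆ z ∈ F, ‖f z j‖ₑ

/-!
Both sides of `A ∘ u = b` are replaced by their Taylor series. Writing `u = w ∘ λ` with `λ = u'(0)`,
the series `w` is unipotent, `w(x) = x + O(|x|²)`, and solves `A ∘ w = c` with `c = b ∘ λ⁻¹`. Let
`Δ ≠ 0` be the determinant of the formal Jacobian matrix of `A`, `d` its order and `D` its
homogeneous part of degree `d`. It suffices to construct from every `c`, solvable or not, a unipotent
series `w` that depends on `c` polynomially, with a fixed loss of derivatives, that is the solution
whenever there is one, and that satisfies bounds uniform in `c`; this is
`exists_unipotent_solution`. The series `w` is a sum `γ + v` of a polynomial and a correction.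

The polynomial `γ` agrees with every solution up to order `d + 2` and is obtained in `exists_approx`.
Its existence rests on the fact that a unipotent group acts with closed orbits. In degree `k`, the
lowest order changes of `A` that unipotent maps can produce form a linear space, because
unipotent maps have complex powers (`flow`) that scale these changes. Choosing maps for a basis of
this space realizes each change by a map depending polynomially on the change, and going up through
the degrees solves `A ∘ γ = c` up to any given order if a solution exists. That `γ` then agrees with
the solution up to `d` orders less is `sub_X_mem_of_subst_sub_mem`: the powers of a unipotent map
that preserves `A` to high order preserve `A` as well, so that the Jacobian matrix of `A` annihilates
their velocity to high order, and multiplication by its adjugate bounds the order of the velocity.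

Multiplying the Taylor formula for `A (γ + v) = c` by the adjugate of the Jacobian matrix along `γ`
gives an equation `D v = resid v`, whose right-hand side consists of `(D - Δ ∘ γ) v`, of the
error made by `γ`, and of terms quadratic in `v`. Since `v` has order `d + 2`, division
by `D` turns this equation into a contraction of the space of formal power series, and its fixed
point `v` exists for all `c`. The coefficients of `v` of degree `k` depend on those of `c` of degree
at most `k + s`, with `s` independent of `k` (`hasCoeffs_fixPt`).

For the bounds, the division by `D` must be bounded independently of the degree. By
`exists_dominant_monomial`, one monomial of `D` dominates the others on a polydisc with well-chosen
ratios of the radii, and the division is a perturbation of the division by this monomial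
(`exists_division`). On a polydisc of size `r` the contraction then maps the ball of radius
`r ^ (d + 1)` to itself if `r` is small, uniformly in `c` (`unifBdd_fixPt`). Norms are weighted
`ℓ¹`-norms of the coefficients; passing to them and back is possible by Cauchy's estimates, and the
choice of the polydisc is immaterial because radii may be shrunk by a common factor, which only
changes the constant `K`.

Coefficients of `w ∘ λ` lie in the algebra generated by the entries of `λ` and `λ⁻¹` and by the jet
coordinates of `b` (`exists_solution_family`), and functions in this algebra become polynomials after
multiplication by a power of `det λ`. The coefficients of degree one are the entries of `λ`.
-/

namespace JetParam
open MvPowerSeries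

/-! ### Orders of formal power series and substitution -/

section OrderIdeal
variable {σ τ : Type*}

/-- The ideal of formal power series all of whose monomials have weight at least `k`, for an
additive weight `w` on exponents. -/
def wtIdeal (w : (σ →₀ ℕ) →+ ℕ) (k : ℕ) : Ideal (MvPowerSeries σ ℂ) where
  carrier := {f | ∀ β : σ →₀ ℕ, w β < k → coeff β f = 0}
  add_mem' := by
    intro f g hf hg β hβ
    simp [hf β hβ, hg β hβ]
  zero_mem' := by
    intro β _
    simp
  smul_mem' := by
    classical
    intro c f hf β hβ
    rw [smul_eq_mul, coeff_mul]
    refine Finset.sum_eq_zero fun p hp => ?_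
    rw [hf p.2, mul_zero]
    have := Finset.HasAntidiagonal.mem_antidiagonal.1 hp
    rw [← this, map_add] at hβ
    omega

theorem mul_mem_wtIdeal {w : (σ →₀ ℕ) →+ ℕ} {k l : ℕ} {f g : MvPowerSeries σ ℂ}
    (hf : f ∈ wtIdeal w k) (hg : g ∈ wtIdeal w l) : f * g ∈ wtIdeal w (k + l) := by
  classical
  intro β hβ
  rw [coeff_mul]
  refine Finset.sum_eq_zero fun p hp => ?_
  have := Finset.HasAntidiagonal.mem_antidiagonal.1 hp
  rw [← this, map_add] at hβ
  rcases lt_or_ge (w p.1) k with h | h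
  · rw [hf _ h, zero_mul]
  · rw [hg _ (by omega), mul_zero]

/-- The ideal of formal power series all of whose monomials have degree at least `k`. -/
abbrev ordIdeal (σ : Type*) (k : ℕ) : Ideal (MvPowerSeries σ ℂ) := wtIdeal Finsupp.degree k

theorem ordIdeal_mono {k l : ℕ} (h : k ≤ l) {f : MvPowerSeries σ ℂ} (hf : f ∈ ordIdeal σ l) :
    f ∈ ordIdeal σ k := fun β hβ => hf β (by omega)

theorem mul_mem_ordIdeal {k l : ℕ} {f g : MvPowerSeries σ ℂ} (hf : f ∈ ordIdeal σ k)
    (hg : g ∈ ordIdeal σ l) : f * g ∈ ordIdeal σ (k + l) := mul_mem_wtIdeal hf hg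

theorem mem_ordIdeal_zero (f : MvPowerSeries σ ℂ) : f ∈ ordIdeal σ 0 := by
  intro β hβ
  simp at hβ

theorem smul_mem_ordIdeal {k : ℕ} {f : MvPowerSeries σ ℂ} (c : ℂ) (hf : f ∈ ordIdeal σ k) :
    c • f ∈ ordIdeal σ k := by
  intro β hβ
  simp [hf β hβ]

theorem eq_zero_of_forall_mem_ordIdeal {f : MvPowerSeries σ ℂ} (h : ∀ k, f ∈ ordIdeal σ k) :
    f = 0 := by
  ext β
  exact h (β.degree + 1) β (Nat.lt_succ_self _)

theorem mem_ordIdeal_one {f : MvPowerSeries σ ℂ} :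
    f ∈ ordIdeal σ 1 ↔ constantCoeff f = 0 := by
  constructor
  · intro h
    simpa using h 0 (by simp)
  · intro h β hβ
    have : β = 0 := by
      rw [Nat.lt_one_iff] at hβ
      exact (Finsupp.degree_eq_zero_iff β).1 hβ
    simpa [this] using h

theorem X_mem_ordIdeal_one (i : σ) : (X i : MvPowerSeries σ ℂ) ∈ ordIdeal σ 1 := by
  rw [mem_ordIdeal_one]; simp

theorem hasSubst_of_mem [Finite σ] {a : σ → MvPowerSeries τ ℂ} (ha : ∀ i, a i ∈ ordIdeal τ 1) :
    HasSubst a := hasSubst_of_constantCoeff_zero fun i => mem_ordIdeal_one.1 (ha i)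

theorem monomial_prod_add (a : σ → MvPowerSeries τ ℂ) (d e : σ →₀ ℕ) :
    ((d + e).prod fun i m => a i ^ m) = (d.prod fun i m => a i ^ m) * e.prod fun i m => a i ^ m :=
  Finsupp.prod_add_index' (by simp) (by simp [pow_add])

theorem prod_pow_mem_ordIdeal {a : σ → MvPowerSeries τ ℂ} (ha : ∀ i, a i ∈ ordIdeal τ 1)
    (d : σ →₀ ℕ) : (d.prod fun i m => a i ^ m) ∈ ordIdeal τ d.degree := by
  induction d using Finsupp.induction_linear with
  | zero => simpa using mem_ordIdeal_zero _
  | add d e hd he =>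
    rw [monomial_prod_add, map_add]
    exact mul_mem_ordIdeal hd he
  | single i m =>
    rw [Finsupp.prod_single_index (by simp), Finsupp.degree_single]
    induction m with
    | zero => exact mem_ordIdeal_zero _
    | succ m ih => rw [pow_succ]; exact mul_mem_ordIdeal ih (ha i)

theorem prod_pow_sub_mem_ordIdeal {k : ℕ} {a b : σ → MvPowerSeries τ ℂ}
    (ha : ∀ i, a i ∈ ordIdeal τ 1) (hb : ∀ i, b i ∈ ordIdeal τ 1)
    (hab : ∀ i, a i - b i ∈ ordIdeal τ (k + 1)) (d : σ →₀ ℕ) :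
    (d.prod fun i m => a i ^ m) - (d.prod fun i m => b i ^ m) ∈ ordIdeal τ (k + d.degree) := by
  induction d using Finsupp.induction_linear with
  | zero => simp
  | add d e hd he =>
    rw [monomial_prod_add, monomial_prod_add, map_add]
    have h1 := mul_mem_ordIdeal (prod_pow_mem_ordIdeal ha d) he
    have h2 := mul_mem_ordIdeal hd (prod_pow_mem_ordIdeal hb e)
    have h3 := Ideal.add_mem _ (ordIdeal_mono (k := k + (d.degree + e.degree)) (by omega) h1)
      (ordIdeal_mono (k := k + (d.degree + e.degree)) (by omega) h2)
    convert h3 using 1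
    ring
  | single i m =>
    rw [Finsupp.prod_single_index (by simp), Finsupp.prod_single_index (by simp),
      Finsupp.degree_single]
    induction m with
    | zero => simp
    | succ m ih =>
      have hbm : b i ^ m ∈ ordIdeal τ m := by
        simpa [Finsupp.prod_single_index] using prod_pow_mem_ordIdeal hb (Finsupp.single i m)
      have h1 := mul_mem_ordIdeal ih (ha i)
      have h2 := mul_mem_ordIdeal hbm (hab i)
      have h3 := Ideal.add_mem _ (ordIdeal_mono (k := k + (m + 1)) (by omega) h1)
        (ordIdeal_mono (k := k + (m + 1)) (by omega) h2)
      convert h3 using 1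
      ring

theorem subst_mem_ordIdeal [Finite σ] {k : ℕ} {a : σ → MvPowerSeries τ ℂ}
    (ha : ∀ i, a i ∈ ordIdeal τ 1) {f : MvPowerSeries σ ℂ} (hf : f ∈ ordIdeal σ k) :
    subst a f ∈ ordIdeal τ k := by
  intro β hβ
  rw [coeff_subst (hasSubst_of_mem ha)]
  refine finsum_eq_zero_of_forall_eq_zero fun d => ?_
  rcases lt_or_ge d.degree k with h | h
  · rw [hf d h, zero_smul]
  · rw [prod_pow_mem_ordIdeal ha d β (by omega), smul_zero]

/-- Two substitutions that agree up to order `k + 1` produce from a series of order `l` series that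
agree up to order `k + l`: one factor of each monomial carries the difference. -/
theorem subst_sub_subst_mem_ordIdeal [Finite σ] {k l : ℕ} {a b : σ → MvPowerSeries τ ℂ}
    (ha : ∀ i, a i ∈ ordIdeal τ 1) (hb : ∀ i, b i ∈ ordIdeal τ 1)
    (hab : ∀ i, a i - b i ∈ ordIdeal τ (k + 1)) {f : MvPowerSeries σ ℂ} (hf : f ∈ ordIdeal σ l) :
    subst a f - subst b f ∈ ordIdeal τ (k + l) := by
  intro β hβ
  rw [map_sub, coeff_subst (hasSubst_of_mem ha), coeff_subst (hasSubst_of_mem hb),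
    ← finsum_sub_distrib (coeff_subst_finite (hasSubst_of_mem ha) f β)
      (coeff_subst_finite (hasSubst_of_mem hb) f β)]
  refine finsum_eq_zero_of_forall_eq_zero fun d => ?_
  rw [← smul_sub, ← map_sub]
  rcases lt_or_ge d.degree l with h | h
  · rw [hf d h, zero_smul]
  · rw [prod_pow_sub_mem_ordIdeal ha hb hab d β (by omega), smul_zero]

/-- Substitutions that agree up to order `k` give results that agree up to order `k`. -/
theorem subst_sub_subst_mem [Finite σ] {k : ℕ} {a b : σ → MvPowerSeries τ ℂ}
    (ha : ∀ i, a i ∈ ordIdeal τ 1) (hb : ∀ i, b i ∈ ordIdeal τ 1)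
    (hab : ∀ i, a i - b i ∈ ordIdeal τ k) (f : MvPowerSeries σ ℂ) :
    subst a f - subst b f ∈ ordIdeal τ k := by
  cases k with
  | zero => exact mem_ordIdeal_zero _
  | succ k =>
    -- the constant term of `f` does not contribute to the difference
    have h : f - C (constantCoeff f) ∈ ordIdeal σ 1 := by
      rw [mem_ordIdeal_one]; simp
    have := subst_sub_subst_mem_ordIdeal ha hb hab h
    rw [subst_sub (hasSubst_of_mem ha), subst_sub (hasSubst_of_mem hb)] at this
    have hC : ∀ {c : σ → MvPowerSeries τ ℂ} (_ : HasSubst c) (r : ℂ),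
        subst c (C r : MvPowerSeries σ ℂ) = C r := by
      intro c hc r
      rw [← coe_substAlgHom hc]
      exact (substAlgHom hc).commutes r
    rw [hC (hasSubst_of_mem ha), hC (hasSubst_of_mem hb)] at this
    convert this using 1
    ring

/-- The finite set of exponents of degree at most `k`. -/
noncomputable def lowDegrees (σ : Type*) [Finite σ] (k : ℕ) : Finset (σ →₀ ℕ) :=
  (Finsupp.finite_of_degree_le (σ := σ) k).toFinset

theorem mem_lowDegrees [Finite σ] {k : ℕ} {d : σ →₀ ℕ} : d ∈ lowDegrees σ k ↔ d.degree ≤ k := by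
  simp [lowDegrees]

theorem coeff_subst_eq_sum [Finite σ] {a : σ → MvPowerSeries τ ℂ}
    (ha : ∀ i, a i ∈ ordIdeal τ 1) (f : MvPowerSeries σ ℂ) (β : τ →₀ ℕ) :
    coeff β (subst a f) = ∑ d ∈ lowDegrees σ β.degree,
      coeff d f * coeff β (d.prod fun i m => a i ^ m) := by
  rw [coeff_subst (hasSubst_of_mem ha)]
  refine finsum_eq_sum_of_support_subset _ ?_
  intro d hd
  rw [Finset.mem_coe, mem_lowDegrees]
  by_contra h
  exact hd (by
    change coeff d f • coeff β (d.prod fun i m => a i ^ m) = 0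
    rw [prod_pow_mem_ordIdeal ha d β (by omega), smul_zero])

theorem subst_C_of_mem [Finite σ] {a : σ → MvPowerSeries τ ℂ}
    (ha : ∀ i, a i ∈ ordIdeal τ 1) (r : ℂ) : subst a (C r : MvPowerSeries σ ℂ) = C r := by
  rw [← coe_substAlgHom (hasSubst_of_mem ha)]
  exact (substAlgHom (hasSubst_of_mem ha)).commutes r

end OrderIdeal

/-! ### Weighted ℓ¹-norms of formal power series -/

section WeightedNorm
variable {σ τ : Type*}

/-- The monomial `ω ^ β` in the weights `ω`. -/
noncomputable def wmon (ω : σ → ℝ≥0∞) (β : σ →₀ ℕ) : ℝ≥0∞ := β.prod fun i e => ω i ^ e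

theorem wmon_add (ω : σ → ℝ≥0∞) (β γ : σ →₀ ℕ) : wmon ω (β + γ) = wmon ω β * wmon ω γ :=
  Finsupp.prod_add_index' (by simp) (by simp [pow_add])

theorem wmon_zero (ω : σ → ℝ≥0∞) : wmon ω 0 = 1 := by simp [wmon]

theorem wmon_single (ω : σ → ℝ≥0∞) (i : σ) (e : ℕ) : wmon ω (Finsupp.single i e) = ω i ^ e := by
  simp [wmon]

theorem wmon_mono {ω ω' : σ → ℝ≥0∞} (h : ∀ i, ω i ≤ ω' i) (β : σ →₀ ℕ) :
    wmon ω β ≤ wmon ω' β :=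
  Finset.prod_le_prod' fun i _ => pow_le_pow_left' (h i) _

theorem wmon_scale (r : ℝ≥0∞) (ω : σ → ℝ≥0∞) (β : σ →₀ ℕ) :
    wmon (fun i => r * ω i) β = r ^ β.degree * wmon ω β := by
  simp only [wmon, Finsupp.prod, mul_pow, Finset.prod_mul_distrib, Finset.prod_pow_eq_pow_sum]
  rfl

/-- The weighted `ℓ¹`-norm `∑ |f_β| ω ^ β` of a formal power series; it majorizes the sup norm of
`f` on the polydisc of multiradius `ω`. -/
noncomputable def wnorm (ω : σ → ℝ≥0∞) (f : MvPowerSeries σ ℂ) : ℝ≥0∞ :=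
  ∑' β, ‖coeff β f‖ₑ * wmon ω β

theorem wnorm_mono {ω ω' : σ → ℝ≥0∞} (h : ∀ i, ω i ≤ ω' i) (f : MvPowerSeries σ ℂ) :
    wnorm ω f ≤ wnorm ω' f :=
  ENNReal.tsum_le_tsum fun β => mul_le_mul_right (wmon_mono h β) _

theorem wnorm_zero (ω : σ → ℝ≥0∞) : wnorm ω 0 = 0 := by simp [wnorm]

theorem wnorm_add_le (ω : σ → ℝ≥0∞) (f g : MvPowerSeries σ ℂ) :
    wnorm ω (f + g) ≤ wnorm ω f + wnorm ω g := by
  rw [wnorm, wnorm, wnorm, ← ENNReal.tsum_add]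
  refine ENNReal.tsum_le_tsum fun β => ?_
  rw [← add_mul, map_add]
  exact mul_le_mul_left (enorm_add_le _ _) _

theorem wnorm_neg (ω : σ → ℝ≥0∞) (f : MvPowerSeries σ ℂ) : wnorm ω (-f) = wnorm ω f := by
  simp [wnorm]

theorem wnorm_sub_le (ω : σ → ℝ≥0∞) (f g : MvPowerSeries σ ℂ) :
    wnorm ω (f - g) ≤ wnorm ω f + wnorm ω g := by
  rw [sub_eq_add_neg, ← wnorm_neg ω g]
  exact wnorm_add_le _ _ _

theorem wnorm_sum_le {ι : Type*} (ω : σ → ℝ≥0∞) (s : Finset ι) (f : ι → MvPowerSeries σ ℂ) :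
    wnorm ω (∑ i ∈ s, f i) ≤ ∑ i ∈ s, wnorm ω (f i) := by
  classical
  induction s using Finset.induction_on with
  | empty => simp [wnorm_zero]
  | insert i s hi ih =>
    rw [Finset.sum_insert hi, Finset.sum_insert hi]
    exact (wnorm_add_le _ _ _).trans (add_le_add_right ih _)

theorem wnorm_monomial (ω : σ → ℝ≥0∞) (β : σ →₀ ℕ) (c : ℂ) :
    wnorm ω (monomial β c) = ‖c‖ₑ * wmon ω β := by
  classical
  rw [wnorm, tsum_eq_single β]
  · rw [coeff_monomial_same]
  · intro γ h
    rw [coeff_monomial_ne h]; simp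

theorem wnorm_one (ω : σ → ℝ≥0∞) : wnorm ω (1 : MvPowerSeries σ ℂ) = 1 := by
  have := wnorm_monomial ω 0 1
  rw [wmon_zero] at this
  simpa using this

theorem wnorm_X (ω : σ → ℝ≥0∞) (i : σ) : wnorm ω (X i : MvPowerSeries σ ℂ) = ω i := by
  have := wnorm_monomial ω (Finsupp.single i 1) 1
  rw [wmon_single] at this
  simpa [X] using this

theorem wnorm_mul_le (ω : σ → ℝ≥0∞) (f g : MvPowerSeries σ ℂ) :
    wnorm ω (f * g) ≤ wnorm ω f * wnorm ω g := by
  classical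
  have key : wnorm ω f * wnorm ω g = ∑' β : σ →₀ ℕ, ∑ p ∈ Finset.HasAntidiagonal.antidiagonal β,
      (‖coeff p.1 f‖ₑ * wmon ω p.1) * (‖coeff p.2 g‖ₑ * wmon ω p.2) := by
    rw [wnorm, wnorm, ← ENNReal.tsum_mul_right]
    simp_rw [← ENNReal.tsum_mul_left]
    rw [← ENNReal.tsum_prod (f := fun a b => (‖coeff a f‖ₑ * wmon ω a) * (‖coeff b g‖ₑ * wmon ω b)),
      ← Finset.HasAntidiagonal.sigmaAntidiagonalEquivProd.tsum_eq, ENNReal.tsum_sigma']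
    refine tsum_congr fun β => ?_
    rw [tsum_fintype]
    exact Finset.sum_coe_sort (Finset.HasAntidiagonal.antidiagonal β) fun p =>
      (‖coeff p.1 f‖ₑ * wmon ω p.1) * (‖coeff p.2 g‖ₑ * wmon ω p.2)
  rw [key]
  refine ENNReal.tsum_le_tsum fun β => ?_
  rw [coeff_mul]
  refine (mul_le_mul_left (enorm_sum_le _ _) _).trans ?_
  rw [Finset.sum_mul]
  refine Finset.sum_le_sum fun p hp => ?_
  rw [← Finset.HasAntidiagonal.mem_antidiagonal.1 hp, wmon_add, enorm_mul]
  exact le_of_eq (by ring)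

theorem wnorm_smul (ω : σ → ℝ≥0∞) (c : ℂ) (f : MvPowerSeries σ ℂ) :
    wnorm ω (c • f) = ‖c‖ₑ * wnorm ω f := by
  rw [wnorm, wnorm, ← ENNReal.tsum_mul_left]
  refine tsum_congr fun β => ?_
  rw [coeff_smul, enorm_mul, mul_assoc]

theorem wnorm_pow_le (ω : σ → ℝ≥0∞) (f : MvPowerSeries σ ℂ) (m : ℕ) :
    wnorm ω (f ^ m) ≤ wnorm ω f ^ m := by
  induction m with
  | zero => simp [wnorm_one]
  | succ m ih =>
    rw [pow_succ, pow_succ]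
    exact (wnorm_mul_le _ _ _).trans (mul_le_mul_left ih _)

theorem wnorm_prod_le {ι : Type*} (ω : σ → ℝ≥0∞) (s : Finset ι) (f : ι → MvPowerSeries σ ℂ) :
    wnorm ω (∏ i ∈ s, f i) ≤ ∏ i ∈ s, wnorm ω (f i) := by
  classical
  induction s using Finset.induction_on with
  | empty => simp [wnorm_one]
  | insert i s hi ih =>
    rw [Finset.prod_insert hi, Finset.prod_insert hi]
    exact (wnorm_mul_le _ _ _).trans (mul_le_mul_right ih _)

/-- Composition is controlled by the norms of the inner series, used as weights for the outer one.
-/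
theorem wnorm_subst_le [Finite σ] (ω : τ → ℝ≥0∞) {a : σ → MvPowerSeries τ ℂ}
    (ha : ∀ i, a i ∈ ordIdeal τ 1) (f : MvPowerSeries σ ℂ) :
    wnorm ω (subst a f) ≤ wnorm (fun i => wnorm ω (a i)) f := by
  calc wnorm ω (subst a f)
      ≤ ∑' β, ∑' d, ‖coeff d f‖ₑ * (‖coeff β (d.prod fun i m => a i ^ m)‖ₑ * wmon ω β) := by
        refine ENNReal.tsum_le_tsum fun β => ?_
        rw [coeff_subst_eq_sum ha]
        refine (mul_le_mul_left (enorm_sum_le _ _) _).trans ?_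
        rw [Finset.sum_mul]
        refine le_trans (le_of_eq ?_) (ENNReal.sum_le_tsum (lowDegrees σ β.degree))
        refine Finset.sum_congr rfl fun d _ => ?_
        rw [enorm_mul, mul_assoc]
    _ = ∑' d, ‖coeff d f‖ₑ * wnorm ω (d.prod fun i m => a i ^ m) := by
        rw [ENNReal.tsum_comm]
        exact tsum_congr fun d => ENNReal.tsum_mul_left
    _ ≤ _ := by
        refine ENNReal.tsum_le_tsum fun d => mul_le_mul_right ?_ _
        refine (wnorm_prod_le _ _ _).trans ?_
        exact Finset.prod_le_prod' fun i _ => wnorm_pow_le _ _ _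

/-- The Schwarz lemma: on the polydisc shrunk by `r`, a series of order `k` gains the factor `r ^
k`. -/
theorem wnorm_scale_le {ω : σ → ℝ≥0∞} {k : ℕ} {r : ℝ≥0∞} (hr : r ≤ 1) {f : MvPowerSeries σ ℂ}
    (hf : f ∈ ordIdeal σ k) : wnorm (fun i => r * ω i) f ≤ r ^ k * wnorm ω f := by
  rw [wnorm, wnorm, ← ENNReal.tsum_mul_left]
  refine ENNReal.tsum_le_tsum fun β => ?_
  rcases lt_or_ge β.degree k with h | h
  · simp [hf β h]
  · rw [wmon_scale, mul_left_comm]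
    exact mul_le_mul_left (pow_le_pow_right_of_le_one' hr h) _

end WeightedNorm

/-! ### The second order Taylor formula for formal power series -/

section Taylor
variable {σ τ : Type*}

/-- The degree of a monomial in the second group of variables. -/
noncomputable def ydeg (σ : Type*) : ((σ ⊕ σ) →₀ ℕ) →+ ℕ :=
  Finsupp.weight (Sum.elim (fun _ => 0) (fun _ => 1))

theorem ydeg_single_inr (j : σ) (e : ℕ) : ydeg σ (Finsupp.single (Sum.inr j) e) = e := by
  simp [ydeg, Finsupp.weight_single]

theorem exists_inr_ne_zero {m : (σ ⊕ σ) →₀ ℕ} (h : 1 ≤ ydeg σ m) : ∃ j, m (Sum.inr j) ≠ 0 := by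
  by_contra! hc
  have : ydeg σ m = 0 := by
    rw [ydeg, Finsupp.weight_apply, Finsupp.sum]
    refine Finset.sum_eq_zero fun i _ => ?_
    rcases i with i | i
    · simp
    · simp [hc i]
  omega

/-- A power series without terms free of the second variables `y` is a combination `∑ y_j G_j`,
where each monomial of the series is assigned to just one `j`, so that no norm grows. -/
theorem exists_eq_sum_X_mul [Fintype σ] {k : ℕ} {G : MvPowerSeries (σ ⊕ σ) ℂ}
    (hG : G ∈ wtIdeal (ydeg σ) (k + 1)) :
    ∃ H : σ → MvPowerSeries (σ ⊕ σ) ℂ, (∀ j, H j ∈ wtIdeal (ydeg σ) k) ∧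
      G = ∑ j, X (Sum.inr j) * H j ∧
      ∀ (ω : σ ⊕ σ → ℝ≥0∞) (j : σ), wnorm ω (H j) * ω (Sum.inr j) ≤ wnorm ω G := by
  classical
  have hch : ∀ m : (σ ⊕ σ) →₀ ℕ, ∃ j : Option σ, 1 ≤ ydeg σ m →
      ∃ i, j = some i ∧ m (Sum.inr i) ≠ 0 := by
    intro m
    by_cases h : 1 ≤ ydeg σ m
    · obtain ⟨i, hi⟩ := exists_inr_ne_zero h
      exact ⟨some i, fun _ => ⟨i, rfl, hi⟩⟩
    · exact ⟨none, fun h' => absurd h' h⟩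
  choose c hc using hch
  let e : σ → ((σ ⊕ σ) →₀ ℕ) := fun j => Finsupp.single (Sum.inr j) 1
  let H : σ → MvPowerSeries (σ ⊕ σ) ℂ := fun j m =>
    if c (m + e j) = some j then coeff (m + e j) G else 0
  have hH : ∀ j m, coeff m (H j) = if c (m + e j) = some j then coeff (m + e j) G else 0 :=
    fun j m => rfl
  refine ⟨H, ?_, ?_, ?_⟩
  · intro j m hm
    rw [hH]
    split_ifs
    · refine hG _ ?_
      rw [map_add, ydeg_single_inr]
      omega
    · rfl
  · ext m
    rw [map_sum]
    have hterm : ∀ j, coeff m (X (Sum.inr j) * H j) =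
        if c m = some j ∧ m (Sum.inr j) ≠ 0 then coeff m G else 0 := by
      intro j
      rw [X, coeff_monomial_mul, one_mul]
      by_cases hle : Finsupp.single (Sum.inr j) 1 ≤ m
      · have h1 : m - e j + e j = m := tsub_add_cancel_of_le hle
        have h2 : m (Sum.inr j) ≠ 0 := by
          rw [Finsupp.single_le_iff] at hle
          omega
        rw [if_pos hle, hH, h1]
        simp [h2]
      · have h2 : m (Sum.inr j) = 0 := by
          rw [Finsupp.single_le_iff] at hle
          omega
        rw [if_neg hle]
        simp [h2]
    simp_rw [hterm]
    by_cases hm : 1 ≤ ydeg σ m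
    · obtain ⟨i, hi, hi'⟩ := hc m hm
      rw [Finset.sum_eq_single i]
      · simp [hi, hi']
      · intro j _ hj
        rw [if_neg]
        rintro ⟨h, _⟩
        rw [hi] at h
        exact hj (Option.some.inj h).symm
      · simp
    · have : coeff m G = 0 := hG m (by omega)
      simp [this]
  · intro ω j
    rw [wnorm, wnorm, ← ENNReal.tsum_mul_right]
    have hinj : Function.Injective fun m : (σ ⊕ σ) →₀ ℕ => m + e j := add_left_injective _
    refine le_trans (ENNReal.tsum_le_tsum fun m => ?_)
      (ENNReal.tsum_comp_le_tsum_of_injective hinj fun m => ‖coeff m G‖ₑ * wmon ω m)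
    rw [wmon_add, wmon_single, pow_one, hH, mul_assoc]
    refine mul_le_mul_left ?_ _
    split_ifs <;> simp

/-- The two-variable series `f(x + y)`. -/
noncomputable def shift [Finite σ] (f : MvPowerSeries σ ℂ) : MvPowerSeries (σ ⊕ σ) ℂ :=
  subst (fun i => (X (Sum.inl i) + X (Sum.inr i) : MvPowerSeries (σ ⊕ σ) ℂ)) f

/-- The series `f(x)` in the variables `(x, y)`. -/
noncomputable def inX [Finite σ] (f : MvPowerSeries σ ℂ) : MvPowerSeries (σ ⊕ σ) ℂ :=
  subst (fun i => (X (Sum.inl i) : MvPowerSeries (σ ⊕ σ) ℂ)) f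

theorem X_add_X_mem (i : σ) :
    (X (Sum.inl i) + X (Sum.inr i) : MvPowerSeries (σ ⊕ σ) ℂ) ∈ ordIdeal (σ ⊕ σ) 1 :=
  Ideal.add_mem _ (X_mem_ordIdeal_one _) (X_mem_ordIdeal_one _)

theorem pderiv_mem_ordIdeal {k : ℕ} {f : MvPowerSeries σ ℂ} (j : σ) (hf : f ∈ ordIdeal σ (k + 1)) :
    pderiv ℂ j f ∈ ordIdeal σ k := by
  intro β hβ
  rw [coeff_pderiv, hf, zero_mul]
  rw [map_add, Finsupp.degree_single]
  omega

/-- The second order Taylor remainder `f(x + y) - f(x) - ∑ y_j ∂_j f(x)`. -/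
noncomputable def taylorRem [Fintype σ] (f : MvPowerSeries σ ℂ) : MvPowerSeries (σ ⊕ σ) ℂ :=
  shift f - inX f - ∑ j, X (Sum.inr j) * inX (pderiv ℂ j f)

theorem X_inr_mem_wtIdeal (j : σ) :
    (X (Sum.inr j) : MvPowerSeries (σ ⊕ σ) ℂ) ∈ wtIdeal (ydeg σ) 1 := by
  classical
  intro m hm
  rw [coeff_X, if_neg]
  rintro rfl
  rw [ydeg_single_inr] at hm
  omega

theorem taylorRem_coe_mem [Fintype σ] (p : MvPolynomial σ ℂ) :
    taylorRem (p : MvPowerSeries σ ℂ) ∈ wtIdeal (ydeg σ) 2 := by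
  classical
  have hS : HasSubst (fun i => (X (Sum.inl i) + X (Sum.inr i) : MvPowerSeries (σ ⊕ σ) ℂ)) :=
    hasSubst_of_mem X_add_X_mem
  have hI : HasSubst (fun i => (X (Sum.inl i) : MvPowerSeries (σ ⊕ σ) ℂ)) :=
    hasSubst_of_mem fun i => X_mem_ordIdeal_one _
  induction p using MvPolynomial.induction_on with
  | C a =>
    have : taylorRem ((MvPolynomial.C a : MvPolynomial σ ℂ) : MvPowerSeries σ ℂ) = 0 := by
      have hz : ∀ j, pderiv ℂ j (C a : MvPowerSeries σ ℂ) = 0 := by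
        intro j
        simp
      rw [taylorRem, MvPolynomial.coe_C, shift, inX, subst_C_of_mem X_add_X_mem,
        subst_C_of_mem fun i => X_mem_ordIdeal_one _, sub_self, zero_sub, neg_eq_zero]
      refine Finset.sum_eq_zero fun j _ => ?_
      rw [hz, inX, ← coe_substAlgHom hI, map_zero, mul_zero]
    rw [this]
    exact Ideal.zero_mem _
  | add p q hp hq =>
    have := Ideal.add_mem _ hp hq
    convert this using 1
    rw [taylorRem, taylorRem, taylorRem, shift, shift, shift, MvPolynomial.coe_add, subst_add hS]
    simp only [inX, subst_add hI, map_add, mul_add, Finset.sum_add_distrib]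
    ring
  | mul_X p i hp =>
    have h1 : shift (p : MvPowerSeries σ ℂ) - inX (p : MvPowerSeries σ ℂ) ∈ wtIdeal (ydeg σ) 1 := by
      have h2 : ∑ j, X (Sum.inr j) * inX (pderiv ℂ j (p : MvPowerSeries σ ℂ)) ∈
          wtIdeal (ydeg σ) 1 :=
        Ideal.sum_mem _ fun j _ => Ideal.mul_mem_right _ _ (X_inr_mem_wtIdeal j)
      have h3 : taylorRem (p : MvPowerSeries σ ℂ) ∈ wtIdeal (ydeg σ) 1 :=
        fun m hm => hp m (by omega)
      have := Ideal.add_mem _ h3 h2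
      rw [taylorRem] at this
      simpa using this
    have h4 : taylorRem ((p * MvPolynomial.X i : MvPolynomial σ ℂ) : MvPowerSeries σ ℂ) =
        taylorRem (p : MvPowerSeries σ ℂ) * X (Sum.inl i) +
          (shift (p : MvPowerSeries σ ℂ) - inX (p : MvPowerSeries σ ℂ)) * X (Sum.inr i) := by
      have hd : ∀ j, pderiv ℂ j ((p : MvPowerSeries σ ℂ) * X i) =
          (p : MvPowerSeries σ ℂ) * (if i = j then 1 else 0) +
            X i * pderiv ℂ j (p : MvPowerSeries σ ℂ) := by
        intro j
        rw [Derivation.leibniz, smul_eq_mul, smul_eq_mul, pderiv_X, Pi.single_apply]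
      rw [taylorRem, taylorRem, MvPolynomial.coe_mul, MvPolynomial.coe_X]
      simp only [hd, shift, inX, subst_mul hS, subst_mul hI, subst_X hS, subst_X hI,
        subst_add hI, mul_add, Finset.sum_add_distrib]
      have h5 : ∑ j, (X (Sum.inr j) : MvPowerSeries (σ ⊕ σ) ℂ) *
          (subst (fun i => (X (Sum.inl i) : MvPowerSeries (σ ⊕ σ) ℂ)) (p : MvPowerSeries σ ℂ) *
            subst (fun i => (X (Sum.inl i) : MvPowerSeries (σ ⊕ σ) ℂ))
              (if i = j then 1 else 0 : MvPowerSeries σ ℂ)) =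
          X (Sum.inr i) * subst (fun i => (X (Sum.inl i) : MvPowerSeries (σ ⊕ σ) ℂ))
            (p : MvPowerSeries σ ℂ) := by
        rw [Finset.sum_eq_single i]
        · rw [if_pos rfl, ← coe_substAlgHom hI, map_one, mul_one]
        · intro j _ hj
          rw [if_neg (Ne.symm hj), ← coe_substAlgHom hI, map_zero, mul_zero, mul_zero]
        · simp
      have h6 : ∀ j, (X (Sum.inr j) : MvPowerSeries (σ ⊕ σ) ℂ) * (X (Sum.inl i) *
          subst (fun i => (X (Sum.inl i) : MvPowerSeries (σ ⊕ σ) ℂ))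
            (pderiv ℂ j (p : MvPowerSeries σ ℂ))) = (X (Sum.inr j) *
          subst (fun i => (X (Sum.inl i) : MvPowerSeries (σ ⊕ σ) ℂ))
            (pderiv ℂ j (p : MvPowerSeries σ ℂ))) * X (Sum.inl i) := fun j => by ring
      simp only [h5, h6, ← Finset.sum_mul]
      ring
    rw [h4]
    exact Ideal.add_mem _ (Ideal.mul_mem_right _ _ hp) (mul_mem_wtIdeal h1 (X_inr_mem_wtIdeal i))

theorem sub_truncTotal_mem [Finite σ] (k : ℕ) (f : MvPowerSeries σ ℂ) :
    f - (truncTotal k f : MvPolynomial σ ℂ) ∈ ordIdeal σ k := by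
  intro β hβ
  rw [map_sub, MvPolynomial.coeff_coe, coeff_truncTotal _ hβ, sub_self]

theorem taylorRem_mem [Fintype σ] (f : MvPowerSeries σ ℂ) :
    taylorRem f ∈ wtIdeal (ydeg σ) 2 := by
  have hS : HasSubst (fun i => (X (Sum.inl i) + X (Sum.inr i) : MvPowerSeries (σ ⊕ σ) ℂ)) :=
    hasSubst_of_mem X_add_X_mem
  have hI : HasSubst (fun i => (X (Sum.inl i) : MvPowerSeries (σ ⊕ σ) ℂ)) :=
    hasSubst_of_mem fun i => X_mem_ordIdeal_one _
  intro m hm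
  -- the coefficient only depends on a truncation of `f`
  set p := truncTotal (m.degree + 2) f with hp
  have h1 : taylorRem f = taylorRem (p : MvPowerSeries σ ℂ) +
      taylorRem (f - (p : MvPowerSeries σ ℂ)) := by
    simp only [taylorRem, shift, inX, subst_sub hS, subst_sub hI, map_sub, mul_sub,
      Finset.sum_sub_distrib]
    ring
  have h2 : taylorRem (f - (p : MvPowerSeries σ ℂ)) ∈ ordIdeal (σ ⊕ σ) (m.degree + 1) := by
    have h3 := sub_truncTotal_mem (m.degree + 2) f
    refine Ideal.sub_mem _ (Ideal.sub_mem _ ?_ ?_) (Ideal.sum_mem _ fun j _ => ?_)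
    · exact subst_mem_ordIdeal X_add_X_mem (ordIdeal_mono (by omega) h3)
    · exact subst_mem_ordIdeal (fun i => X_mem_ordIdeal_one _) (ordIdeal_mono (by omega) h3)
    · exact Ideal.mul_mem_left _ _
        (subst_mem_ordIdeal (fun i => X_mem_ordIdeal_one _) (pderiv_mem_ordIdeal j h3))
  rw [h1, map_add, taylorRem_coe_mem p m hm, h2 m (by omega), add_zero]

theorem coeff_inX_of_ydeg [Finite σ] (f : MvPowerSeries σ ℂ) {m : (σ ⊕ σ) →₀ ℕ}
    (hm : 1 ≤ ydeg σ m) : coeff m (inX f) = 0 := by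
  rw [inX, coeff_subst_eq_sum fun i => X_mem_ordIdeal_one _]
  refine Finset.sum_eq_zero fun d hd => ?_
  clear hd
  have h : (d.prod fun i e => (X (Sum.inl i) : MvPowerSeries (σ ⊕ σ) ℂ) ^ e) =
      monomial (d.mapDomain Sum.inl) 1 := by
    induction d using Finsupp.induction_linear with
    | zero => simp
    | add d e hd he =>
      rw [monomial_prod_add, hd, he, monomial_mul_monomial, Finsupp.mapDomain_add, one_mul]
    | single i e =>
      rw [Finsupp.prod_single_index (by simp), Finsupp.mapDomain_single, X_pow_eq]
  rw [h, coeff_monomial_ne, mul_zero]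
  rintro rfl
  obtain ⟨j, hj⟩ := exists_inr_ne_zero hm
  exact hj (Finsupp.mapDomain_of_notMem_range _ _ (by simp))

/-- The second order Taylor formula for formal power series, with remainder in the Hadamard form
`∑ y_j y_k H_jk(x, y)`. -/
theorem exists_taylor [Fintype σ] (f : MvPowerSeries σ ℂ) :
    ∃ H : σ → σ → MvPowerSeries (σ ⊕ σ) ℂ,
      taylorRem f = ∑ j, ∑ k, X (Sum.inr j) * (X (Sum.inr k) * H j k) ∧
      ∀ (ω : σ ⊕ σ → ℝ≥0∞) (j k : σ),
        wnorm ω (H j k) * ω (Sum.inr k) * ω (Sum.inr j) ≤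
          wnorm (fun i => ω (Sum.inl i) + ω (Sum.inr i)) f := by
  classical
  obtain ⟨G, hG, hGs, hGn⟩ := exists_eq_sum_X_mul (taylorRem_mem f)
  choose H hH hHs hHn using fun j => exists_eq_sum_X_mul (hG j)
  refine ⟨H, ?_, ?_⟩
  · rw [hGs]
    refine Finset.sum_congr rfl fun j _ => ?_
    rw [hHs j, Finset.mul_sum]
  · intro ω j k
    calc wnorm ω (H j k) * ω (Sum.inr k) * ω (Sum.inr j)
        ≤ wnorm ω (G j) * ω (Sum.inr j) := mul_le_mul_left (hHn j ω k) _
      _ ≤ wnorm ω (taylorRem f) := hGn ω j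
      _ ≤ wnorm ω (shift f) := by
        -- the monomials of the remainder are among those of `f(x + y)`
        refine ENNReal.tsum_le_tsum fun m => mul_le_mul_left ?_ _
        rcases lt_or_ge (ydeg σ m) 2 with h | h
        · rw [taylorRem_mem f m h]; simp
        · have : coeff m (taylorRem f) = coeff m (shift f) := by
            rw [taylorRem, map_sub, map_sub, coeff_inX_of_ydeg f (by omega), sub_zero, map_sum,
              Finset.sum_eq_zero, sub_zero]
            intro i _
            rw [X, coeff_monomial_mul]
            split_ifs with hle
            · rw [coeff_inX_of_ydeg, mul_zero]
              have := congrArg (ydeg σ) (tsub_add_cancel_of_le hle)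
              rw [map_add, ydeg_single_inr] at this
              omega
            · rfl
          rw [this]
      _ ≤ _ := by
        refine (wnorm_subst_le ω X_add_X_mem f).trans (wnorm_mono (fun i => ?_) f)
        refine (wnorm_add_le _ _ _).trans ?_
        rw [wnorm_X, wnorm_X]

/-- The Taylor formula for `f(x + y)`, with series substituted for both groups of variables. -/
theorem subst_add_eq [Fintype σ] {f : MvPowerSeries σ ℂ} {H : σ → σ → MvPowerSeries (σ ⊕ σ) ℂ}
    (hH : taylorRem f = ∑ j, ∑ k, X (Sum.inr j) * (X (Sum.inr k) * H j k))
    {x y : σ → MvPowerSeries τ ℂ} (hx : ∀ i, x i ∈ ordIdeal τ 1) (hy : ∀ i, y i ∈ ordIdeal τ 1) :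
    subst (fun i => x i + y i) f = subst x f + ∑ j, y j * subst x (pderiv ℂ j f) +
      ∑ j, ∑ k, y j * (y k * subst (Sum.elim x y) (H j k)) := by
  have hxy : HasSubst (Sum.elim x y) := by
    refine hasSubst_of_mem ?_
    rintro (i | i)
    · exact hx i
    · exact hy i
  have h1 : subst (Sum.elim x y) (shift f) = subst (fun i => x i + y i) f := by
    rw [shift, subst_comp_subst_apply (hasSubst_of_mem X_add_X_mem) hxy]
    simp [subst_add hxy, subst_X hxy]
  have h2 : ∀ g : MvPowerSeries σ ℂ, subst (Sum.elim x y) (inX g) = subst x g := by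
    intro g
    rw [inX, subst_comp_subst_apply (hasSubst_of_mem fun i => X_mem_ordIdeal_one _) hxy]
    simp [subst_X hxy]
  have h3 := congrArg (substAlgHom hxy) hH
  simp only [taylorRem, map_sub, map_sum, map_mul, coe_substAlgHom, h1, h2, subst_X hxy,
    Sum.elim_inr] at h3
  rw [← h3]
  ring

end Taylor

/-! ### Families of power series with coefficients in a filtered algebra -/

section Families
variable {σ τ X : Type*}

/-- A family of power series indexed by `x : X` has, for each exponent `β`, its coefficient at `β`
in the `|β|`-th member of a filtration `F` of the algebra of functions on `X`. -/
def HasCoeffs (F : ℕ → Subalgebra ℂ (X → ℂ)) (f : X → MvPowerSeries σ ℂ) : Prop :=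
  ∀ β, (fun x => coeff β (f x)) ∈ F β.degree

variable {F : ℕ → Subalgebra ℂ (X → ℂ)}

theorem sum_fun_mem {ι : Type*} (S : Subalgebra ℂ (X → ℂ)) (s : Finset ι) {f : ι → X → ℂ}
    (h : ∀ i ∈ s, f i ∈ S) : (fun x => ∑ i ∈ s, f i x) ∈ S := by
  have : (fun x => ∑ i ∈ s, f i x) = ∑ i ∈ s, f i := by
    ext x; simp
  rw [this]
  exact Subalgebra.sum_mem _ h

theorem const_fun_mem (S : Subalgebra ℂ (X → ℂ)) (c : ℂ) : (fun _ => c) ∈ S :=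
  S.algebraMap_mem c

namespace HasCoeffs

theorem const (f : MvPowerSeries σ ℂ) : HasCoeffs F (fun _ => f) := fun _ => const_fun_mem _ _

theorem mono {F' : ℕ → Subalgebra ℂ (X → ℂ)} (h : ∀ k, F k ≤ F' k) {f : X → MvPowerSeries σ ℂ}
    (hf : HasCoeffs F f) : HasCoeffs F' f := fun β => h _ (hf β)

theorem add {f g : X → MvPowerSeries σ ℂ} (hf : HasCoeffs F f) (hg : HasCoeffs F g) :
    HasCoeffs F (fun x => f x + g x) := fun β => by
  simpa using! (F β.degree).add_mem (hf β) (hg β)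

theorem sub {f g : X → MvPowerSeries σ ℂ} (hf : HasCoeffs F f) (hg : HasCoeffs F g) :
    HasCoeffs F (fun x => f x - g x) := fun β => by
  simpa using! (F β.degree).sub_mem (hf β) (hg β)

theorem sum {ι : Type*} (s : Finset ι) {f : ι → X → MvPowerSeries σ ℂ}
    (h : ∀ i ∈ s, HasCoeffs F (f i)) : HasCoeffs F (fun x => ∑ i ∈ s, f i x) := fun β => by
  simpa using! sum_fun_mem (F β.degree) s fun i hi => h i hi β

theorem smul {c : X → ℂ} (hc : ∀ k, c ∈ F k) {f : X → MvPowerSeries σ ℂ} (hf : HasCoeffs F f) :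
    HasCoeffs F (fun x => c x • f x) := fun β => by
  simpa using! (F β.degree).mul_mem (hc _) (hf β)

theorem mul (hF : Monotone F) {f g : X → MvPowerSeries σ ℂ} (hf : HasCoeffs F f)
    (hg : HasCoeffs F g) : HasCoeffs F (fun x => f x * g x) := by
  classical
  intro β
  simp only [coeff_mul]
  refine sum_fun_mem _ _ fun p hp => ?_
  have h : p.1.degree + p.2.degree = β.degree := by
    rw [← map_add, Finset.HasAntidiagonal.mem_antidiagonal.1 hp]
  exact (F β.degree).mul_mem (hF (by omega) (hf p.1)) (hF (by omega) (hg p.2))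

theorem pow (hF : Monotone F) {f : X → MvPowerSeries σ ℂ} (hf : HasCoeffs F f) (m : ℕ) :
    HasCoeffs F (fun x => f x ^ m) := by
  induction m with
  | zero => simpa using const (F := F) (1 : MvPowerSeries σ ℂ)
  | succ m ih => simpa [pow_succ] using ih.mul hF hf

theorem prod (hF : Monotone F) {ι : Type*} (s : Finset ι) {f : ι → X → MvPowerSeries σ ℂ}
    (h : ∀ i ∈ s, HasCoeffs F (f i)) : HasCoeffs F (fun x => ∏ i ∈ s, f i x) := by
  classical
  induction s using Finset.induction_on with
  | empty => simpa using const (F := F) (1 : MvPowerSeries σ ℂ)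
  | insert i s hi ih =>
    simp only [Finset.prod_insert hi]
    exact (h i (by simp)).mul hF (ih fun j hj => h j (by simp [hj]))

theorem subst [Finite σ] (hF : Monotone F) {f : X → MvPowerSeries σ ℂ} (hf : HasCoeffs F f)
    {a : X → σ → MvPowerSeries τ ℂ} (ha : ∀ i, HasCoeffs F (fun x => a x i))
    (ha1 : ∀ x i, a x i ∈ ordIdeal τ 1) :
    HasCoeffs F (fun x => MvPowerSeries.subst (a x) (f x)) := by
  intro β
  simp only [fun x => coeff_subst_eq_sum (ha1 x) (f x) β]
  refine sum_fun_mem _ _ fun d hd => ?_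
  rw [mem_lowDegrees] at hd
  refine (F β.degree).mul_mem (hF hd (hf d)) ?_
  exact (HasCoeffs.prod hF d.support fun i _ => (ha i).pow hF (d i)) β

end HasCoeffs

/-- A product of two families of series of order at least `a` and `b` only involves coefficients
of the factors in degrees lowered by `b` and `a` respectively. -/
theorem coeff_mul_mem_of_ord (hF : Monotone F) {a b : ℕ} {f g : X → MvPowerSeries σ ℂ}
    (hf : HasCoeffs F f) (hg : HasCoeffs F g) (hfa : ∀ x, f x ∈ ordIdeal σ a)
    (hgb : ∀ x, g x ∈ ordIdeal σ b) {β : σ →₀ ℕ} {k : ℕ} (hka : β.degree ≤ k + a)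
    (hkb : β.degree ≤ k + b) : (fun x => coeff β (f x * g x)) ∈ F k := by
  classical
  simp only [coeff_mul]
  refine sum_fun_mem _ _ fun p hp => ?_
  have h : p.1.degree + p.2.degree = β.degree := by
    rw [← map_add, Finset.HasAntidiagonal.mem_antidiagonal.1 hp]
  by_cases h1 : p.1.degree < a
  · simp only [fun x => hfa x p.1 h1, zero_mul]
    exact const_fun_mem _ _
  by_cases h2 : p.2.degree < b
  · simp only [fun x => hgb x p.2 h2, mul_zero]
    exact const_fun_mem _ _
  exact (F k).mul_mem (hF (by omega) (hf p.1)) (hF (by omega) (hg p.2))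

end Families

/-! ### Unipotent formal maps and their complex powers -/

section Unipotent
variable {σ : Type*}

/-- `g` is a formal map tangent to the identity to first order: `g(x) = x + O(|x|²)`. -/
def IsUnip (g : σ → MvPowerSeries σ ℂ) : Prop := ∀ i, g i - X i ∈ ordIdeal σ 2

theorem IsUnip.ord {g : σ → MvPowerSeries σ ℂ} (hg : IsUnip g) (i : σ) : g i ∈ ordIdeal σ 1 := by
  have := Ideal.add_mem _ (ordIdeal_mono (k := 1) (by omega) (hg i)) (X_mem_ordIdeal_one i)
  simpa using this

theorem isUnip_X : IsUnip (fun i : σ => (X i : MvPowerSeries σ ℂ)) := fun i => by simp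

theorem IsUnip.congr {g g' : σ → MvPowerSeries σ ℂ} (hg : IsUnip g) {k : ℕ} (hk : 2 ≤ k)
    (h : ∀ i, g' i - g i ∈ ordIdeal σ k) : IsUnip g' := fun i => by
  have := Ideal.add_mem _ (ordIdeal_mono hk (h i)) (hg i)
  simpa using this

variable [Finite σ]

theorem IsUnip.subst_sub_mem {g : σ → MvPowerSeries σ ℂ} (hg : IsUnip g) {k : ℕ}
    {f : MvPowerSeries σ ℂ} (hf : f ∈ ordIdeal σ k) : subst g f - f ∈ ordIdeal σ (k + 1) := by
  have := subst_sub_subst_mem_ordIdeal (k := 1) hg.ord X_mem_ordIdeal_one hg hf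
  rwa [subst_self, id, add_comm] at this

theorem IsUnip.comp {g h : σ → MvPowerSeries σ ℂ} (hg : IsUnip g) (hh : IsUnip h) :
    IsUnip (fun i => subst h (g i)) := fun i => by
  have h1 := hh.subst_sub_mem (hg.ord i)
  have h2 := Ideal.add_mem _ h1 (hg i)
  simpa using h2

/-- Pullback of power series by `g`, minus the identity, as a linear operator. -/
noncomputable def pullSub {g : σ → MvPowerSeries σ ℂ} (hg : IsUnip g) :
    Module.End ℂ (MvPowerSeries σ ℂ) :=
  (substAlgHom (R := ℂ) (hasSubst_of_mem hg.ord)).toLinearMap - 1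

theorem pullSub_apply {g : σ → MvPowerSeries σ ℂ} (hg : IsUnip g) (f : MvPowerSeries σ ℂ) :
    pullSub hg f = subst g f - f := by
  simp [pullSub]

theorem pullSub_pow_mem {g : σ → MvPowerSeries σ ℂ} (hg : IsUnip g) {k : ℕ}
    {f : MvPowerSeries σ ℂ} (hf : f ∈ ordIdeal σ k) (m : ℕ) :
    (pullSub hg ^ m) f ∈ ordIdeal σ (k + m) := by
  induction m with
  | zero => simpa using hf
  | succ m ih =>
    rw [pow_succ', Module.End.mul_apply, pullSub_apply]
    exact hg.subst_sub_mem ih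

/-- The `m`-th iterate of `g`. -/
noncomputable def iter (g : σ → MvPowerSeries σ ℂ) : ℕ → σ → MvPowerSeries σ ℂ
  | 0 => fun i => X i
  | m + 1 => fun i => subst g (iter g m i)

theorem isUnip_iter {g : σ → MvPowerSeries σ ℂ} (hg : IsUnip g) (m : ℕ) : IsUnip (iter g m) := by
  induction m with
  | zero => exact isUnip_X
  | succ m ih => exact ih.comp hg

theorem iter_eq {g : σ → MvPowerSeries σ ℂ} (hg : IsUnip g) (m : ℕ) (i : σ) :
    iter g m i = ((pullSub hg + 1) ^ m) (X i) := by
  induction m with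
  | zero => simp [iter]
  | succ m ih =>
    rw [pow_succ', Module.End.mul_apply, ← ih]
    simp [iter, pullSub_apply]

/-- The power of `g` with complex exponent `t`, by Newton's binomial series in `pullback - 1`,
cut off at order `N`. It interpolates the iterates of `g` polynomially. -/
noncomputable def flow {g : σ → MvPowerSeries σ ℂ} (hg : IsUnip g) (N : ℕ) (t : ℂ) (i : σ) :
    MvPowerSeries σ ℂ :=
  ∑ k ∈ Finset.range N, ((k ! : ℂ)⁻¹ * (descPochhammer ℂ k).eval t) • (pullSub hg ^ k) (X i)

/-- The functions `ℂ → ℂ` that are polynomials. -/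
noncomputable def polyFun : Subalgebra ℂ (ℂ → ℂ) :=
  (AlgHom.pi fun t : ℂ => Polynomial.aeval t).range

theorem eval_mem_polyFun (p : Polynomial ℂ) : (fun t => p.eval t) ∈ polyFun :=
  ⟨p, by ext t; simp [Polynomial.aeval_def, Polynomial.eval₂_eq_eval_map]⟩

theorem exists_of_mem_polyFun {f : ℂ → ℂ} (hf : f ∈ polyFun) :
    ∃ p : Polynomial ℂ, ∀ t, f t = p.eval t := by
  obtain ⟨p, rfl⟩ := hf
  exact ⟨p, fun t => by simp [Polynomial.aeval_def, Polynomial.eval₂_eq_eval_map]⟩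

/-- Polynomials are determined by their values at the positive integers. As `0` is left out, the
functions may be compared after multiplication by the argument. -/
theorem eq_of_mem_polyFun {f g : ℂ → ℂ} (hf : f ∈ polyFun) (hg : g ∈ polyFun)
    (h : ∀ m : ℕ, f (m + 1) = g (m + 1)) : f = g := by
  obtain ⟨p, hp⟩ := exists_of_mem_polyFun hf
  obtain ⟨q, hq⟩ := exists_of_mem_polyFun hg
  have : p = q := by
    refine Polynomial.eq_of_infinite_eval_eq p q ?_
    refine Set.infinite_of_injective_forall_mem (f := fun m : ℕ => (m : ℂ) + 1) ?_ ?_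
    · intro a b hab
      simpa using hab
    · intro m
      have := h m
      rw [hp, hq] at this
      exact this
  ext t
  rw [hp, hq, this]

theorem flow_hasCoeffs {g : σ → MvPowerSeries σ ℂ} (hg : IsUnip g) (N : ℕ) (i : σ) :
    HasCoeffs (fun _ => polyFun) (fun t => flow hg N t i) := by
  refine HasCoeffs.sum _ fun k _ => HasCoeffs.smul (fun _ => ?_) (HasCoeffs.const _)
  simpa using eval_mem_polyFun (Polynomial.C ((k ! : ℂ)⁻¹) * descPochhammer ℂ k)

/-- At natural exponents the binomial series reproduces the iterates of `g`, up to order `N`. -/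
theorem flow_natCast {g : σ → MvPowerSeries σ ℂ} (hg : IsUnip g) (N m : ℕ) (i : σ) :
    flow hg N m i - iter g m i ∈ ordIdeal σ N := by
  have hcoef : ∀ k : ℕ, (k ! : ℂ)⁻¹ * (descPochhammer ℂ k).eval (m : ℂ) = (m.choose k : ℂ) := by
    intro k
    rw [descPochhammer_eval_eq_descFactorial, Nat.descFactorial_eq_factorial_mul_choose]
    have : (k ! : ℂ) ≠ 0 := by exact_mod_cast k.factorial_ne_zero
    push_cast
    field_simp
  have hit : iter g m i =
      ∑ k ∈ Finset.range (m + 1), (m.choose k : ℂ) • (pullSub hg ^ k) (X i) := by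
    rw [iter_eq hg, (Commute.one_right (pullSub hg)).add_pow, LinearMap.sum_apply]
    refine Finset.sum_congr rfl fun k _ => ?_
    rw [one_pow, mul_one, Nat.cast_smul_eq_nsmul, ← Nat.cast_comm, ← nsmul_eq_mul]
    rfl
  have hmem : ∀ k, N ≤ k → (m.choose k : ℂ) • (pullSub hg ^ k) (X i) ∈ ordIdeal σ N := by
    intro k hk
    exact smul_mem_ordIdeal _
      (ordIdeal_mono (by omega) (pullSub_pow_mem hg (X_mem_ordIdeal_one i) k))
  have hz : ∀ k, m < k → (m.choose k : ℂ) • (pullSub hg ^ k) (X i) = 0 := by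
    intro k hk
    rw [Nat.choose_eq_zero_of_lt hk]; simp
  have hfl : flow hg N m i = ∑ k ∈ Finset.range N, (m.choose k : ℂ) • (pullSub hg ^ k) (X i) := by
    simp only [flow, hcoef]
  rw [hfl, hit]
  rcases le_total N (m + 1) with h | h
  · rw [← Finset.sum_range_add_sum_Ico _ h, sub_add_cancel_left]
    exact Ideal.neg_mem_iff _ |>.2
      (Ideal.sum_mem _ fun k hk => hmem k (Finset.mem_Ico.1 hk).1)
  · rw [← Finset.sum_range_add_sum_Ico _ h, add_sub_cancel_left]
    rw [Finset.sum_eq_zero fun k hk => hz k (by have := (Finset.mem_Ico.1 hk).1; omega)]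
    exact Ideal.zero_mem _

theorem flow_zero_term {g : σ → MvPowerSeries σ ℂ} (hg : IsUnip g) (N : ℕ) (t : ℂ) (i : σ) :
    flow hg (N + 1) t i = X i + t • ∑ k ∈ Finset.range N,
      (((k + 1) ! : ℂ)⁻¹ * ((descPochhammer ℂ k).comp (Polynomial.X - 1)).eval t) •
        (pullSub hg ^ (k + 1)) (X i) := by
  rw [flow, Finset.sum_range_succ', add_comm]
  congr 1
  · simp
  · rw [Finset.smul_sum]
    refine Finset.sum_congr rfl fun k _ => ?_
    rw [descPochhammer_succ_left, smul_smul, Polynomial.eval_mul, Polynomial.eval_X]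
    congr 1
    ring

theorem isUnip_flow {g : σ → MvPowerSeries σ ℂ} (hg : IsUnip g) (N : ℕ) (t : ℂ) :
    IsUnip (flow hg (N + 1) t) := fun i => by
  rw [flow_zero_term, add_sub_cancel_left]
  refine smul_mem_ordIdeal _ (Ideal.sum_mem _ fun k _ => smul_mem_ordIdeal _ ?_)
  exact ordIdeal_mono (by omega) (pullSub_pow_mem hg (X_mem_ordIdeal_one i) (k + 1))

/-- If composition with `g` adds `h` to `f` in the lowest order, then composition with the power
`g ^ t` adds `t • h`: true for integers `t`, hence for all `t` as both sides are polynomials. -/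
theorem subst_flow_sub_mem {g : σ → MvPowerSeries σ ℂ} (hg : IsUnip g) {k : ℕ}
    {f h : MvPowerSeries σ ℂ} (hh : h ∈ ordIdeal σ k)
    (hf : subst g f - f - h ∈ ordIdeal σ (k + 1)) (t : ℂ) :
    subst (flow hg (k + 2) t) f - f - t • h ∈ ordIdeal σ (k + 1) := by
  have hnat : ∀ m : ℕ, subst (iter g m) f - f - (m : ℂ) • h ∈ ordIdeal σ (k + 1) := by
    intro m
    induction m with
    | zero => simp [iter, subst_self]
    | succ m ih =>
      have hs := hasSubst_of_mem hg.ord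
      have h1 := subst_mem_ordIdeal hg.ord ih
      have h2 : subst g (subst (iter g m) f) = subst (iter g (m + 1)) f :=
        subst_comp_subst_apply (hasSubst_of_mem (isUnip_iter hg m).ord) hs f
      rw [subst_sub hs, subst_sub hs, subst_smul hs, h2] at h1
      have h3 := smul_mem_ordIdeal (m : ℂ) (hg.subst_sub_mem hh)
      have h4 := Ideal.add_mem _ (Ideal.add_mem _ h1 h3) hf
      convert h4 using 1
      rw [smul_sub]
      push_cast
      rw [add_smul, one_smul]
      ring
  intro β hβ
  have hpoly : (fun t : ℂ => coeff β (subst (flow hg (k + 2) t) f)) ∈ polyFun :=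
    (HasCoeffs.const (F := fun _ => polyFun) f).subst (fun _ _ _ => le_rfl)
      (flow_hasCoeffs hg (k + 2)) (fun t => (isUnip_flow hg (k + 1) t).ord) β
  have hlin : (fun t : ℂ => coeff β f + t * coeff β h) ∈ polyFun := by
    have := eval_mem_polyFun
      (Polynomial.C (coeff β f) + Polynomial.X * Polynomial.C (coeff β h))
    simpa only [Polynomial.eval_add, Polynomial.eval_mul, Polynomial.eval_C,
      Polynomial.eval_X] using this
  have heq := eq_of_mem_polyFun hpoly hlin fun m => by
    have h1 := hnat (m + 1) β hβ
    have h2 := subst_sub_subst_mem (isUnip_flow hg (k + 1) ((m + 1 : ℕ) : ℂ)).ord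
      (isUnip_iter hg (m + 1)).ord (flow_natCast hg (k + 2) (m + 1)) f β (by omega)
    rw [map_sub, sub_eq_zero] at h2
    rw [map_sub, map_sub, coeff_smul, ← h2] at h1
    push_cast at h1
    linear_combination h1
  have := congrFun heq t
  rw [map_sub, map_sub, coeff_smul]
  linear_combination this

end Unipotent

/-! ### Approximate stabilizers -/

section Stabilizer
variable {σ : Type*}

theorem mem_ordIdeal_iff_le_order {k : ℕ} {f : MvPowerSeries σ ℂ} :
    f ∈ ordIdeal σ k ↔ (k : ℕ∞) ≤ f.order := by
  constructor
  · intro h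
    exact nat_le_order h
  · intro h β hβ
    exact coeff_of_lt_order (lt_of_lt_of_le (by exact_mod_cast hβ) h)

theorem mem_ordIdeal_of_mul_mem {K : ℕ} {D y : MvPowerSeries σ ℂ} (hD : D ≠ 0)
    (h : D * y ∈ ordIdeal σ K) : y ∈ ordIdeal σ (K - D.order.toNat) := by
  rw [mem_ordIdeal_iff_le_order] at h ⊢
  rw [order_mul, ← ne_zero_iff_order_finite.1 hD] at h
  generalize y.order = o at h
  cases o with
  | top => exact le_top
  | coe o =>
    norm_cast at h ⊢
    omega

variable [Fintype σ] [DecidableEq σ]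

/-- The formal Jacobian matrix. -/
noncomputable def jac (A : σ → MvPowerSeries σ ℂ) : Matrix σ σ (MvPowerSeries σ ℂ) :=
  fun i j => pderiv ℂ j (A i)

omit [DecidableEq σ] in
theorem subst_add_jac {f : MvPowerSeries σ ℂ}
    {H : σ → σ → MvPowerSeries (σ ⊕ σ) ℂ}
    (hH : taylorRem f = ∑ j, ∑ k, X (Sum.inr j) * (X (Sum.inr k) * H j k))
    {t : ℂ} {y : σ → MvPowerSeries σ ℂ} (hy : ∀ i, y i ∈ ordIdeal σ 1) :
    subst (fun i => X i + t • y i) f - f =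
      t • (∑ j, y j * pderiv ℂ j f + t • ∑ j, ∑ k, y j * (y k *
        subst (Sum.elim (fun i => X i) fun i => t • y i) (H j k))) := by
  rw [subst_add_eq hH X_mem_ordIdeal_one fun i => smul_mem_ordIdeal t (hy i)]
  have hX : ∀ g : MvPowerSeries σ ℂ, subst (fun i => (X i : MvPowerSeries σ ℂ)) g = g :=
    fun g => congrFun subst_self g
  simp only [hX, smul_mul_assoc, mul_smul_comm, ← Finset.smul_sum, smul_add]
  ring

/-- Multiplication by the Jacobian matrix loses at most as many orders as its determinant has:
multiply by the adjugate. -/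
theorem mem_ordIdeal_of_jac_mul {A : σ → MvPowerSeries σ ℂ} (hD : (jac A).det ≠ 0) {K : ℕ}
    {y : σ → MvPowerSeries σ ℂ} (h : ∀ i, ∑ j, y j * jac A i j ∈ ordIdeal σ K) (i : σ) :
    y i ∈ ordIdeal σ (K - (jac A).det.order.toNat) := by
  refine mem_ordIdeal_of_mul_mem hD ?_
  have h1 : (jac A).det * y i = ∑ l, (jac A).adjugate i l * ∑ j, y j * jac A l j := by
    have h2 := congrFun (congrArg (fun B => B *ᵥ y) (Matrix.adjugate_mul (jac A))) i
    simp only [Matrix.smul_mulVec, Matrix.one_mulVec, ← Matrix.mulVec_mulVec] at h2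
    rw [Pi.smul_apply, smul_eq_mul] at h2
    rw [← h2]
    simp only [Matrix.mulVec, dotProduct]
    simp only [mul_comm]
  rw [h1]
  exact Ideal.sum_mem _ fun l _ => Ideal.mul_mem_left _ _ (h l)

/-- A formal map tangent to the identity that preserves `A` up to order `K` is the identity up to
order `K - d`, where `d` is the order of the Jacobian determinant of `A`. The complex powers of the
map preserve `A` as well, so their velocity is annihilated by the Jacobian matrix of `A`. -/
theorem sub_X_mem_of_subst_sub_mem {A : σ → MvPowerSeries σ ℂ} (hD : (jac A).det ≠ 0)
    {g : σ → MvPowerSeries σ ℂ} (hg : IsUnip g) {K : ℕ}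
    (h : ∀ i, subst g (A i) - A i ∈ ordIdeal σ K) (i : σ) :
    g i - X i ∈ ordIdeal σ (K - (jac A).det.order.toNat) := by
  set d := (jac A).det.order.toNat with hd
  obtain _ | k := K
  · rw [Nat.zero_sub]
    exact mem_ordIdeal_zero _
  -- `X + t • y t` is the `t`-th power of `g`
  let y : ℂ → σ → MvPowerSeries σ ℂ := fun t i => ∑ k ∈ Finset.range (k + 1),
      (((k + 1) ! : ℂ)⁻¹ * ((descPochhammer ℂ k).comp (Polynomial.X - 1)).eval t) •
        (pullSub hg ^ (k + 1)) (X i)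
  have hflow : ∀ t, flow hg (k + 2) t = fun i => X i + t • y t i := fun t => by
    ext1 i
    exact flow_zero_term hg (k + 1) t i
  have hyord : ∀ t i, y t i ∈ ordIdeal σ 1 := fun t i =>
    Ideal.sum_mem _ fun l _ => smul_mem_ordIdeal _
      (ordIdeal_mono (by omega) (pullSub_pow_mem hg (X_mem_ordIdeal_one i) (l + 1)))
  have hypoly : ∀ i, HasCoeffs (fun _ => polyFun) (fun t => y t i) := fun i => by
    refine HasCoeffs.sum _ fun l _ => HasCoeffs.smul (fun _ => ?_) (HasCoeffs.const _)
    simpa only [Polynomial.eval_mul, Polynomial.eval_C] using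
      eval_mem_polyFun (Polynomial.C (((l + 1) ! : ℂ)⁻¹) *
        (descPochhammer ℂ l).comp (Polynomial.X - 1))
  have hid : (fun t : ℂ => t) ∈ polyFun := by
    simpa only [Polynomial.eval_X] using eval_mem_polyFun Polynomial.X
  have hmono : Monotone (fun _ : ℕ => polyFun) := fun _ _ _ => le_rfl
  have hy0 : ∀ i, ∑ j, y 0 j * jac A i j ∈ ordIdeal σ (k + 1) := by
    intro i β hβ
    obtain ⟨H, hH, -⟩ := exists_taylor (A i)
    let Q : ℂ → MvPowerSeries σ ℂ := fun t => ∑ j, ∑ l, y t j * (y t l *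
      subst (Sum.elim (fun i => X i) fun i => t • y t i) (H j l))
    have hQ : HasCoeffs (fun _ => polyFun) Q := by
      refine HasCoeffs.sum _ fun j _ => HasCoeffs.sum _ fun l _ =>
        (hypoly j).mul hmono ((hypoly l).mul hmono ?_)
      refine (HasCoeffs.const (H j l)).subst hmono ?_ ?_
      · rintro (i | i)
        · exact HasCoeffs.const _
        · exact HasCoeffs.smul (fun _ => hid) (hypoly i)
      · rintro t (i | i)
        · exact X_mem_ordIdeal_one i
        · exact smul_mem_ordIdeal t (hyord t i)
    have hL : HasCoeffs (fun _ => polyFun) (fun t => ∑ j, y t j * jac A i j) :=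
      HasCoeffs.sum _ fun j _ => (hypoly j).mul hmono (HasCoeffs.const _)
    have heq := eq_of_mem_polyFun (hL β)
      (g := fun t => -(t * coeff β (Q t)))
      (polyFun.neg_mem (polyFun.mul_mem hid (hQ β))) fun m => by
        have h1 := subst_flow_sub_mem hg (Ideal.zero_mem (ordIdeal σ k))
          (by simpa using h i) ((m : ℂ) + 1) β hβ
        rw [smul_zero, sub_zero, hflow, subst_add_jac hH (hyord _), coeff_smul, map_add,
          coeff_smul] at h1
        rcases mul_eq_zero.1 h1 with h2 | h2
        · exact absurd h2 (by exact_mod_cast Nat.succ_ne_zero m)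
        · exact eq_neg_of_add_eq_zero_left h2
    have := congrFun heq 0
    simpa using this
  have hy1 := mem_ordIdeal_of_jac_mul hD hy0
  have hstep : ∀ j, (∀ i, g i - X i ∈ ordIdeal σ (j + 2)) → j + 3 ≤ k + 1 - d →
      ∀ i, g i - X i ∈ ordIdeal σ (j + 3) := by
    intro j hj hjk i
    -- the velocity `y 0` of the powers of `g` agrees with `g - X` in the lowest order
    have h1 : y 0 i - (g i - X i) ∈ ordIdeal σ (j + 3) := by
      have h2 : y 0 i = (∑ l ∈ Finset.range k, (((l + 1 + 1) ! : ℂ)⁻¹ *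
          ((descPochhammer ℂ (l + 1)).comp (Polynomial.X - 1)).eval 0) •
          (pullSub hg ^ (l + 1 + 1)) (X i)) + (g i - X i) := by
        simp only [y]
        rw [Finset.sum_range_succ']
        congr 1
        simp [pullSub_apply, subst_X (hasSubst_of_mem hg.ord)]
      rw [h2, add_sub_cancel_right]
      refine Ideal.sum_mem _ fun l _ => smul_mem_ordIdeal _ ?_
      rw [pow_succ, Module.End.mul_apply, pullSub_apply, subst_X (hasSubst_of_mem hg.ord)]
      exact ordIdeal_mono (by omega) (pullSub_pow_mem hg (hj i) (l + 1))
    have h3 := Ideal.sub_mem _ (ordIdeal_mono hjk (hy1 i)) h1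
    simpa using h3
  rcases le_or_gt (k + 1 - d) 2 with hle | hlt
  · exact ordIdeal_mono hle (hg i)
  · have : ∀ j, j + 2 ≤ k + 1 - d → ∀ i, g i - X i ∈ ordIdeal σ (j + 2) := by
      intro j
      induction j with
      | zero => intro _; exact hg
      | succ j ih => intro hj; exact hstep j (ih (by omega)) hj
    have h4 := this (k + 1 - d - 2) (by omega) i
    exact ordIdeal_mono (by omega) h4

end Stabilizer

/-! ### Inverses of unipotent maps up to finite order -/

section Inverse
variable {σ : Type*} [Finite σ]

/-- The left inverse is the image of `X` under the truncated Neumann series of the pullback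
operator. -/
theorem exists_left_inverse {g : σ → MvPowerSeries σ ℂ} (hg : IsUnip g) (N : ℕ) :
    ∃ δ : σ → MvPowerSeries σ ℂ, IsUnip δ ∧ ∀ i, subst g (δ i) - X i ∈ ordIdeal σ N := by
  have hmem : ∀ (k : ℕ) (i : σ), ((-pullSub hg) ^ k) (X i) ∈ ordIdeal σ (1 + k) := by
    intro k i
    induction k with
    | zero => simpa using X_mem_ordIdeal_one i
    | succ k ih =>
      rw [pow_succ', Module.End.mul_apply, LinearMap.neg_apply, pullSub_apply]
      exact (Ideal.neg_mem_iff _).2 (hg.subst_sub_mem ih)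
  refine ⟨fun i => (∑ k ∈ Finset.range (N + 1), (-pullSub hg) ^ k) (X i), fun i => ?_, fun i => ?_⟩
  · beta_reduce
    rw [LinearMap.sum_apply, Finset.sum_range_succ', pow_zero, Module.End.one_apply,
      add_sub_cancel_right]
    exact Ideal.sum_mem _ fun k _ => ordIdeal_mono (by omega) (hmem (k + 1) i)
  · have h1 : ∀ f, subst g f = (1 - (-pullSub hg)) f := fun f => by
      simp [pullSub_apply]
    rw [h1, ← Module.End.mul_apply, mul_neg_geom_sum]
    simp only [LinearMap.sub_apply, Module.End.one_apply, sub_sub_cancel_left]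
    exact (Ideal.neg_mem_iff _).2 (ordIdeal_mono (by omega) (hmem (N + 1) i))

theorem exists_inverse {g : σ → MvPowerSeries σ ℂ} (hg : IsUnip g) (N : ℕ) :
    ∃ δ : σ → MvPowerSeries σ ℂ, IsUnip δ ∧ (∀ i, subst g (δ i) - X i ∈ ordIdeal σ N) ∧
      ∀ i, subst δ (g i) - X i ∈ ordIdeal σ N := by
  obtain ⟨δ, hδ, h1⟩ := exists_left_inverse hg N
  obtain ⟨ε, hε, h2⟩ := exists_left_inverse hδ N
  refine ⟨δ, hδ, h1, fun i => ?_⟩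
  -- a left inverse of a left inverse of `g` agrees with `g`
  have hsg := hasSubst_of_mem hg.ord
  have hsδ := hasSubst_of_mem hδ.ord
  have h3 := subst_mem_ordIdeal hg.ord (h2 i)
  rw [subst_sub hsg, subst_X hsg, subst_comp_subst_apply hsδ hsg] at h3
  have h4 := subst_sub_subst_mem (fun j => (hδ.comp hg).ord j) X_mem_ordIdeal_one h1 (ε i)
  rw [subst_self, id] at h4
  have h5 : g i - ε i ∈ ordIdeal σ N := by
    have := Ideal.sub_mem _ h4 h3
    convert this using 1
    ring
  have h6 := subst_mem_ordIdeal hδ.ord h5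
  rw [subst_sub hsδ] at h6
  have := Ideal.add_mem _ h6 (h2 i)
  convert this using 1
  ring

end Inverse

/-! ### Lowest order changes under unipotent maps -/

section Orbit
variable {σ : Type*}

/-- Composition with the unipotent map `g` changes `A` by `h` up to order `k + 1`. -/
def Moves (A : σ → MvPowerSeries σ ℂ) (k : ℕ) (g h : σ → MvPowerSeries σ ℂ) : Prop :=
  IsUnip g ∧ (∀ i, h i ∈ ordIdeal σ k) ∧ ∀ i, subst g (A i) - A i - h i ∈ ordIdeal σ (k + 1)

variable {A : σ → MvPowerSeries σ ℂ} {k : ℕ}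

theorem moves_X (A : σ → MvPowerSeries σ ℂ) (k : ℕ) : Moves A k (fun i => X i) 0 :=
  ⟨isUnip_X, fun _ => Ideal.zero_mem _, fun i => by simp [subst_self]⟩

variable [Finite σ]

theorem Moves.comp {g h g' h' : σ → MvPowerSeries σ ℂ} (H : Moves A k g h)
    (H' : Moves A k g' h') : Moves A k (fun i => subst g' (g i)) (h + h') := by
  refine ⟨H.1.comp H'.1, fun i => Ideal.add_mem _ (H.2.1 i) (H'.2.1 i), fun i => ?_⟩
  have hs := hasSubst_of_mem H'.1.ord
  have h1 := subst_mem_ordIdeal H'.1.ord (H.2.2 i)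
  rw [subst_sub hs, subst_sub hs, subst_comp_subst_apply (hasSubst_of_mem H.1.ord) hs] at h1
  have h2 := Ideal.add_mem _ (Ideal.add_mem _ h1 (H'.2.2 i)) (H'.1.subst_sub_mem (H.2.1 i))
  convert h2 using 1
  rw [Pi.add_apply]
  ring

theorem Moves.flow {g h : σ → MvPowerSeries σ ℂ} (H : Moves A k g h) (t : ℂ) :
    Moves A k (flow H.1 (k + 2) t) (t • h) :=
  ⟨isUnip_flow H.1 (k + 1) t, fun i => smul_mem_ordIdeal t (H.2.1 i),
    fun i => subst_flow_sub_mem H.1 (H.2.1 i) (H.2.2 i) t⟩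

/-- The tuple of polynomials of degree at most `k` with the given coefficients. -/
noncomputable def ofLow (k : ℕ) : (σ × lowDegrees σ k → ℂ) →ₗ[ℂ] (σ → MvPowerSeries σ ℂ) where
  toFun e i := ∑ β : lowDegrees σ k, monomial (β : σ →₀ ℕ) (e (i, β))
  map_add' e e' := by
    funext i
    simp [Finset.sum_add_distrib]
  map_smul' c e := by
    funext i
    simp [Finset.smul_sum, -smul_eq_mul]

theorem coeff_ofLow {k : ℕ} (e : σ × lowDegrees σ k → ℂ) (i : σ) {β : σ →₀ ℕ}
    (h : β ∈ lowDegrees σ k) : coeff β (ofLow k e i) = e (i, ⟨β, h⟩) := by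
  classical
  change coeff β (∑ γ : lowDegrees σ k, monomial (γ : σ →₀ ℕ) (e (i, γ))) = _
  rw [map_sum, Finset.sum_eq_single ⟨β, h⟩]
  · exact coeff_monomial_same _ _
  · intro γ _ hγ
    exact coeff_monomial_ne (fun hc => hγ (Subtype.ext hc.symm)) _
  · simp

/-- The lowest order changes of `A` under unipotent maps form a linear space. -/
noncomputable def moveSpace (A : σ → MvPowerSeries σ ℂ) (k : ℕ) :
    Submodule ℂ (σ × lowDegrees σ k → ℂ) where
  carrier := {e | ∃ g, Moves A k g (ofLow k e)}
  zero_mem' := ⟨_, by rw [map_zero]; exact moves_X A k⟩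
  add_mem' := by
    rintro e e' ⟨g, hg⟩ ⟨g', hg'⟩
    exact ⟨_, by rw [map_add]; exact hg.comp hg'⟩
  smul_mem' := by
    rintro t e ⟨g, hg⟩
    exact ⟨_, by rw [map_smul]; exact hg.flow t⟩

end Orbit

/-! ### Polynomial dependence of solutions up to finite order -/

section Approximation
variable {σ : Type*} [Fintype σ] {Y : Type*}

theorem comp_mem_of_mem_polyFun {S : Subalgebra ℂ (Y → ℂ)} {f : ℂ → ℂ} (hf : f ∈ polyFun)
    {t : Y → ℂ} (ht : t ∈ S) : (fun y => f (t y)) ∈ S := by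
  obtain ⟨p, hp⟩ := exists_of_mem_polyFun hf
  have h1 : (fun y => f (t y)) = Polynomial.aeval t p := by
    ext y
    rw [hp]
    simp [Polynomial.aeval_def, Polynomial.eval₂_eq_eval_map]
  rw [h1]
  exact Polynomial.aeval_mem_adjoin_singleton ℂ t |> (Algebra.adjoin_le (by simpa using ht) ·)

/-- Changes of `A` in degree `k` that unipotent maps can produce are produced by unipotent maps
depending polynomially on the change. -/
theorem exists_moves_family (A : σ → MvPowerSeries σ ℂ) (k : ℕ) (S : Subalgebra ℂ (Y → ℂ))
    {e : Y → (σ × lowDegrees σ k → ℂ)} (he : ∀ q, (fun y => e y q) ∈ S) :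
    ∃ s : Y → σ → MvPowerSeries σ ℂ, (∀ y, IsUnip (s y)) ∧
      (∀ i, HasCoeffs (fun _ => S) (fun y => s y i)) ∧
      ∀ y, e y ∈ moveSpace A k → Moves A k (s y) (ofLow k (e y)) := by
  classical
  let W := moveSpace A k
  let b := Module.finBasis ℂ W
  obtain ⟨π, hπ⟩ := W.subtype.exists_leftInverse_of_injective (Submodule.ker_subtype W)
  choose g hg using fun j => (b j).2
  -- a linear projection onto the space of changes keeps the dependence on `y` polynomial
  let t : Fin (Module.finrank ℂ W) → Y → ℂ := fun j y => b.repr (π (e y)) j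
  have ht : ∀ j, t j ∈ S := by
    intro j
    let ψ : (σ × lowDegrees σ k → ℂ) →ₗ[ℂ] ℂ := b.coord j ∘ₗ π
    have h1 : t j = fun y => ∑ q, e y q * ψ (fun q' => if q = q' then 1 else 0) := by
      ext y
      have := LinearMap.pi_apply_eq_sum_univ ψ (e y)
      simpa [ψ, t] using this
    rw [h1]
    exact sum_fun_mem S _ fun q _ => S.mul_mem (he q) (const_fun_mem S _)
  have hind : ∀ J : Finset (Fin (Module.finrank ℂ W)), ∃ s : Y → σ → MvPowerSeries σ ℂ,
      (∀ i, HasCoeffs (fun _ => S) (fun y => s y i)) ∧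
      ∀ y, Moves A k (s y) (∑ j ∈ J, t j y • ofLow k (b j : σ × lowDegrees σ k → ℂ)) := by
    intro J
    induction J using Finset.induction_on with
    | empty =>
      exact ⟨fun _ i => X i, fun i => HasCoeffs.const _, fun y => by simpa using moves_X A k⟩
    | insert j J hj ih =>
      obtain ⟨s, hs, hsm⟩ := ih
      -- the multiple `t j y` of a basis vector is realized by a complex power of a fixed map
      let f : Y → σ → MvPowerSeries σ ℂ := fun y => flow (hg j).1 (k + 2) (t j y)
      have hf : ∀ i, HasCoeffs (fun _ => S) (fun y => f y i) := fun i β =>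
        comp_mem_of_mem_polyFun (flow_hasCoeffs (hg j).1 (k + 2) i β) (ht j)
      refine ⟨fun y i => subst (s y) (f y i), fun i => ?_, fun y => ?_⟩
      · exact (hf i).subst (fun _ _ _ => le_rfl) hs fun y => (hsm y).1.ord
      · rw [Finset.sum_insert hj]
        exact ((hg j).flow (t j y)).comp (hsm y)
  obtain ⟨s, hs, hsm⟩ := hind Finset.univ
  refine ⟨s, fun y => (hsm y).1, hs, fun y hy => ?_⟩
  have h1 : ∑ j, t j y • ofLow k (b j : σ × lowDegrees σ k → ℂ) = ofLow k (e y) := by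
    have h2 : π (e y) = ⟨e y, hy⟩ := by
      have := LinearMap.congr_fun hπ ⟨e y, hy⟩
      simpa using this
    have h3 := b.sum_repr (π (e y))
    rw [h2] at h3
    have h4 := congrArg (fun v : W => ofLow k (v : σ × lowDegrees σ k → ℂ)) h3
    simp only [AddSubmonoidClass.coe_finsetSum, map_sum, Submodule.coe_smul, map_smul] at h4
    rw [← h4]
    refine Finset.sum_congr rfl fun j _ => ?_
    simp only [t, h2]
  rw [← h1]
  exact hsm y

variable [DecidableEq σ]

/-- Every finite order part of a unipotent solution `w` of `A ∘ w = c` is a polynomial in finitely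
many Taylor coefficients of `c`: this is the closedness of orbits of unipotent groups, made
explicit by solving the equation degree by degree. -/
theorem exists_approx {A : σ → MvPowerSeries σ ℂ} (hD : (jac A).det ≠ 0) (K : ℕ)
    (S : Subalgebra ℂ (Y → ℂ)) {c : Y → σ → MvPowerSeries σ ℂ}
    (hc : ∀ i (β : σ →₀ ℕ), β.degree ≤ K → (fun y => coeff β (c y i)) ∈ S) :
    ∃ γ : Y → σ → MvPowerSeries σ ℂ, (∀ y, IsUnip (γ y)) ∧
      (∀ i, HasCoeffs (fun _ => S) (fun y => γ y i)) ∧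
      (∀ y i (β : σ →₀ ℕ), K + 2 ≤ β.degree → coeff β (γ y i) = 0) ∧
      ∀ y w, IsUnip w → (∀ i, subst w (A i) - c y i ∈ ordIdeal σ K) →
        ∀ i, w i - γ y i ∈ ordIdeal σ (K - (jac A).det.order.toNat) := by
  have hmono : Monotone (fun _ : ℕ => S) := fun _ _ _ => le_rfl
  have hind : ∀ k, k ≤ K → ∃ γ : Y → σ → MvPowerSeries σ ℂ, (∀ y, IsUnip (γ y)) ∧
      (∀ i, HasCoeffs (fun _ => S) (fun y => γ y i)) ∧
      ∀ y w, IsUnip w → (∀ i, subst w (A i) - c y i ∈ ordIdeal σ K) →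
        ∀ i, c y i - subst (γ y) (A i) ∈ ordIdeal σ k := by
    intro k
    induction k with
    | zero =>
      intro _
      exact ⟨fun _ i => X i, fun _ => isUnip_X, fun i => HasCoeffs.const _,
        fun _ _ _ _ _ => mem_ordIdeal_zero _⟩
    | succ k ih =>
      intro hk
      obtain ⟨γ, hγ, hγS, hγA⟩ := ih (by omega)
      let e : Y → (σ × lowDegrees σ k → ℂ) := fun y q =>
        coeff (q.2 : σ →₀ ℕ) (c y q.1 - subst (γ y) (A q.1))
      have he : ∀ q, (fun y => e y q) ∈ S := by
        rintro ⟨i, β, hβ⟩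
        rw [mem_lowDegrees] at hβ
        have h1 := (HasCoeffs.const (F := fun _ => S) (A i)).subst hmono hγS
          (fun y => (hγ y).ord) β
        simpa [e] using! S.sub_mem (hc i β (by omega)) h1
      obtain ⟨s, hs, hsS, hsm⟩ := exists_moves_family A k S he
      refine ⟨fun y i => subst (γ y) (s y i), fun y => (hs y).comp (hγ y),
        fun i => (hsS i).subst hmono hγS fun y => (hγ y).ord, ?_⟩
      intro y w hw hwc
      have hlow := hγA y w hw hwc
      have hsγ := hasSubst_of_mem (hγ y).ord
      have h1 : ∀ i, c y i - subst (γ y) (A i) - ofLow k (e y) i ∈ ordIdeal σ (k + 1) := by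
        intro i β hβ
        rw [map_sub, coeff_ofLow _ _ (mem_lowDegrees.2 (Nat.lt_succ_iff.1 hβ)), sub_self]
      have h2 : ∀ i, ofLow k (e y) i ∈ ordIdeal σ k := by
        intro i
        have := Ideal.sub_mem _ (hlow i) (ordIdeal_mono (Nat.le_succ k) (h1 i))
        simpa using this
      -- the required change is realized by `w ∘ γ⁻¹`
      have h3 : e y ∈ moveSpace A k := by
        obtain ⟨δ, hδ, -, hγδ⟩ := exists_inverse (hγ y) (k + 1)
        have hsδ := hasSubst_of_mem hδ.ord
        refine ⟨fun i => subst δ (w i), hw.comp hδ, h2, fun i => ?_⟩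
        rw [← subst_comp_subst_apply (hasSubst_of_mem hw.ord) hsδ]
        have h4 : subst w (A i) - subst (γ y) (A i) - ofLow k (e y) i ∈ ordIdeal σ (k + 1) := by
          have := Ideal.add_mem _ (ordIdeal_mono hk (hwc i)) (h1 i)
          convert this using 1
          ring
        have h5 := subst_mem_ordIdeal hδ.ord h4
        rw [subst_sub hsδ, subst_sub hsδ, subst_comp_subst_apply hsγ hsδ] at h5
        have h6 := subst_sub_subst_mem (fun j => ((hγ y).comp hδ).ord j) X_mem_ordIdeal_one
          hγδ (A i)
        rw [subst_self, id] at h6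
        have h7 := Ideal.add_mem _ (Ideal.add_mem _ h5 h6) (hδ.subst_sub_mem (h2 i))
        convert h7 using 1
        ring
      intro i
      have h4 := subst_mem_ordIdeal (hγ y).ord ((hsm y h3).2.2 i)
      rw [subst_sub hsγ, subst_sub hsγ,
        subst_comp_subst_apply (hasSubst_of_mem (hs y).ord) hsγ] at h4
      have h5 := Ideal.sub_mem _ (Ideal.sub_mem _ (h1 i) h4) ((hγ y).subst_sub_mem (h2 i))
      convert h5 using 1
      ring
  obtain ⟨γ, hγ, hγS, hγA⟩ := hind K le_rfl
  refine ⟨fun y i => (truncTotal (K + 2) (γ y i) : MvPolynomial σ ℂ), fun y => ?_, fun i β => ?_,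
    fun y i β hβ => ?_, fun y w hw hwc i => ?_⟩
  · refine (hγ y).congr (k := K + 2) (by omega) fun i => ?_
    rw [← Ideal.neg_mem_iff, neg_sub]
    exact sub_truncTotal_mem _ _
  · simp only [MvPolynomial.coeff_coe, coeff_truncTotal_eq_ite]
    by_cases h : β.degree < K + 2
    · simpa [h] using! hγS i β
    · simpa [h] using! const_fun_mem S 0
  · rw [MvPolynomial.coeff_coe, coeff_truncTotal_eq_zero _ hβ]
  · obtain ⟨δ, hδ, hδγ, hγδ⟩ := exists_inverse (hγ y) K
    have hsδ := hasSubst_of_mem hδ.ord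
    have hsγ := hasSubst_of_mem (hγ y).ord
    -- `w ∘ γ⁻¹` preserves `A` up to order `K`
    have h1 : ∀ i, subst (fun j => subst δ (w j)) (A i) - A i ∈ ordIdeal σ K := by
      intro i
      rw [← subst_comp_subst_apply (hasSubst_of_mem hw.ord) hsδ]
      have h2 := subst_mem_ordIdeal hδ.ord (Ideal.add_mem _ (hwc i) (hγA y w hw hwc i))
      rw [sub_add_sub_cancel, subst_sub hsδ, subst_comp_subst_apply hsγ hsδ] at h2
      have h3 := subst_sub_subst_mem (fun j => ((hγ y).comp hδ).ord j) X_mem_ordIdeal_one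
        hγδ (A i)
      rw [subst_self, id] at h3
      simpa using Ideal.add_mem _ h2 h3
    have h2 := subst_mem_ordIdeal (hγ y).ord (sub_X_mem_of_subst_sub_mem hD (hw.comp hδ) h1 i)
    rw [subst_sub hsγ, subst_X hsγ, subst_comp_subst_apply hsδ hsγ] at h2
    have h3 := subst_sub_subst_mem (fun j => (hδ.comp (hγ y)).ord j) X_mem_ordIdeal_one hδγ (w i)
    rw [subst_self, id] at h3
    have h4 := ordIdeal_mono (k := K - (jac A).det.order.toNat) (by omega)
      (sub_truncTotal_mem (K + 2) (γ y i))
    have h5 := ordIdeal_mono (Nat.sub_le K (jac A).det.order.toNat) h3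
    have h6 := Ideal.add_mem _ (Ideal.sub_mem _ h2 h5) h4
    convert h6 using 1
    ring

end Approximation

/-! ### The dominant monomial of a homogeneous polynomial -/

section Division
variable {σ : Type*} [Fintype σ]

/-- A linear form on exponents that takes different values on the members of a finite set. -/
theorem exists_separating_form (s : Finset (σ →₀ ℕ)) :
    ∃ w : σ → ℝ, Set.InjOn (fun β : σ →₀ ℕ => ∑ i, (β i : ℝ) * w i) s := by
  classical
  let P : (σ →₀ ℕ) × (σ →₀ ℕ) → MvPolynomial σ ℝ := fun q =>
    ∑ i, MvPolynomial.C ((q.1 i : ℝ) - q.2 i) * MvPolynomial.X i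
  have hev : ∀ q (w : σ → ℝ), MvPolynomial.eval w (P q) =
      ∑ i, (q.1 i : ℝ) * w i - ∑ i, (q.2 i : ℝ) * w i := by
    intro q w
    simp [P, sub_mul, Finset.sum_sub_distrib]
  have hP : ∀ q ∈ s.offDiag, P q ≠ 0 := by
    rintro ⟨β, γ⟩ hq h0
    refine (Finset.mem_offDiag.1 hq).2.2 (Finsupp.ext fun j => ?_)
    have h1 := hev (β, γ) (Pi.single j 1)
    rw [h0, map_zero] at h1
    simp [Pi.single_apply] at h1
    exact_mod_cast (sub_eq_zero.1 h1.symm)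
  have hprod : ∏ q ∈ s.offDiag, P q ≠ 0 := Finset.prod_ne_zero_iff.2 hP
  obtain ⟨w, hw⟩ : ∃ w : σ → ℝ, MvPolynomial.eval w (∏ q ∈ s.offDiag, P q) ≠ 0 := by
    by_contra! h
    exact hprod (MvPolynomial.funext fun w => by rw [h w, map_zero])
  refine ⟨w, fun β hβ γ hγ h => ?_⟩
  by_contra hne
  rw [map_prod] at hw
  refine Finset.prod_ne_zero_iff.1 hw (β, γ) (Finset.mem_offDiag.2 ⟨hβ, hγ, hne⟩) ?_
  rw [hev, sub_eq_zero]
  exact h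

/-- On a suitable polydisc one monomial of a homogeneous polynomial dominates all others. -/
theorem exists_dominant_monomial {D : MvPowerSeries σ ℂ} {d : ℕ}
    (hD : ∀ β : σ →₀ ℕ, β.degree ≠ d → coeff β D = 0) (hD0 : D ≠ 0) :
    ∃ (ω : σ → ℝ≥0∞) (α : σ →₀ ℕ), (∀ i, ω i ≠ 0 ∧ ω i ≠ ⊤) ∧ coeff α D ≠ 0 ∧
      2 * wnorm ω (D - monomial α (coeff α D)) ≤ ‖coeff α D‖ₑ * wmon ω α := by
  classical
  let s : Finset (σ →₀ ℕ) := (lowDegrees σ d).filter fun β => coeff β D ≠ 0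
  have hs : ∀ β, β ∈ s ↔ coeff β D ≠ 0 := by
    intro β
    simp only [s, Finset.mem_filter, mem_lowDegrees, and_iff_right_iff_imp]
    intro h
    by_contra hlt
    exact h (hD β (by omega))
  have hne : s.Nonempty := by
    by_contra h
    rw [Finset.not_nonempty_iff_eq_empty] at h
    refine hD0 (MvPowerSeries.ext fun β => ?_)
    by_contra hβ
    have := (hs β).2 (by simpa using hβ)
    simp [h] at this
  obtain ⟨w, hw⟩ := exists_separating_form s
  let l : (σ →₀ ℕ) → ℝ := fun β => ∑ i, (β i : ℝ) * w i
  obtain ⟨α, hα, hmin⟩ := s.exists_min_image l hne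
  -- for these weights `ω ^ β = exp (-t l(β))`, so that the monomial with the least value of `l`
  -- wins as `t → ∞`
  let ω : ℝ → σ → ℝ≥0∞ := fun t i => ENNReal.ofReal (Real.exp (-(t * w i)))
  have hωm : ∀ t β, wmon (ω t) β = ENNReal.ofReal (Real.exp (-(t * l β))) := by
    intro t β
    have h1 : l β = ∑ i ∈ β.support, (β i : ℝ) * w i := by
      refine (Finset.sum_subset (Finset.subset_univ _) fun i _ hi => ?_).symm
      rw [Finsupp.notMem_support_iff.1 hi]; simp
    rw [h1, Finset.mul_sum, ← Finset.sum_neg_distrib, Real.exp_sum,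
      ENNReal.ofReal_prod_of_nonneg fun i _ => (Real.exp_pos _).le]
    refine Finset.prod_congr rfl fun i _ => ?_
    simp only [ω]
    rw [← ENNReal.ofReal_pow (Real.exp_pos _).le, ← Real.exp_nat_mul]
    congr 2
    ring
  have hlim : Tendsto (fun t : ℝ => ∑ β ∈ s.erase α,
      ‖coeff β D‖ * Real.exp (-(t * (l β - l α)))) atTop (𝓝 0) := by
    rw [← Finset.sum_const_zero (s := s.erase α)]
    refine tendsto_finsetSum _ fun β hβ => ?_
    have hlt : 0 < l β - l α := by
      have h1 := hmin β (Finset.mem_of_mem_erase hβ)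
      have h2 : l α ≠ l β := fun h =>
        Finset.ne_of_mem_erase hβ (hw hα (Finset.mem_of_mem_erase hβ) h).symm
      exact sub_pos.2 (lt_of_le_of_ne h1 h2)
    rw [← mul_zero ‖coeff β D‖]
    exact (Real.tendsto_exp_neg_atTop_nhds_zero.comp
      (tendsto_id.atTop_mul_const hlt)).const_mul _
  have hα0 : coeff α D ≠ 0 := (hs α).1 hα
  obtain ⟨t, ht⟩ := (hlim.eventually (Iic_mem_nhds (a := ‖coeff α D‖ / 2) (b := (0 : ℝ))
    (half_pos (norm_pos_iff.2 hα0)))).exists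
  refine ⟨ω t, α, fun i => ⟨?_, ENNReal.ofReal_ne_top⟩, hα0, ?_⟩
  · simpa [ω] using Real.exp_pos _
  have hcoef : ∀ β, coeff β (D - monomial α (coeff α D)) =
      if β ∈ s.erase α then coeff β D else 0 := by
    intro β
    rw [map_sub, coeff_monomial]
    by_cases h1 : β = α
    · subst h1; simp
    · by_cases h2 : β ∈ s
      · simp [h1, h2]
      · have : coeff β D = 0 := by
          by_contra h; exact h2 ((hs β).2 h)
        simp [h1, h2, this]
  have hnorm : wnorm (ω t) (D - monomial α (coeff α D)) =
      ENNReal.ofReal (∑ β ∈ s.erase α, ‖coeff β D‖ * Real.exp (-(t * l β))) := by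
    rw [wnorm, tsum_eq_sum (s := s.erase α) fun β hβ => by rw [hcoef, if_neg hβ]; simp,
      ENNReal.ofReal_sum_of_nonneg fun β _ => by positivity]
    refine Finset.sum_congr rfl fun β hβ => ?_
    rw [hcoef, if_pos hβ, hωm, ENNReal.ofReal_mul (norm_nonneg _), ofReal_norm]
  rw [hnorm, hωm, ← ofReal_norm, ← ENNReal.ofReal_mul (norm_nonneg _),
    show (2 : ℝ≥0∞) = ENNReal.ofReal 2 by simp, ← ENNReal.ofReal_mul (by norm_num)]
  refine ENNReal.ofReal_le_ofReal ?_
  have h3 : ∑ β ∈ s.erase α, ‖coeff β D‖ * Real.exp (-(t * l β)) =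
      (∑ β ∈ s.erase α, ‖coeff β D‖ * Real.exp (-(t * (l β - l α)))) *
        Real.exp (-(t * l α)) := by
    rw [Finset.sum_mul]
    refine Finset.sum_congr rfl fun β _ => ?_
    rw [mul_assoc, ← Real.exp_add]
    congr 2
    ring
  rw [h3]
  have := mul_le_mul_of_nonneg_right ht (Real.exp_pos (-(t * l α))).le
  linarith

theorem wnorm_le_of_truncTotal {ω : σ → ℝ≥0∞} {f : MvPowerSeries σ ℂ} {b : ℝ≥0∞}
    (h : ∀ k, wnorm ω (truncTotal k f : MvPolynomial σ ℂ) ≤ b) : wnorm ω f ≤ b := by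
  rw [wnorm, ENNReal.tsum_eq_iSup_sum]
  refine iSup_le fun s => ?_
  let k := s.sup Finsupp.degree + 1
  refine le_trans (le_of_eq ?_) ((ENNReal.sum_le_tsum s).trans (h k))
  refine Finset.sum_congr rfl fun β hβ => ?_
  have : β.degree < k := Nat.lt_succ_of_le (Finset.le_sup (f := Finsupp.degree) hβ)
  rw [MvPolynomial.coeff_coe, coeff_truncTotal _ this]

omit [Fintype σ] in
theorem wnorm_coe_ne_top {ω : σ → ℝ≥0∞} (hω : ∀ i, ω i ≠ ⊤) (p : MvPolynomial σ ℂ) :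
    wnorm ω (p : MvPowerSeries σ ℂ) ≠ ⊤ := by
  rw [wnorm, tsum_eq_sum (s := p.support) fun β hβ => by
    rw [MvPolynomial.coeff_coe, MvPolynomial.notMem_support_iff.1 hβ]; simp]
  refine ENNReal.sum_ne_top.2 fun β _ => ENNReal.mul_ne_top enorm_ne_top ?_
  exact ENNReal.prod_ne_top fun i _ => ENNReal.pow_ne_top (hω i)

/-- The quotient part: the operator that keeps the monomials divisible by `x ^ α` and divides them
by `x ^ α`. -/
noncomputable def shiftDown (α : σ →₀ ℕ) (f : MvPowerSeries σ ℂ) : MvPowerSeries σ ℂ :=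
  fun β => coeff (β + α) f

omit [Fintype σ] in
theorem coeff_shiftDown (α β : σ →₀ ℕ) (f : MvPowerSeries σ ℂ) :
    coeff β (shiftDown α f) = coeff (β + α) f := rfl

omit [Fintype σ] in
theorem wnorm_shiftDown_mul_le (ω : σ → ℝ≥0∞) (α : σ →₀ ℕ) (f : MvPowerSeries σ ℂ) :
    wnorm ω (shiftDown α f) * wmon ω α ≤ wnorm ω f := by
  rw [wnorm, wnorm, ← ENNReal.tsum_mul_right]
  refine le_trans (le_of_eq (tsum_congr fun β => ?_))
    (ENNReal.tsum_comp_le_tsum_of_injective (add_left_injective α)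
      fun β => ‖coeff β f‖ₑ * wmon ω β)
  rw [coeff_shiftDown, wmon_add, mul_assoc]

omit [Fintype σ] in
/-- If one monomial of `D` dominates, then `y` is bounded by the quotient of `D * y` by this
monomial, as the other monomials of `D` contribute at most half of the norm of `y`. Finiteness of
the norm of `y` is needed to absorb that half. -/
theorem wnorm_le_of_dominant {ω : σ → ℝ≥0∞} (hω : ∀ i, ω i ≠ 0 ∧ ω i ≠ ⊤)
    {D : MvPowerSeries σ ℂ} {α : σ →₀ ℕ}
    (h : 2 * wnorm ω (D - monomial α (coeff α D)) ≤ ‖coeff α D‖ₑ * wmon ω α)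
    {y : MvPowerSeries σ ℂ} (hy : wnorm ω y ≠ ⊤) :
    ‖coeff α D‖ₑ * wnorm ω y ≤ 2 * wnorm ω (shiftDown α (D * y)) := by
  classical
  set a := coeff α D with ha
  have hm0 : wmon ω α ≠ 0 := Finset.prod_ne_zero_iff.2 fun i _ => pow_ne_zero _ (hω i).1
  have hmt : wmon ω α ≠ ⊤ := ENNReal.prod_ne_top fun i _ => ENNReal.pow_ne_top (hω i).2
  have h1 : a • y = shiftDown α (D * y) - shiftDown α ((D - monomial α a) * y) := by
    ext β
    have : coeff (β + α) (monomial α a * y) = a * coeff β y := by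
      rw [add_comm, coeff_add_monomial_mul]
    rw [map_sub, coeff_shiftDown, coeff_shiftDown, sub_mul, map_sub, this, coeff_smul]
    ring
  have h2 : ‖a‖ₑ * wnorm ω y * wmon ω α ≤
      wnorm ω (shiftDown α (D * y)) * wmon ω α + wnorm ω (D - monomial α a) * wnorm ω y := by
    rw [← wnorm_smul, h1]
    refine (mul_le_mul_left (wnorm_sub_le _ _ _) _).trans ?_
    rw [add_mul]
    exact add_le_add_right ((wnorm_shiftDown_mul_le _ _ _).trans (wnorm_mul_le _ _ _)) _
  have h3 : 2 * (‖a‖ₑ * wnorm ω y * wmon ω α) ≤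
      2 * wnorm ω (shiftDown α (D * y)) * wmon ω α + ‖a‖ₑ * wnorm ω y * wmon ω α := by
    calc 2 * (‖a‖ₑ * wnorm ω y * wmon ω α)
        ≤ 2 * (wnorm ω (shiftDown α (D * y)) * wmon ω α +
            wnorm ω (D - monomial α a) * wnorm ω y) := mul_le_mul_right h2 _
      _ = 2 * wnorm ω (shiftDown α (D * y)) * wmon ω α +
            (2 * wnorm ω (D - monomial α a)) * wnorm ω y := by ring
      _ ≤ 2 * wnorm ω (shiftDown α (D * y)) * wmon ω α + (‖a‖ₑ * wmon ω α) * wnorm ω y :=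
          add_le_add_right (mul_le_mul_left h _) _
      _ = _ := by ring
  have ht : ‖a‖ₑ * wnorm ω y * wmon ω α ≠ ⊤ :=
    ENNReal.mul_ne_top (ENNReal.mul_ne_top enorm_ne_top hy) hmt
  rw [two_mul] at h3
  exact (ENNReal.mul_le_mul_iff_left hm0 hmt).1 ((ENNReal.add_le_add_iff_right ht).1 h3)

end Division

/-! ### Bounded division by a homogeneous polynomial -/

section DivisionOperator
variable {σ : Type*} [Fintype σ]

/-- The finite set of exponents of degree `k`. -/
noncomputable def homDegrees (σ : Type*) [Finite σ] (k : ℕ) : Finset (σ →₀ ℕ) :=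
  (lowDegrees σ k).filter fun β => β.degree = k

omit [Fintype σ] in
theorem mem_homDegrees [Finite σ] {k : ℕ} {β : σ →₀ ℕ} :
    β ∈ homDegrees σ k ↔ β.degree = k := by
  simp only [homDegrees, Finset.mem_filter, mem_lowDegrees]
  omega

/-- The linear operator on power series with matrix `τ`, which lowers degrees by `d`. -/
noncomputable def degOp (d : ℕ) (τ : (σ →₀ ℕ) → (σ →₀ ℕ) → ℂ) (f : MvPowerSeries σ ℂ) :
    MvPowerSeries σ ℂ :=
  fun β => ∑ γ ∈ homDegrees σ (β.degree + d), τ β γ * coeff γ f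

theorem coeff_degOp (d : ℕ) (τ : (σ →₀ ℕ) → (σ →₀ ℕ) → ℂ) (f : MvPowerSeries σ ℂ) (β : σ →₀ ℕ) :
    coeff β (degOp d τ f) = ∑ γ ∈ homDegrees σ (β.degree + d), τ β γ * coeff γ f := rfl

theorem degOp_sub (d : ℕ) (τ : (σ →₀ ℕ) → (σ →₀ ℕ) → ℂ) (f g : MvPowerSeries σ ℂ) :
    degOp d τ (f - g) = degOp d τ f - degOp d τ g := by
  ext β
  simp only [coeff_degOp, map_sub, mul_sub, Finset.sum_sub_distrib]

theorem degOp_mem {d k : ℕ} {τ : (σ →₀ ℕ) → (σ →₀ ℕ) → ℂ} {f : MvPowerSeries σ ℂ}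
    (hf : f ∈ ordIdeal σ (k + d)) : degOp d τ f ∈ ordIdeal σ k := by
  intro β hβ
  rw [coeff_degOp]
  refine Finset.sum_eq_zero fun γ hγ => ?_
  rw [hf γ (by rw [mem_homDegrees.1 hγ]; omega), mul_zero]

omit [Fintype σ] in
/-- Multiplication by a homogeneous polynomial only depends, in each degree, on one homogeneous
part of the other factor. -/
theorem coeff_mul_eq_of_homogeneous {D : MvPowerSeries σ ℂ} {d : ℕ}
    (hD : ∀ β : σ →₀ ℕ, β.degree ≠ d → coeff β D = 0) {f g : MvPowerSeries σ ℂ} {β : σ →₀ ℕ}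
    {k : ℕ} (hβ : β.degree = k + d) (h : ∀ γ : σ →₀ ℕ, γ.degree = k → coeff γ f = coeff γ g) :
    coeff β (D * f) = coeff β (D * g) := by
  classical
  rw [coeff_mul, coeff_mul]
  refine Finset.sum_congr rfl fun p hp => ?_
  have h1 : p.1.degree + p.2.degree = β.degree := by
    rw [← map_add, Finset.HasAntidiagonal.mem_antidiagonal.1 hp]
  by_cases h2 : p.1.degree = d
  · rw [h p.2 (by omega)]
  · rw [hD _ h2, zero_mul, zero_mul]

/-- The homogeneous polynomial of degree `k` with the given coefficients. -/
noncomputable def ofHom (k : ℕ) (y : homDegrees σ k → ℂ) : MvPolynomial σ ℂ :=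
  ∑ β : homDegrees σ k, MvPolynomial.monomial (β : σ →₀ ℕ) (y β)

theorem coeff_ofHom {k : ℕ} (y : homDegrees σ k → ℂ) (β : homDegrees σ k) :
    coeff (β : σ →₀ ℕ) (ofHom k y : MvPowerSeries σ ℂ) = y β := by
  classical
  rw [MvPolynomial.coeff_coe, ofHom, MvPolynomial.coeff_sum, Finset.sum_eq_single β]
  · simp
  · intro γ _ hγ
    rw [MvPolynomial.coeff_monomial, if_neg fun hc => hγ (Subtype.ext hc)]
  · simp

/-- Multiplication by a nonzero homogeneous polynomial `D` has a left inverse that is bounded for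
the weighted norm of a suitable polydisc. The quotient by the dominant monomial of `D` is corrected
degree by degree, which is possible because the correction is invertible on each space of
homogeneous polynomials, with an inverse bounded independently of the degree. -/
theorem exists_division {D : MvPowerSeries σ ℂ} {d : ℕ}
    (hD : ∀ β : σ →₀ ℕ, β.degree ≠ d → coeff β D = 0) (hD0 : D ≠ 0) :
    ∃ (ω : σ → ℝ≥0∞) (b : ℝ≥0∞) (τ : (σ →₀ ℕ) → (σ →₀ ℕ) → ℂ),
      (∀ i, ω i ≠ 0 ∧ ω i ≠ ⊤) ∧ b ≠ ⊤ ∧ (∀ y, degOp d τ (D * y) = y) ∧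
      ∀ f, wnorm ω (degOp d τ f) ≤ b * wnorm ω f := by
  classical
  obtain ⟨ω, α, hω, hα, hdom⟩ := exists_dominant_monomial hD hD0
  have hαd : α.degree = d := by
    by_contra h
    exact hα (hD α h)
  have ha0 : ‖coeff α D‖ₑ ≠ 0 := by simpa using hα
  have hm0 : wmon ω α ≠ 0 := Finset.prod_ne_zero_iff.2 fun i _ => pow_ne_zero _ (hω i).1
  have hmt : wmon ω α ≠ ⊤ := ENNReal.prod_ne_top fun i _ => ENNReal.pow_ne_top (hω i).2
  -- multiplication by `D` followed by division by the dominant monomial, in degree `k`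
  let l : ∀ k, (homDegrees σ k → ℂ) →ₗ[ℂ] (homDegrees σ k → ℂ) := fun k =>
    { toFun := fun y β => coeff ((β : σ →₀ ℕ) + α) (D * (ofHom k y : MvPowerSeries σ ℂ))
      map_add' := fun y z => by
        ext β
        have : ofHom k (y + z) = ofHom k y + ofHom k z := by
          simp [ofHom, Finset.sum_add_distrib]
        rw [this, MvPolynomial.coe_add, mul_add, map_add]
        rfl
      map_smul' := fun c y => by
        ext β
        have : ofHom k (c • y) = MvPolynomial.C c * ofHom k y := by
          simp [ofHom, Finset.mul_sum, MvPolynomial.C_mul_monomial]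
        rw [this, MvPolynomial.coe_mul, MvPolynomial.coe_C, mul_left_comm, coeff_C_mul]
        rfl }
  have hl : ∀ k y (β : homDegrees σ k), l k y β =
      coeff ((β : σ →₀ ℕ) + α) (D * (ofHom k y : MvPowerSeries σ ℂ)) := fun _ _ _ => rfl
  have hker : ∀ k, LinearMap.ker (l k) = ⊥ := by
    intro k
    rw [LinearMap.ker_eq_bot']
    intro y hy
    have h1 : shiftDown α (D * (ofHom k y : MvPowerSeries σ ℂ)) = 0 := by
      ext β
      rw [coeff_shiftDown]
      by_cases hβ : β.degree = k
      · have := congrFun hy ⟨β, mem_homDegrees.2 hβ⟩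
        rw [hl] at this
        simpa using this
      · rw [coeff_mul_eq_of_homogeneous hD (k := β.degree) (g := 0) (by rw [map_add, hαd])]
        · simp
        · intro γ hγ
          rw [MvPolynomial.coeff_coe, ofHom, MvPolynomial.coeff_sum]
          refine Finset.sum_eq_zero fun δ _ => ?_
          rw [MvPolynomial.coeff_monomial, if_neg]
          rintro rfl
          exact hβ (hγ.symm.trans (mem_homDegrees.1 δ.2))
    have h2 := wnorm_le_of_dominant hω hdom (wnorm_coe_ne_top (fun i => (hω i).2) (ofHom k y))
    rw [h1, wnorm_zero, mul_zero, nonpos_iff_eq_zero, mul_eq_zero, or_iff_right ha0, wnorm,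
      ENNReal.tsum_eq_zero] at h2
    ext β
    have h3 := h2 β
    rw [mul_eq_zero, coeff_ofHom, enorm_eq_zero] at h3
    refine h3.resolve_right ?_
    exact Finset.prod_ne_zero_iff.2 fun i _ => pow_ne_zero _ (hω i).1
  let e : ∀ k, (homDegrees σ k → ℂ) ≃ₗ[ℂ] (homDegrees σ k → ℂ) := fun k =>
    LinearEquiv.ofInjectiveEndo (l k) (LinearMap.ker_eq_bot.1 (hker k))
  have he : ∀ k y, e k y = l k y := fun _ _ => rfl
  let τ : (σ →₀ ℕ) → (σ →₀ ℕ) → ℂ := fun β γ =>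
    (e β.degree).symm (fun δ => if (δ : σ →₀ ℕ) + α = γ then 1 else 0)
      ⟨β, mem_homDegrees.2 rfl⟩
  -- the operator with matrix `τ` inverts `l` in each degree
  have hτ : ∀ f (β : σ →₀ ℕ), coeff β (degOp d τ f) =
      (e β.degree).symm (fun δ => coeff ((δ : σ →₀ ℕ) + α) f) ⟨β, mem_homDegrees.2 rfl⟩ := by
    intro f β
    have h1 : (fun δ : homDegrees σ β.degree => coeff ((δ : σ →₀ ℕ) + α) f) =
        ∑ γ ∈ homDegrees σ (β.degree + d), coeff γ f •
          fun δ : homDegrees σ β.degree => if (δ : σ →₀ ℕ) + α = γ then (1 : ℂ) else 0 := by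
      ext δ
      rw [Finset.sum_apply, Finset.sum_eq_single ((δ : σ →₀ ℕ) + α)]
      · simp
      · intro γ _ hγ
        simp [hγ.symm]
      · intro h
        exact absurd (mem_homDegrees.2 (by rw [map_add, mem_homDegrees.1 δ.2, hαd])) h
    rw [h1, map_sum, Finset.sum_apply, coeff_degOp]
    refine Finset.sum_congr rfl fun γ _ => ?_
    rw [map_smul, Pi.smul_apply, smul_eq_mul, mul_comm]
  have hval : ∀ f k (β : homDegrees σ k), coeff (β : σ →₀ ℕ) (degOp d τ f) =
      (e k).symm (fun δ => coeff ((δ : σ →₀ ℕ) + α) f) β := by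
    rintro f k ⟨β, hβ⟩
    obtain rfl := mem_homDegrees.1 hβ
    exact hτ f β
  have hsolve : ∀ f (β : σ →₀ ℕ), coeff (β + α) (D * degOp d τ f) = coeff (β + α) f := by
    intro f β
    have h1 : coeff (β + α) (D * degOp d τ f) = l β.degree
        ((e β.degree).symm fun δ => coeff ((δ : σ →₀ ℕ) + α) f) ⟨β, mem_homDegrees.2 rfl⟩ := by
      rw [hl]
      refine coeff_mul_eq_of_homogeneous hD (k := β.degree) (by rw [map_add, hαd]) fun γ hγ => ?_
      have := coeff_ofHom ((e β.degree).symm fun δ => coeff ((δ : σ →₀ ℕ) + α) f)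
        ⟨γ, mem_homDegrees.2 hγ⟩
      rw [hval f β.degree ⟨γ, mem_homDegrees.2 hγ⟩]
      exact this.symm
    rw [h1, ← he, LinearEquiv.apply_symm_apply]
  refine ⟨ω, ‖coeff α D‖ₑ⁻¹ * 2 * (wmon ω α)⁻¹, τ, hω, ?_, fun y => ?_, fun f => ?_⟩
  · exact ENNReal.mul_ne_top (ENNReal.mul_ne_top (ENNReal.inv_ne_top.2 ha0) (by simp))
      (ENNReal.inv_ne_top.2 hm0)
  · ext β
    rw [hτ]
    have h1 : (fun δ : homDegrees σ β.degree => coeff ((δ : σ →₀ ℕ) + α) (D * y)) =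
        e β.degree (fun δ => coeff (δ : σ →₀ ℕ) y) := by
      ext δ
      rw [he, hl]
      refine coeff_mul_eq_of_homogeneous hD (k := β.degree)
        (by rw [map_add, hαd, mem_homDegrees.1 δ.2]) fun γ hγ => ?_
      rw [coeff_ofHom _ ⟨γ, mem_homDegrees.2 hγ⟩]
    rw [h1, LinearEquiv.symm_apply_apply]
  · -- truncations have finite norm, so the estimate for the dominant monomial applies to them
    refine wnorm_le_of_truncTotal fun k => ?_
    set y : MvPowerSeries σ ℂ :=
      ((truncTotal k (degOp d τ f) : MvPolynomial σ ℂ) : MvPowerSeries σ ℂ) with hy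
    have h1 := wnorm_le_of_dominant hω hdom (y := y)
      (wnorm_coe_ne_top (fun i => (hω i).2) _)
    have h2 : wnorm ω (shiftDown α (D * y)) ≤ wnorm ω (shiftDown α f) := by
      refine ENNReal.tsum_le_tsum fun β => mul_le_mul_left ?_ _
      rw [coeff_shiftDown, coeff_shiftDown]
      by_cases hβ : β.degree < k
      · rw [← hsolve f β, coeff_mul_eq_of_homogeneous hD (k := β.degree) (g := degOp d τ f)
          (by rw [map_add, hαd])]
        intro γ hγ
        rw [hy, MvPolynomial.coeff_coe, coeff_truncTotal _ (by omega)]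
      · rw [coeff_mul_eq_of_homogeneous hD (k := β.degree) (g := 0) (by rw [map_add, hαd])]
        · simp
        · intro γ hγ
          rw [hy, MvPolynomial.coeff_coe, coeff_truncTotal_eq_zero _ (by omega), map_zero]
    have h3 : wnorm ω (shiftDown α f) ≤ (wmon ω α)⁻¹ * wnorm ω f := by
      rw [mul_comm, ← div_eq_mul_inv,
        ENNReal.le_div_iff_mul_le (Or.inl hm0) (Or.inl hmt)]
      exact wnorm_shiftDown_mul_le ω α f
    calc wnorm ω y = ‖coeff α D‖ₑ⁻¹ * (‖coeff α D‖ₑ * wnorm ω y) := by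
          rw [← mul_assoc, ENNReal.inv_mul_cancel ha0 enorm_ne_top, one_mul]
      _ ≤ ‖coeff α D‖ₑ⁻¹ * (2 * ((wmon ω α)⁻¹ * wnorm ω f)) :=
          mul_le_mul_right (h1.trans (mul_le_mul_right (h2.trans h3) _)) _
      _ = _ := by ring

/-- Scaling of the polydisc: an operator lowering degrees by `d` gains a factor `r ^ (-d)`. -/
theorem wnorm_degOp_scale_le {ω : σ → ℝ≥0∞} {b : ℝ≥0∞} {d : ℕ} {τ : (σ →₀ ℕ) → (σ →₀ ℕ) → ℂ}
    (hb : ∀ f, wnorm ω (degOp d τ f) ≤ b * wnorm ω f) {r : ℝ} (hr : 0 < r)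
    (f : MvPowerSeries σ ℂ) :
    ENNReal.ofReal r ^ d * wnorm (fun i => ENNReal.ofReal r * ω i) (degOp d τ f) ≤
      b * wnorm (fun i => ENNReal.ofReal r * ω i) f := by
  let s : MvPowerSeries σ ℂ → MvPowerSeries σ ℂ := fun g β => (r : ℂ) ^ β.degree * coeff β g
  have hs : ∀ g (β : σ →₀ ℕ), coeff β (s g) = (r : ℂ) ^ β.degree * coeff β g := fun _ _ => rfl
  have hn : ∀ g, wnorm ω (s g) = wnorm (fun i => ENNReal.ofReal r * ω i) g := by
    intro g
    refine tsum_congr fun β => ?_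
    rw [hs, wmon_scale, enorm_mul, enorm_pow]
    have : ‖(r : ℂ)‖ₑ = ENNReal.ofReal r := by
      rw [← ofReal_norm, Complex.norm_real, Real.norm_of_nonneg hr.le]
    rw [this]
    ring
  have hc : degOp d τ (s f) = ((r : ℂ) ^ d) • s (degOp d τ f) := by
    ext β
    rw [coeff_smul, hs, coeff_degOp, coeff_degOp, Finset.mul_sum, Finset.mul_sum]
    refine Finset.sum_congr rfl fun γ hγ => ?_
    rw [hs, mem_homDegrees.1 hγ]
    ring
  have h1 := hb (s f)
  rw [hc, wnorm_smul, hn, hn, enorm_pow] at h1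
  have : ‖(r : ℂ)‖ₑ = ENNReal.ofReal r := by
    rw [← ofReal_norm, Complex.norm_real, Real.norm_of_nonneg hr.le]
  rwa [this] at h1

end DivisionOperator

/-! ### Uniformly bounded families of power series -/

section UniformBounds
variable {σ τ Y : Type*}

/-- The weights `ω` scaled by `r`. -/
noncomputable def scaled (ω : σ → ℝ≥0∞) (r : ℝ) : σ → ℝ≥0∞ := fun i => ENNReal.ofReal r * ω i

theorem scaled_mono (ω : σ → ℝ≥0∞) {r r' : ℝ} (h : r ≤ r') (i : σ) :
    scaled ω r i ≤ scaled ω r' i := mul_le_mul_left (ENNReal.ofReal_le_ofReal h) _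

theorem wnorm_scaled_le (ω : σ → ℝ≥0∞) {r r₀ : ℝ} (hr₀ : 0 < r₀) (h : r ≤ r₀)
    {k : ℕ} {f : MvPowerSeries σ ℂ} (hf : f ∈ ordIdeal σ k) :
    wnorm (scaled ω r) f ≤ ENNReal.ofReal (r / r₀) ^ k * wnorm (scaled ω r₀) f := by
  have h1 : scaled ω r = fun i => ENNReal.ofReal (r / r₀) * scaled ω r₀ i := by
    ext i
    rw [scaled, scaled, ← mul_assoc, ← ENNReal.ofReal_mul' hr₀.le, div_mul_cancel₀ _ hr₀.ne']
  rw [h1]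
  exact wnorm_scale_le (ENNReal.ofReal_le_one.2 ((div_le_one hr₀).2 h)) hf

/-- A family of power series that is uniformly bounded on some polydisc proportional to `ω`. -/
def UnifBdd (ω : σ → ℝ≥0∞) (Z : Set Y) (f : Y → MvPowerSeries σ ℂ) : Prop :=
  ∃ r : ℝ, 0 < r ∧ ∃ b : ℝ≥0∞, b ≠ ⊤ ∧ ∀ y ∈ Z, wnorm (scaled ω r) (f y) ≤ b

variable {ω : σ → ℝ≥0∞} {Z : Set Y}

theorem UnifBdd.add {f g : Y → MvPowerSeries σ ℂ} (hf : UnifBdd ω Z f) (hg : UnifBdd ω Z g) :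
    UnifBdd ω Z fun y => f y + g y := by
  obtain ⟨r, hr, b, hb, h⟩ := hf
  obtain ⟨r', hr', b', hb', h'⟩ := hg
  refine ⟨min r r', lt_min hr hr', b + b', ENNReal.add_ne_top.2 ⟨hb, hb'⟩, fun y hy => ?_⟩
  refine (wnorm_add_le _ _ _).trans (add_le_add ?_ ?_)
  · exact (wnorm_mono (scaled_mono ω (min_le_left _ _)) _).trans (h y hy)
  · exact (wnorm_mono (scaled_mono ω (min_le_right _ _)) _).trans (h' y hy)

theorem UnifBdd.neg {f : Y → MvPowerSeries σ ℂ} (hf : UnifBdd ω Z f) :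
    UnifBdd ω Z fun y => -f y := by
  obtain ⟨r, hr, b, hb, h⟩ := hf
  exact ⟨r, hr, b, hb, fun y hy => (wnorm_neg _ _).trans_le (h y hy)⟩

theorem UnifBdd.sub {f g : Y → MvPowerSeries σ ℂ} (hf : UnifBdd ω Z f) (hg : UnifBdd ω Z g) :
    UnifBdd ω Z fun y => f y - g y := by
  simpa only [sub_eq_add_neg] using hf.add hg.neg

theorem UnifBdd.mul {f g : Y → MvPowerSeries σ ℂ} (hf : UnifBdd ω Z f) (hg : UnifBdd ω Z g) :
    UnifBdd ω Z fun y => f y * g y := by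
  obtain ⟨r, hr, b, hb, h⟩ := hf
  obtain ⟨r', hr', b', hb', h'⟩ := hg
  refine ⟨min r r', lt_min hr hr', b * b', ENNReal.mul_ne_top hb hb', fun y hy => ?_⟩
  refine (wnorm_mul_le _ _ _).trans (mul_le_mul' ?_ ?_)
  · exact (wnorm_mono (scaled_mono ω (min_le_left _ _)) _).trans (h y hy)
  · exact (wnorm_mono (scaled_mono ω (min_le_right _ _)) _).trans (h' y hy)

theorem UnifBdd.zero : UnifBdd ω Z fun _ => (0 : MvPowerSeries σ ℂ) :=
  ⟨1, one_pos, 0, by simp, fun _ _ => by rw [wnorm_zero]⟩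

theorem UnifBdd.one : UnifBdd ω Z fun _ => (1 : MvPowerSeries σ ℂ) :=
  ⟨1, one_pos, 1, by simp, fun _ _ => by rw [wnorm_one]⟩

theorem UnifBdd.const {f : MvPowerSeries σ ℂ} {r : ℝ} (hr : 0 < r)
    (hf : wnorm (scaled ω r) f ≠ ⊤) : UnifBdd ω Z fun _ => f :=
  ⟨r, hr, _, hf, fun _ _ => le_rfl⟩

theorem UnifBdd.sum {ι : Type*} (s : Finset ι) {f : ι → Y → MvPowerSeries σ ℂ}
    (h : ∀ i ∈ s, UnifBdd ω Z (f i)) : UnifBdd ω Z fun y => ∑ i ∈ s, f i y := by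
  classical
  induction s using Finset.induction_on with
  | empty => simpa using UnifBdd.zero
  | insert i s hi ih =>
    simp only [Finset.sum_insert hi]
    exact (h i (by simp)).add (ih fun j hj => h j (by simp [hj]))

theorem UnifBdd.prod {ι : Type*} (s : Finset ι) {f : ι → Y → MvPowerSeries σ ℂ}
    (h : ∀ i ∈ s, UnifBdd ω Z (f i)) : UnifBdd ω Z fun y => ∏ i ∈ s, f i y := by
  classical
  induction s using Finset.induction_on with
  | empty => simpa using UnifBdd.one
  | insert i s hi ih =>
    simp only [Finset.prod_insert hi]
    exact (h i (by simp)).mul (ih fun j hj => h j (by simp [hj]))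

/-- Finitely many uniformly bounded families have a common polydisc and a common bound. -/
theorem UnifBdd.uniform {ι : Type*} (s : Finset ι) {f : ι → Y → MvPowerSeries σ ℂ}
    (h : ∀ i ∈ s, UnifBdd ω Z (f i)) : ∃ r : ℝ, 0 < r ∧ ∃ b : ℝ≥0∞, b ≠ ⊤ ∧
      ∀ i ∈ s, ∀ y ∈ Z, wnorm (scaled ω r) (f i y) ≤ b := by
  classical
  induction s using Finset.induction_on with
  | empty => exact ⟨1, one_pos, 0, by simp, by simp⟩
  | insert i s hi ih =>
    obtain ⟨r, hr, b, hb, hs⟩ := ih fun j hj => h j (by simp [hj])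
    obtain ⟨r', hr', b', hb', hi'⟩ := h i (by simp)
    refine ⟨min r r', lt_min hr hr', b + b', ENNReal.add_ne_top.2 ⟨hb, hb'⟩, fun j hj y hy => ?_⟩
    rcases Finset.mem_insert.1 hj with rfl | hj
    · exact ((wnorm_mono (scaled_mono ω (min_le_right _ _)) _).trans (hi' y hy)).trans
        le_add_self
    · exact ((wnorm_mono (scaled_mono ω (min_le_left _ _)) _).trans (hs j hj y hy)).trans
        le_self_add

/-- A uniformly bounded family without constant terms is small on small polydiscs. -/
theorem exists_wnorm_le {ι : Type*} [Finite ι] {a : Y → ι → MvPowerSeries σ ℂ}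
    (ha : ∀ i, UnifBdd ω Z fun y => a y i) (ha1 : ∀ y i, a y i ∈ ordIdeal σ 1)
    {ε : ι → ℝ≥0∞} (hε : ∀ i, ε i ≠ 0) :
    ∃ r : ℝ, 0 < r ∧ ∀ r', r' ≤ r → ∀ y ∈ Z, ∀ i, wnorm (scaled ω r') (a y i) ≤ ε i := by
  cases nonempty_fintype ι
  obtain ⟨r, hr, b, hb, h⟩ := UnifBdd.uniform Finset.univ fun i _ => ha i
  have h1 : ∀ i, ∀ᶠ t : ℝ in 𝓝[>] 0, ENNReal.ofReal (t / r) * b ≤ ε i := by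
    intro i
    have h2 : Tendsto (fun t : ℝ => ENNReal.ofReal (t / r) * b) (𝓝[>] 0) (𝓝 0) := by
      have h3 : Tendsto (fun t : ℝ => ENNReal.ofReal (t / r)) (𝓝[>] 0) (𝓝 0) := by
        have : Tendsto (fun t : ℝ => ENNReal.ofReal (t / r)) (𝓝 0) (𝓝 (ENNReal.ofReal (0 / r))) :=
          (ENNReal.continuous_ofReal.comp (continuous_id.div_const r)).tendsto 0
        simp only [zero_div, ENNReal.ofReal_zero] at this
        exact this.mono_left nhdsWithin_le_nhds
      simpa using ENNReal.Tendsto.mul_const h3 (Or.inr hb)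
    exact h2.eventually (Iic_mem_nhds (pos_iff_ne_zero.2 (hε i)))
  obtain ⟨t, ht, ht0, htr⟩ := ((eventually_all.2 h1).and
    (Ioc_mem_nhdsGT hr)).exists
  refine ⟨t, ht0, fun r' hr' y hy i => ?_⟩
  refine (wnorm_mono (scaled_mono ω hr') _).trans ((wnorm_scaled_le ω hr htr (ha1 y i)).trans ?_)
  rw [pow_one]
  exact (mul_le_mul_right (h i (Finset.mem_univ i) y hy) _).trans (ht i)

theorem UnifBdd.subst [Finite σ] {ω' : τ → ℝ≥0∞} {f : Y → MvPowerSeries σ ℂ}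
    (hf : UnifBdd ω Z f) (hω : ∀ i, ω i ≠ 0)
    {a : Y → σ → MvPowerSeries τ ℂ} (ha : ∀ i, UnifBdd ω' Z fun y => a y i)
    (ha1 : ∀ y i, a y i ∈ ordIdeal τ 1) :
    UnifBdd ω' Z fun y => MvPowerSeries.subst (a y) (f y) := by
  obtain ⟨r, hr, b, hb, h⟩ := hf
  obtain ⟨t, ht, h'⟩ := exists_wnorm_le ha ha1 (ε := scaled ω r) fun i =>
    mul_ne_zero (by simpa using hr) (hω i)
  refine ⟨t, ht, b, hb, fun y hy => ?_⟩
  exact (wnorm_subst_le _ (ha1 y) _).trans ((wnorm_mono (h' t le_rfl y hy) _).trans (h y hy))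

/-- Uniform bounds do not depend on the choice of the weights. -/
theorem UnifBdd.congr_weights [Finite σ] {f : Y → MvPowerSeries σ ℂ} (hf : UnifBdd ω Z f)
    {ω' : σ → ℝ≥0∞} (hω : ∀ i, ω i ≠ 0) (hω' : ∀ i, ω' i ≠ ⊤) : UnifBdd ω' Z f := by
  have := hf.subst (ω' := ω') hω (a := fun _ i => X i)
    (fun i => ⟨1, one_pos, ω' i, hω' i, fun y _ => by rw [wnorm_X]; simp [scaled]⟩)
    fun _ i => X_mem_ordIdeal_one i
  simpa [subst_self] using this

/-- A family of polynomials of bounded degree with bounded coefficients is uniformly bounded. -/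
theorem UnifBdd.of_coeff [Finite σ] {f : Y → MvPowerSeries σ ℂ} {k : ℕ} (hω : ∀ i, ω i ≠ ⊤)
    (hk : ∀ y (β : σ →₀ ℕ), k < β.degree → coeff β (f y) = 0)
    (hb : ∀ β, ∃ b : ℝ, ∀ y ∈ Z, ‖coeff β (f y)‖ ≤ b) : UnifBdd ω Z f := by
  choose b hb using hb
  refine ⟨1, one_pos, ∑ β ∈ lowDegrees σ k, ENNReal.ofReal (b β) * wmon (scaled ω 1) β,
    ENNReal.sum_ne_top.2 fun β _ => ENNReal.mul_ne_top (by simp) ?_, fun y hy => ?_⟩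
  · exact ENNReal.prod_ne_top fun i _ => ENNReal.pow_ne_top (ENNReal.mul_ne_top (by simp) (hω i))
  · rw [wnorm, tsum_eq_sum (s := lowDegrees σ k) fun β hβ => by
      rw [mem_lowDegrees, not_le] at hβ
      rw [hk y β hβ]; simp]
    refine Finset.sum_le_sum fun β _ => mul_le_mul_left ?_ _
    rw [← ofReal_norm]
    exact ENNReal.ofReal_le_ofReal (hb β y hy)

end UniformBounds

/-! ### High order parts -/

section Truncation
variable {σ : Type*} [Finite σ]

theorem wnorm_truncTotal_le (ω : σ → ℝ≥0∞) (k : ℕ) (f : MvPowerSeries σ ℂ) :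
    wnorm ω (truncTotal k f : MvPolynomial σ ℂ) ≤ wnorm ω f := by
  refine ENNReal.tsum_le_tsum fun β => mul_le_mul_left ?_ _
  rw [MvPolynomial.coeff_coe, coeff_truncTotal_eq_ite]
  split_ifs <;> simp

/-- The part of order at least `k` of a power series. -/
noncomputable def highPart (k : ℕ) (f : MvPowerSeries σ ℂ) : MvPowerSeries σ ℂ :=
  f - (truncTotal k f : MvPolynomial σ ℂ)

theorem coeff_highPart (k : ℕ) (f : MvPowerSeries σ ℂ) (β : σ →₀ ℕ) :
    coeff β (highPart k f) = if β.degree < k then 0 else coeff β f := by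
  rw [highPart, map_sub, MvPolynomial.coeff_coe, coeff_truncTotal_eq_ite]
  split_ifs <;> simp

theorem highPart_mem (k : ℕ) (f : MvPowerSeries σ ℂ) : highPart k f ∈ ordIdeal σ k :=
  sub_truncTotal_mem k f

theorem wnorm_highPart_le (ω : σ → ℝ≥0∞) (k : ℕ) (f : MvPowerSeries σ ℂ) :
    wnorm ω (highPart k f) ≤ wnorm ω f := by
  refine ENNReal.tsum_le_tsum fun β => mul_le_mul_left ?_ _
  rw [coeff_highPart]
  split_ifs <;> simp

theorem highPart_eq_self {k : ℕ} {f : MvPowerSeries σ ℂ} (hf : f ∈ ordIdeal σ k) :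
    highPart k f = f := by
  ext β
  rw [coeff_highPart]
  split_ifs with h
  · rw [hf β h]
  · rfl

theorem highPart_add (k : ℕ) (f g : MvPowerSeries σ ℂ) :
    highPart k (f + g) = highPart k f + highPart k g := by
  ext β
  simp only [coeff_highPart, map_add]
  split_ifs <;> simp

end Truncation

theorem highPart_degOp {σ : Type*} [Fintype σ] (d k : ℕ) (τ : (σ →₀ ℕ) → (σ →₀ ℕ) → ℂ)
    (f : MvPowerSeries σ ℂ) : highPart k (degOp d τ f) = degOp d τ (highPart (k + d) f) := by
  ext β
  rw [coeff_highPart, coeff_degOp, coeff_degOp]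
  split_ifs with h
  · refine (Finset.sum_eq_zero fun γ hγ => ?_).symm
    rw [coeff_highPart, if_pos (by rw [mem_homDegrees.1 hγ]; omega), mul_zero]
  · refine Finset.sum_congr rfl fun γ hγ => ?_
    rw [coeff_highPart, if_neg (by rw [mem_homDegrees.1 hγ]; omega)]

/-! ### The equation for the correction -/

section Correction
variable {σ : Type*} [Fintype σ] [DecidableEq σ]

/-- The adjugate of the Jacobian matrix of `A` along the formal map `γ`. -/
noncomputable def adjAt (A γ : σ → MvPowerSeries σ ℂ) : Matrix σ σ (MvPowerSeries σ ℂ) :=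
  ((jac A).map (subst γ)).adjugate

/-- The right-hand side of the equation `D * v = resid v`, which is equivalent to
`A (γ + v) = c` after multiplication by the adjugate Jacobian matrix along `γ`; here `D` stands for
the lowest order part of the Jacobian determinant, and `H` for the Taylor remainder of `A`. -/
noncomputable def resid (A : σ → MvPowerSeries σ ℂ) (H : σ → σ → σ → MvPowerSeries (σ ⊕ σ) ℂ)
    (D : MvPowerSeries σ ℂ) (γ c v : σ → MvPowerSeries σ ℂ) (i : σ) : MvPowerSeries σ ℂ :=
  (D - subst γ (jac A).det) * v i + ∑ l, adjAt A γ i l * (c l - subst γ (A l)) -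
    ∑ l, adjAt A γ i l * ∑ j, ∑ k, v j * (v k * subst (Sum.elim γ v) (H l j k))

variable {A : σ → MvPowerSeries σ ℂ} {H : σ → σ → σ → MvPowerSeries (σ ⊕ σ) ℂ}
  {D : MvPowerSeries σ ℂ}

theorem adjAt_mul {γ : σ → MvPowerSeries σ ℂ} (hγ : ∀ i, γ i ∈ ordIdeal σ 1)
    (v : σ → MvPowerSeries σ ℂ) (i : σ) :
    ∑ l, adjAt A γ i l * ∑ j, v j * subst γ (jac A l j) = subst γ (jac A).det * v i := by
  have hs := hasSubst_of_mem hγ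
  have h1 : subst γ (jac A).det = ((jac A).map (subst γ)).det := by
    have := RingHom.map_det (substAlgHom (R := ℂ) hs).toRingHom (jac A)
    simpa [RingHom.mapMatrix_apply] using! this
  have h2 := congrFun (congrArg (fun B => B *ᵥ v) (Matrix.adjugate_mul ((jac A).map (subst γ)))) i
  simp only [Matrix.smul_mulVec, Matrix.one_mulVec, ← Matrix.mulVec_mulVec] at h2
  rw [Pi.smul_apply, smul_eq_mul] at h2
  rw [h1, ← h2]
  simp only [Matrix.mulVec, dotProduct, adjAt, Matrix.map_apply, mul_comm]

/-- By the Taylor formula, `D * v = resid v` says that the adjugate matrix annihilates the error `c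
- A (γ + v)`. -/
theorem resid_eq (hH : ∀ l, taylorRem (A l) =
      ∑ j, ∑ k, X (Sum.inr j) * (X (Sum.inr k) * H l j k))
    {γ c v : σ → MvPowerSeries σ ℂ} (hγ : ∀ i, γ i ∈ ordIdeal σ 1)
    (hv : ∀ i, v i ∈ ordIdeal σ 1) (i : σ) :
    resid A H D γ c v i =
      D * v i + ∑ l, adjAt A γ i l * (c l - subst (fun j => γ j + v j) (A l)) := by
  have h1 : ∀ l, c l - subst (fun j => γ j + v j) (A l) = (c l - subst γ (A l)) -
      (∑ j, v j * subst γ (jac A l j)) -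
      ∑ j, ∑ k, v j * (v k * subst (Sum.elim γ v) (H l j k)) := by
    intro l
    rw [subst_add_eq (hH l) hγ hv]
    simp only [jac]
    ring
  simp only [h1, mul_sub, Finset.sum_sub_distrib]
  rw [adjAt_mul hγ, resid]
  simp only [mul_sub, Finset.sum_sub_distrib]
  ring

omit [Fintype σ] [DecidableEq σ] in
theorem sum_elim_mem {γ v : σ → MvPowerSeries σ ℂ} (hγ : ∀ i, γ i ∈ ordIdeal σ 1)
    (hv : ∀ i, v i ∈ ordIdeal σ 1) (q : σ ⊕ σ) : Sum.elim γ v q ∈ ordIdeal σ 1 := by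
  rcases q with i | i
  · exact hγ i
  · exact hv i

/-- The residual is a contraction: it improves agreement of two corrections of order at least
`d + 1` by more than `d` orders. -/
theorem resid_sub_mem {d m j : ℕ} (hm : d + 1 ≤ m)
    {γ c v v' : σ → MvPowerSeries σ ℂ} (hγ : ∀ i, γ i ∈ ordIdeal σ 1)
    (hDγ : D - subst γ (jac A).det ∈ ordIdeal σ (d + 1))
    (hv : ∀ i, v i ∈ ordIdeal σ m) (hv' : ∀ i, v' i ∈ ordIdeal σ m)
    (hvv : ∀ i, v i - v' i ∈ ordIdeal σ j) (i : σ) :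
    resid A H D γ c v i - resid A H D γ c v' i ∈ ordIdeal σ (j + 1 + d) := by
  have hv1 : ∀ i, v i ∈ ordIdeal σ 1 := fun i => ordIdeal_mono (by omega) (hv i)
  have hv1' : ∀ i, v' i ∈ ordIdeal σ 1 := fun i => ordIdeal_mono (by omega) (hv' i)
  have h1 : resid A H D γ c v i - resid A H D γ c v' i =
      (D - subst γ (jac A).det) * (v i - v' i) - ∑ l, adjAt A γ i l * ∑ j, ∑ k,
        (v j * (v k * subst (Sum.elim γ v) (H l j k)) -
          v' j * (v' k * subst (Sum.elim γ v') (H l j k))) := by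
    simp only [resid, Finset.sum_sub_distrib, mul_sub]
    ring
  rw [h1]
  refine Ideal.sub_mem _ (ordIdeal_mono (by omega) (mul_mem_ordIdeal hDγ (hvv i)))
    (Ideal.sum_mem _ fun l _ => Ideal.mul_mem_left _ _
      (Ideal.sum_mem _ fun p _ => Ideal.sum_mem _ fun k _ => ?_))
  have h2 : subst (Sum.elim γ v) (H l p k) - subst (Sum.elim γ v') (H l p k) ∈ ordIdeal σ j := by
    refine subst_sub_subst_mem (sum_elim_mem hγ hv1) (sum_elim_mem hγ hv1') ?_ _
    rintro (q | q)
    · simp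
    · exact hvv q
  have h3 : v p * (v k * subst (Sum.elim γ v) (H l p k)) -
      v' p * (v' k * subst (Sum.elim γ v') (H l p k)) =
      (v p - v' p) * v k * subst (Sum.elim γ v) (H l p k) +
      v' p * (v k - v' k) * subst (Sum.elim γ v) (H l p k) +
      v' p * (subst (Sum.elim γ v) (H l p k) - subst (Sum.elim γ v') (H l p k)) * v' k := by
    ring
  rw [h3]
  refine Ideal.add_mem _ (Ideal.add_mem _ ?_ ?_) ?_
  · exact Ideal.mul_mem_right _ _ (ordIdeal_mono (by omega) (mul_mem_ordIdeal (hvv p) (hv k)))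
  · exact Ideal.mul_mem_right _ _ (ordIdeal_mono (by omega) (mul_mem_ordIdeal (hv' p) (hvv k)))
  · exact Ideal.mul_mem_right _ _ (ordIdeal_mono (by omega) (mul_mem_ordIdeal (hv' p) h2))

/-- The fixed point operator for the correction `v`: division of the residual by `D`, in orders
at least `m`. -/
noncomputable def fixOp (d m : ℕ) (τ : (σ →₀ ℕ) → (σ →₀ ℕ) → ℂ) (A : σ → MvPowerSeries σ ℂ)
    (H : σ → σ → σ → MvPowerSeries (σ ⊕ σ) ℂ) (D : MvPowerSeries σ ℂ)
    (γ c v : σ → MvPowerSeries σ ℂ) (i : σ) : MvPowerSeries σ ℂ :=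
  highPart m (degOp d τ (resid A H D γ c v i))

/-- The fixed point of the correction operator, assembled from the iterates of `0`: the coefficients
of degree `k` are constant from the `k + 1`-st iterate on. -/
noncomputable def fixPt (f : (σ → MvPowerSeries σ ℂ) → σ → MvPowerSeries σ ℂ) (i : σ) :
    MvPowerSeries σ ℂ :=
  fun β => coeff β (f^[β.degree + 1] 0 i)

omit [Fintype σ] [DecidableEq σ] in
theorem coeff_fixPt (f : (σ → MvPowerSeries σ ℂ) → σ → MvPowerSeries σ ℂ) (i : σ) (β : σ →₀ ℕ) :
    coeff β (fixPt f i) = coeff β (f^[β.degree + 1] 0 i) := rfl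

omit [Fintype σ] [DecidableEq σ] in
theorem fixPt_sub_iterate_mem {f : (σ → MvPowerSeries σ ℂ) → σ → MvPowerSeries σ ℂ} {m : ℕ}
    (hfm : ∀ v i, f v i ∈ ordIdeal σ m)
    (hf : ∀ j v v', (∀ i, v i ∈ ordIdeal σ m) → (∀ i, v' i ∈ ordIdeal σ m) →
      (∀ i, v i - v' i ∈ ordIdeal σ j) → ∀ i, f v i - f v' i ∈ ordIdeal σ (j + 1))
    (j : ℕ) (i : σ) : fixPt f i - f^[j] 0 i ∈ ordIdeal σ j := by
  have hm : ∀ j i, f^[j] 0 i ∈ ordIdeal σ m := by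
    rintro (_ | j) i
    · exact Ideal.zero_mem _
    · rw [Function.iterate_succ_apply']
      exact hfm _ _
  have h1 : ∀ j i, f^[j + 1] 0 i - f^[j] 0 i ∈ ordIdeal σ j := by
    intro j
    induction j with
    | zero => exact fun i => mem_ordIdeal_zero _
    | succ j ih =>
      intro i
      rw [Function.iterate_succ_apply', Function.iterate_succ_apply' f j]
      have := hf j _ _ (hm (j + 1)) (hm j) ih i
      rwa [Function.iterate_succ_apply' f j] at this
  have h2 : ∀ l j i, f^[j + l] 0 i - f^[j] 0 i ∈ ordIdeal σ j := by
    intro l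
    induction l with
    | zero => intro j i; simp
    | succ l ih =>
      intro j i
      have := Ideal.add_mem _ (ordIdeal_mono (Nat.le_add_right j l) (h1 (j + l) i)) (ih j i)
      simpa [add_assoc] using this
  intro β hβ
  obtain ⟨l, rfl⟩ : ∃ l, j = β.degree + 1 + l := ⟨j - (β.degree + 1), by omega⟩
  have := h2 l (β.degree + 1) i β (by omega)
  rw [map_sub, sub_eq_zero] at this
  rw [map_sub, coeff_fixPt, this, sub_self]

omit [Fintype σ] [DecidableEq σ] in
theorem eq_fixPt {f : (σ → MvPowerSeries σ ℂ) → σ → MvPowerSeries σ ℂ} {m : ℕ}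
    (hfm : ∀ v i, f v i ∈ ordIdeal σ m)
    (hf : ∀ j v v', (∀ i, v i ∈ ordIdeal σ m) → (∀ i, v' i ∈ ordIdeal σ m) →
      (∀ i, v i - v' i ∈ ordIdeal σ j) → ∀ i, f v i - f v' i ∈ ordIdeal σ (j + 1))
    {v : σ → MvPowerSeries σ ℂ} (hv : ∀ i, v i ∈ ordIdeal σ m) (hfv : f v = v) : v = fixPt f := by
  have h1 : ∀ j i, v i - f^[j] 0 i ∈ ordIdeal σ j := by
    intro j
    induction j with
    | zero => exact fun i => mem_ordIdeal_zero _
    | succ j ih =>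
      intro i
      have hm : ∀ i, f^[j] 0 i ∈ ordIdeal σ m := by
        intro i
        obtain _ | j := j
        · exact Ideal.zero_mem _
        · rw [Function.iterate_succ_apply']
          exact hfm _ _
      rw [Function.iterate_succ_apply', ← congrFun hfv i]
      exact hf j _ _ hv hm ih i
  funext i
  refine sub_eq_zero.1 (eq_zero_of_forall_mem_ordIdeal fun j => ?_)
  have := Ideal.sub_mem _ (h1 j i) (fixPt_sub_iterate_mem hfm hf j i)
  simpa using this

omit [DecidableEq σ] in
/-- The fixed point lies in every weighted norm ball that the operator maps to itself, as the norm is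
lower semicontinuous under convergence of coefficients. -/
theorem wnorm_fixPt_le {f : (σ → MvPowerSeries σ ℂ) → σ → MvPowerSeries σ ℂ} {m : ℕ}
    (hfm : ∀ v i, f v i ∈ ordIdeal σ m)
    (hf : ∀ j v v', (∀ i, v i ∈ ordIdeal σ m) → (∀ i, v' i ∈ ordIdeal σ m) →
      (∀ i, v i - v' i ∈ ordIdeal σ j) → ∀ i, f v i - f v' i ∈ ordIdeal σ (j + 1))
    {ω : σ → ℝ≥0∞} {b : ℝ≥0∞}
    (hb : ∀ v, (∀ i, v i ∈ ordIdeal σ m) → (∀ i, wnorm ω (v i) ≤ b) → ∀ i, wnorm ω (f v i) ≤ b)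
    (i : σ) : wnorm ω (fixPt f i) ≤ b := by
  refine wnorm_le_of_truncTotal fun k => ?_
  have h1 : truncTotal k (fixPt f i) = truncTotal k (f^[k] 0 i) := by
    ext β
    rw [coeff_truncTotal_eq_ite, coeff_truncTotal_eq_ite]
    split_ifs with h
    · have := fixPt_sub_iterate_mem hfm hf k i β h
      rwa [map_sub, sub_eq_zero] at this
    · rfl
  have h2 : ∀ k, (∀ i, f^[k] 0 i ∈ ordIdeal σ m) ∧ ∀ i, wnorm ω (f^[k] 0 i) ≤ b := by
    intro k
    induction k with
    | zero => exact ⟨fun i => Ideal.zero_mem _, fun i => by simp [wnorm_zero]⟩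
    | succ k ih =>
      simp only [Function.iterate_succ_apply']
      exact ⟨fun i => hfm _ _, hb _ ih.1 ih.2⟩
  rw [h1]
  exact (wnorm_truncTotal_le _ _ _).trans ((h2 k).2 i)

end Correction

/-! ### The fixed point operator -/

section FixedPoint
variable {σ : Type*} [Fintype σ] [DecidableEq σ] {A : σ → MvPowerSeries σ ℂ}
  {H : σ → σ → σ → MvPowerSeries (σ ⊕ σ) ℂ} {D : MvPowerSeries σ ℂ} {d : ℕ}
  {τ : (σ →₀ ℕ) → (σ →₀ ℕ) → ℂ}

theorem fixOp_mem (m : ℕ) (γ c v : σ → MvPowerSeries σ ℂ) (i : σ) :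
    fixOp d m τ A H D γ c v i ∈ ordIdeal σ m := highPart_mem _ _

theorem fixOp_sub_mem {m j : ℕ} (hm : d + 1 ≤ m)
    {γ c v v' : σ → MvPowerSeries σ ℂ} (hγ : ∀ i, γ i ∈ ordIdeal σ 1)
    (hDγ : D - subst γ (jac A).det ∈ ordIdeal σ (d + 1))
    (hv : ∀ i, v i ∈ ordIdeal σ m) (hv' : ∀ i, v' i ∈ ordIdeal σ m)
    (hvv : ∀ i, v i - v' i ∈ ordIdeal σ j) (i : σ) :
    fixOp d m τ A H D γ c v i - fixOp d m τ A H D γ c v' i ∈ ordIdeal σ (j + 1) := by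
  have h1 := degOp_mem (τ := τ) (resid_sub_mem (H := H) (c := c) hm hγ hDγ hv hv' hvv i)
  rw [degOp_sub] at h1
  intro β hβ
  have h2 := h1 β hβ
  rw [map_sub, sub_eq_zero] at h2
  rw [map_sub, fixOp, fixOp, coeff_highPart, coeff_highPart, h2, sub_self]

theorem fixOp_eq_self {m : ℕ} (hm : 1 ≤ m) (hτ : ∀ y, degOp d τ (D * y) = y)
    (hH : ∀ l, taylorRem (A l) = ∑ j, ∑ k, X (Sum.inr j) * (X (Sum.inr k) * H l j k))
    {γ c v : σ → MvPowerSeries σ ℂ} (hγ : ∀ i, γ i ∈ ordIdeal σ 1)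
    (hv : ∀ i, v i ∈ ordIdeal σ m) (hc : ∀ l, subst (fun j => γ j + v j) (A l) = c l) :
    fixOp d m τ A H D γ c v = v := by
  funext i
  rw [fixOp, resid_eq hH hγ fun i => ordIdeal_mono hm (hv i)]
  simp only [hc, sub_self, mul_zero, Finset.sum_const_zero, add_zero]
  rw [hτ, highPart_eq_self (hv i)]

variable {Y : Type*}

theorem hasCoeffs_det {F : ℕ → Subalgebra ℂ (Y → ℂ)} (hF : Monotone F)
    {B : Y → Matrix σ σ (MvPowerSeries σ ℂ)} (hB : ∀ i j, HasCoeffs F fun y => B y i j) :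
    HasCoeffs F fun y => (B y).det := by
  simp only [Matrix.det_apply']
  refine HasCoeffs.sum _ fun p _ => ?_
  refine HasCoeffs.mul hF (HasCoeffs.const _) (HasCoeffs.prod hF _ fun i _ => hB _ _)

theorem hasCoeffs_adjAt {F : ℕ → Subalgebra ℂ (Y → ℂ)} (hF : Monotone F)
    {γ : Y → σ → MvPowerSeries σ ℂ} (hγ : ∀ i, HasCoeffs F fun y => γ y i)
    (hγ1 : ∀ y i, γ y i ∈ ordIdeal σ 1) (i j : σ) : HasCoeffs F fun y => adjAt A (γ y) i j := by
  simp only [adjAt, Matrix.adjugate_apply]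
  refine hasCoeffs_det hF fun k l => ?_
  by_cases h : k = j
  · subst h
    simpa using HasCoeffs.const (F := F) _
  · simp only [Matrix.updateRow_ne h, Matrix.map_apply]
    exact (HasCoeffs.const _).subst hF hγ hγ1

/-- In degree `k + d` the residual involves the coefficients of `c` up to degree `k + d`, but those
of `v` only up to degree `k`, because `v` always appears multiplied by a factor of order more than
`d`. Hence dividing by `D` does not add to the loss of derivatives. -/
theorem coeff_resid_mem {F : ℕ → Subalgebra ℂ (Y → ℂ)} (hF : Monotone F) {K m : ℕ}
    (hm : d + 1 ≤ m) {γ c v : Y → σ → MvPowerSeries σ ℂ}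
    (hγ : ∀ i, HasCoeffs (fun _ => F K) fun y => γ y i) (hγ1 : ∀ y i, γ y i ∈ ordIdeal σ 1)
    (hDγ : ∀ y, D - subst (γ y) (jac A).det ∈ ordIdeal σ (d + 1))
    (hc : ∀ i, HasCoeffs F fun y => c y i)
    (hv : ∀ i, HasCoeffs (fun k => F (k + (K + d))) fun y => v y i)
    (hvm : ∀ y i, v y i ∈ ordIdeal σ m) (i : σ) {β : σ →₀ ℕ} {k : ℕ} (hβ : β.degree = k + d) :
    (fun y => coeff β (resid A H D (γ y) (c y) (v y) i)) ∈ F (k + (K + d)) := by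
  have hF1 : Monotone fun k => F (k + (K + d)) := fun a b h => hF (by omega)
  have hF2 : Monotone fun k => F (k + K) := fun a b h => hF (by omega)
  have hγF1 : ∀ i, HasCoeffs (fun k => F (k + (K + d))) fun y => γ y i :=
    fun i => (hγ i).mono fun k => hF (by omega)
  have hγF2 : ∀ i, HasCoeffs (fun k => F (k + K)) fun y => γ y i :=
    fun i => (hγ i).mono fun k => hF (by omega)
  have hcF2 : ∀ i, HasCoeffs (fun k => F (k + K)) fun y => c y i :=
    fun i => (hc i).mono fun k => hF (by omega)
  have hv1 : ∀ y i, v y i ∈ ordIdeal σ 1 := fun y i => ordIdeal_mono (by omega) (hvm y i)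
  simp only [resid, map_sub, map_add, map_sum]
  refine (F (k + (K + d))).sub_mem ((F (k + (K + d))).add_mem ?_ (sum_fun_mem _ _ fun l _ => ?_))
    (sum_fun_mem _ _ fun l _ => ?_)
  · refine coeff_mul_mem_of_ord hF1 (a := d + 1) (b := m) ?_ (hv i) hDγ (fun y => hvm y i)
      (by omega) (by omega)
    exact (HasCoeffs.const _).sub ((HasCoeffs.const _).subst hF1 hγF1 hγ1)
  · have h1 : HasCoeffs (fun k => F (k + K))
        fun y => adjAt A (γ y) i l * (c y l - subst (γ y) (A l)) :=
      (hasCoeffs_adjAt hF2 hγF2 hγ1 i l).mul hF2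
        ((hcF2 l).sub ((HasCoeffs.const _).subst hF2 hγF2 hγ1))
    exact hF (by omega) (h1 β)
  · simp only [Finset.mul_sum, map_sum]
    refine sum_fun_mem _ _ fun p _ => sum_fun_mem _ _ fun q _ => ?_
    simp only [mul_left_comm (adjAt A (γ _) i l)]
    refine coeff_mul_mem_of_ord hF1 (a := m) (b := m) (hv p) ?_ (fun y => hvm y p)
      (fun y => Ideal.mul_mem_right _ _ (hvm y q)) (by omega) (by omega)
    refine (hv q).mul hF1 ((hasCoeffs_adjAt hF1 hγF1 hγ1 i l).mul hF1 ?_)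
    refine (HasCoeffs.const _).subst hF1 ?_ fun y => sum_elim_mem (hγ1 y) (hv1 y)
    rintro (j | j)
    · exact hγF1 j
    · exact hv j

/-- The coefficients of the fixed point depend on the data with the fixed loss `K + d` in all
degrees. -/
theorem hasCoeffs_fixPt {F : ℕ → Subalgebra ℂ (Y → ℂ)} (hF : Monotone F) {K m : ℕ}
    (hm : d + 1 ≤ m) {γ c : Y → σ → MvPowerSeries σ ℂ}
    (hγ : ∀ i, HasCoeffs (fun _ => F K) fun y => γ y i) (hγ1 : ∀ y i, γ y i ∈ ordIdeal σ 1)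
    (hDγ : ∀ y, D - subst (γ y) (jac A).det ∈ ordIdeal σ (d + 1))
    (hc : ∀ i, HasCoeffs F fun y => c y i) (i : σ) :
    HasCoeffs (fun k => F (k + (K + d))) fun y => fixPt (fixOp d m τ A H D (γ y) (c y)) i := by
  have h1 : ∀ j, (∀ i, HasCoeffs (fun k => F (k + (K + d)))
      fun y => (fixOp d m τ A H D (γ y) (c y))^[j] 0 i) ∧
      ∀ y i, (fixOp d m τ A H D (γ y) (c y))^[j] 0 i ∈ ordIdeal σ m := by
    intro j
    induction j with
    | zero => exact ⟨fun i => HasCoeffs.const _, fun y i => Ideal.zero_mem _⟩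
    | succ j ih =>
      simp only [Function.iterate_succ_apply']
      refine ⟨fun i β => ?_, fun y i => fixOp_mem _ _ _ _ _⟩
      simp only [fixOp, coeff_highPart, coeff_degOp]
      split_ifs with h
      · exact const_fun_mem _ _
      · refine sum_fun_mem _ _ fun γ' hγ' => Subalgebra.mul_mem _ (const_fun_mem _ _) ?_
        exact coeff_resid_mem hF hm hγ hγ1 hDγ hc ih.1 ih.2 i (mem_homDegrees.1 hγ')
  intro β
  exact (h1 (β.degree + 1)).1 i β

end FixedPoint

/-! ### Bounds for the correction -/

section Bounds
variable {σ : Type*} [Fintype σ] [DecidableEq σ] {A : σ → MvPowerSeries σ ℂ}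
  {H : σ → σ → σ → MvPowerSeries (σ ⊕ σ) ℂ} {D : MvPowerSeries σ ℂ} {d : ℕ}
  {τ : (σ →₀ ℕ) → (σ →₀ ℕ) → ℂ} {Y : Type*} {Z : Set Y} {ω : σ → ℝ≥0∞}

theorem unifBdd_det {B : Y → Matrix σ σ (MvPowerSeries σ ℂ)}
    (hB : ∀ i j, UnifBdd ω Z fun y => B y i j) : UnifBdd ω Z fun y => (B y).det := by
  simp only [Matrix.det_apply']
  refine UnifBdd.sum _ fun p _ => UnifBdd.mul ?_ (UnifBdd.prod _ fun i _ => hB _ _)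
  rcases Int.units_eq_one_or (Equiv.Perm.sign p) with h | h
  · simpa [h] using UnifBdd.one
  · simpa [h] using UnifBdd.one.neg

theorem unifBdd_adjugate {B : Y → Matrix σ σ (MvPowerSeries σ ℂ)}
    (hB : ∀ i j, UnifBdd ω Z fun y => B y i j) (i j : σ) :
    UnifBdd ω Z fun y => (B y).adjugate i j := by
  simp only [Matrix.adjugate_apply]
  refine unifBdd_det fun k l => ?_
  by_cases h : k = j
  · subst h
    simp only [Matrix.updateRow_self]
    by_cases h' : l = i
    · subst h'
      simpa using UnifBdd.one
    · simpa [Pi.single_apply, h'] using UnifBdd.zero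
  · simpa only [Matrix.updateRow_ne h] using hB k l

theorem exists_pos_ofReal_le {ε : ℝ≥0∞} (hε : ε ≠ 0) :
    ∀ᶠ r : ℝ in 𝓝[>] 0, ENNReal.ofReal r ≤ ε := by
  have h : Tendsto ENNReal.ofReal (𝓝[>] (0 : ℝ)) (𝓝 0) := by
    have := ENNReal.continuous_ofReal.tendsto 0
    rw [ENNReal.ofReal_zero] at this
    exact this.mono_left nhdsWithin_le_nhds
  exact h.eventually (Iic_mem_nhds (pos_iff_ne_zero.2 hε))

omit [DecidableEq σ] in
theorem wnorm_quadratic_le {ω : σ → ℝ≥0∞} {v : σ → MvPowerSeries σ ℂ} {e b₁ : ℝ≥0∞}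
    (hv : ∀ i, wnorm ω (v i) ≤ e) {a : σ → MvPowerSeries σ ℂ} (ha : ∀ l, wnorm ω (a l) ≤ b₁)
    {h : σ → σ → σ → MvPowerSeries σ ℂ} {B : σ → σ → σ → ℝ≥0∞}
    (hB : ∀ l j k, wnorm ω (h l j k) ≤ B l j k) :
    wnorm ω (∑ l, a l * ∑ j, ∑ k, v j * (v k * h l j k)) ≤
      e * e * (b₁ * ∑ l, ∑ j, ∑ k, B l j k) := by
  rw [Finset.mul_sum, Finset.mul_sum]
  refine (wnorm_sum_le _ _ _).trans (Finset.sum_le_sum fun l _ => ?_)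
  refine (wnorm_mul_le _ _ _).trans ?_
  have h1 : wnorm ω (∑ j, ∑ k, v j * (v k * h l j k)) ≤ e * e * ∑ j, ∑ k, B l j k := by
    rw [Finset.mul_sum]
    refine (wnorm_sum_le _ _ _).trans (Finset.sum_le_sum fun j _ => ?_)
    rw [Finset.mul_sum]
    refine (wnorm_sum_le _ _ _).trans (Finset.sum_le_sum fun k _ => ?_)
    rw [mul_assoc]
    exact (wnorm_mul_le _ _ _).trans (mul_le_mul' (hv j)
      ((wnorm_mul_le _ _ _).trans (mul_le_mul' (hv k) (hB l j k))))
  refine (mul_le_mul' (ha l) h1).trans (le_of_eq ?_)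
  rw [mul_left_comm]

theorem wnorm_highPart_resid_le {ω : σ → ℝ≥0∞} {m : ℕ} {γ c v : σ → MvPowerSeries σ ℂ}
    {e e₁ e₂ b₁ : ℝ≥0∞} {B : σ → σ → σ → ℝ≥0∞} (hv : ∀ i, wnorm ω (v i) ≤ e)
    (hdet : wnorm ω (D - subst γ (jac A).det) ≤ e₁) (i : σ)
    (hres : wnorm ω (highPart m (∑ l, adjAt A γ i l * (c l - subst γ (A l)))) ≤ e₂)
    (hadj : ∀ l, wnorm ω (adjAt A γ i l) ≤ b₁)
    (hB : ∀ l j k, wnorm ω (subst (Sum.elim γ v) (H l j k)) ≤ B l j k) :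
    wnorm ω (highPart m (resid A H D γ c v i)) ≤
      e₁ * e + e₂ + e * e * (b₁ * ∑ l, ∑ j, ∑ k, B l j k) := by
  rw [resid, sub_eq_add_neg, highPart_add, highPart_add]
  refine (wnorm_add_le _ _ _).trans
    (add_le_add ((wnorm_add_le _ _ _).trans (add_le_add ?_ hres)) ?_)
  · exact (wnorm_highPart_le _ _ _).trans ((wnorm_mul_le _ _ _).trans (mul_le_mul' hdet (hv i)))
  · refine (wnorm_highPart_le _ _ _).trans ?_
    rw [wnorm_neg]
    exact wnorm_quadratic_le hv hadj hB

/-- The corrections are uniformly bounded: on a polydisc of size `r` the residual of a correction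
of size `r ^ (d + 1)` has size `r ^ (2 d + 2)`, and division by `D` loses only a factor `r ^ d`. -/
theorem unifBdd_fixPt (hω : ∀ i, ω i ≠ 0 ∧ ω i ≠ ⊤) {b : ℝ≥0∞} (hb : b ≠ ⊤)
    (hT : ∀ f, wnorm ω (degOp d τ f) ≤ b * wnorm ω f)
    {ρ : ℝ} (hρ : 0 < ρ)
    (hH : ∀ l j k, wnorm (fun q => ENNReal.ofReal ρ * Sum.elim ω ω q) (H l j k) ≠ ⊤)
    {γ c : Y → σ → MvPowerSeries σ ℂ} (hγ : ∀ i, UnifBdd ω Z fun y => γ y i)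
    (hγ1 : ∀ y i, γ y i ∈ ordIdeal σ 1)
    (hDγ : ∀ y, D - subst (γ y) (jac A).det ∈ ordIdeal σ (d + 1))
    (hadj : ∀ i l, UnifBdd ω Z fun y => adjAt A (γ y) i l)
    (hres : ∀ i, UnifBdd ω Z fun y => ∑ l, adjAt A (γ y) i l * (c y l - subst (γ y) (A l)))
    (hDet : UnifBdd ω Z fun y => D - subst (γ y) (jac A).det) (i : σ) :
    UnifBdd ω Z fun y => fixPt (fixOp d (d + 2) τ A H D (γ y) (c y)) i := by
  obtain ⟨r₁, hr₁, b₁, hb₁, hall⟩ := UnifBdd.uniform (ω := ω) (Z := Z) Finset.univ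
    (f := Sum.elim (fun q : σ × σ => fun y => adjAt A (γ y) q.1 q.2)
      (Sum.elim (fun i => fun y => ∑ l, adjAt A (γ y) i l * (c y l - subst (γ y) (A l)))
        (fun _ : Unit => fun y => D - subst (γ y) (jac A).det))) (by
      rintro (q | i | q) _
      · exact hadj q.1 q.2
      · exact hres i
      · exact hDet)
  have hb_adj : ∀ i l, ∀ y ∈ Z, wnorm (scaled ω r₁) (adjAt A (γ y) i l) ≤ b₁ := fun i l =>
    hall (Sum.inl (i, l)) (Finset.mem_univ _)
  have hb_res : ∀ i, ∀ y ∈ Z, wnorm (scaled ω r₁)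
      (∑ l, adjAt A (γ y) i l * (c y l - subst (γ y) (A l))) ≤ b₁ := fun i =>
    hall (Sum.inr (Sum.inl i)) (Finset.mem_univ _)
  have hb_det : ∀ y ∈ Z, wnorm (scaled ω r₁) (D - subst (γ y) (jac A).det) ≤ b₁ :=
    hall (Sum.inr (Sum.inr ())) (Finset.mem_univ _)
  set bH : ℝ≥0∞ := ∑ l, ∑ j, ∑ k, wnorm (fun q => ENNReal.ofReal ρ * Sum.elim ω ω q) (H l j k)
    with hbH
  have hbHt : bH ≠ ⊤ := ENNReal.sum_ne_top.2 fun l _ => ENNReal.sum_ne_top.2 fun j _ =>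
    ENNReal.sum_ne_top.2 fun k _ => hH l j k
  have hρω : ∀ i, scaled ω ρ i ≠ 0 := fun i => mul_ne_zero (by simpa using hρ) (hω i).1
  obtain ⟨r₂, hr₂, hγr⟩ := exists_wnorm_le hγ hγ1 hρω
  -- on the polydisc of size `r` the residual is at most `r ^ (2 * d + 2) * M`, and `r` is taken so
  -- small that the surplus factor `r` absorbs `b * M`
  let q : ℝ≥0∞ := ENNReal.ofReal (1 / r₁)
  let M : ℝ≥0∞ := q ^ (d + 1) * b₁ + q ^ (2 * d + 2) * b₁ + b₁ * bH
  have hM : M ≠ ⊤ := by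
    refine ENNReal.add_ne_top.2 ⟨ENNReal.add_ne_top.2 ⟨?_, ?_⟩, ?_⟩
    · exact ENNReal.mul_ne_top (ENNReal.pow_ne_top ENNReal.ofReal_ne_top) hb₁
    · exact ENNReal.mul_ne_top (ENNReal.pow_ne_top ENNReal.ofReal_ne_top) hb₁
    · exact ENNReal.mul_ne_top hb₁ hbHt
  have hinv : (b * M)⁻¹ ≠ 0 := ENNReal.inv_ne_zero.2 (ENNReal.mul_ne_top hb hM)
  obtain ⟨r, hrρ, hrM, hr0, hrle⟩ :=
    ((eventually_all.2 fun i => exists_pos_ofReal_le (hρω i)).and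
      ((exists_pos_ofReal_le hinv).and (Ioc_mem_nhdsGT
        (lt_min one_pos (lt_min hr₁ hr₂))))).exists
  have hr1 : r ≤ 1 := hrle.trans (min_le_left _ _)
  have hrr₁ : r ≤ r₁ := hrle.trans ((min_le_right _ _).trans (min_le_left _ _))
  have hrr₂ : r ≤ r₂ := hrle.trans ((min_le_right _ _).trans (min_le_right _ _))
  set t : ℝ≥0∞ := ENNReal.ofReal r with ht
  have ht0 : t ≠ 0 := by simpa [ht] using hr0
  have htt : t ≠ ⊤ := ENNReal.ofReal_ne_top
  have ht1 : t ≤ 1 := ENNReal.ofReal_le_one.2 hr1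
  have hdiv : ENNReal.ofReal (r / r₁) = t * q := by
    rw [ht, ← ENNReal.ofReal_mul hr0.le, mul_one_div]
  refine ⟨r, hr0, t ^ (d + 1), ENNReal.pow_ne_top htt, fun y hy => ?_⟩
  refine wnorm_fixPt_le (f := fixOp d (d + 2) τ A H D (γ y) (c y)) (m := d + 2)
    (fun v i => fixOp_mem _ _ _ _ _)
    (fun j v v' hv hv' hvv => fixOp_sub_mem (by omega) (hγ1 y) (hDγ y) hv hv' hvv) ?_ i
  intro v hv hvn i
  have h1 : wnorm (scaled ω r) (D - subst (γ y) (jac A).det) ≤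
      t ^ (d + 1) * (q ^ (d + 1) * b₁) := by
    have h2 := (wnorm_scaled_le ω hr₁ hrr₁ (hDγ y)).trans (mul_le_mul_right (hb_det y hy) _)
    rwa [hdiv, mul_pow, mul_assoc] at h2
  have h2 : wnorm (scaled ω r) (highPart (d + 2 + d)
      (∑ l, adjAt A (γ y) i l * (c y l - subst (γ y) (A l)))) ≤
      t ^ (2 * d + 2) * (q ^ (2 * d + 2) * b₁) := by
    refine (wnorm_scaled_le ω hr₁ hrr₁ (highPart_mem _ _)).trans ?_
    rw [hdiv, mul_pow, show d + 2 + d = 2 * d + 2 by ring, mul_assoc]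
    exact mul_le_mul_right (mul_le_mul_right ((wnorm_highPart_le _ _ _).trans (hb_res i y hy)) _) _
  have hHn : ∀ l j k, wnorm (scaled ω r) (subst (Sum.elim (γ y) v) (H l j k)) ≤
      wnorm (fun q => ENNReal.ofReal ρ * Sum.elim ω ω q) (H l j k) := by
    intro l j k
    refine (wnorm_subst_le _ (sum_elim_mem (hγ1 y)
      fun i => ordIdeal_mono (by omega) (hv i)) _).trans (wnorm_mono ?_ _)
    rintro (p | p)
    · exact hγr r hrr₂ y hy p
    · refine (hvn p).trans (le_trans ?_ (hrρ p))
      calc t ^ (d + 1) ≤ t ^ 1 := pow_le_pow_right_of_le_one' ht1 (by omega)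
        _ = t := pow_one t
  have h4 : wnorm (scaled ω r) (highPart (d + 2 + d) (resid A H D (γ y) (c y) v i)) ≤
      t ^ (2 * d + 2) * M := by
    refine (wnorm_highPart_resid_le hvn h1 i h2
      (fun l => (wnorm_mono (scaled_mono ω hrr₁) _).trans (hb_adj i l y hy)) hHn).trans
      (le_of_eq ?_)
    simp only [M]
    ring
  have h5 : t ^ d * wnorm (scaled ω r) (fixOp d (d + 2) τ A H D (γ y) (c y) v i) ≤
      t ^ d * t ^ (d + 1) := by
    rw [fixOp, highPart_degOp]
    refine (wnorm_degOp_scale_le hT hr0 _).trans ?_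
    calc b * wnorm (scaled ω r) (highPart (d + 2 + d) (resid A H D (γ y) (c y) v i))
        ≤ b * (t ^ (2 * d + 2) * M) := mul_le_mul_right h4 _
      _ = t ^ d * t ^ (d + 1) * (b * M * t) := by ring
      _ ≤ t ^ d * t ^ (d + 1) * 1 := by
          refine mul_le_mul_right ((mul_le_mul_right hrM _).trans ?_) _
          exact ENNReal.mul_inv_le_one _
      _ = _ := mul_one _
  exact (ENNReal.mul_le_mul_iff_right (pow_ne_zero d ht0) (ENNReal.pow_ne_top htt)).1 h5

end Bounds

/-! ### Bounds for derivatives -/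

section Derivative
variable {σ : Type*}

theorem wmon_const (t : ℝ≥0∞) (β : σ →₀ ℕ) : wmon (fun _ => t) β = t ^ β.degree := by
  rw [wmon, Finsupp.prod, Finset.prod_pow_eq_pow_sum, Finsupp.degree]
  rfl

/-- A derivative converges on a smaller polydisc, because `k + 1 ≤ 2 ^ k`. -/
theorem wnorm_pderiv_le {r : ℝ} (hr : 0 ≤ r) (j : σ) (f : MvPowerSeries σ ℂ) :
    wnorm (fun _ => ENNReal.ofReal (r / 2)) (pderiv ℂ j f) * ENNReal.ofReal r ≤
      wnorm (fun _ => ENNReal.ofReal r) f := by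
  classical
  rw [wnorm, ← ENNReal.tsum_mul_right]
  refine le_trans (ENNReal.tsum_le_tsum fun β => ?_) (ENNReal.tsum_comp_le_tsum_of_injective
    (add_left_injective (Finsupp.single j 1)) fun β => ‖coeff β f‖ₑ * wmon _ β)
  rw [coeff_pderiv, wmon_const, wmon_const, enorm_mul, mul_assoc, mul_assoc]
  refine mul_le_mul_right ?_ _
  have h1 : (β j + 1 : ℂ) = ((β j + 1 : ℕ) : ℂ) := by push_cast; rfl
  have h2 : β j + 1 ≤ 2 ^ β.degree :=
    (Nat.succ_le_of_lt (Nat.lt_two_pow_self (n := β j))).trans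
      (Nat.pow_le_pow_right two_pos (Finsupp.le_degree j β))
  have h3 : (β + Finsupp.single j 1).degree = β.degree + 1 := by simp
  rw [h1, h3, ← ofReal_norm, Complex.norm_natCast, ← ENNReal.ofReal_pow (div_nonneg hr zero_le_two),
    ← ENNReal.ofReal_mul (pow_nonneg (div_nonneg hr zero_le_two) _),
    ← ENNReal.ofReal_mul (Nat.cast_nonneg _),
    ← ENNReal.ofReal_pow hr]
  refine ENNReal.ofReal_le_ofReal ?_
  have h4 : ((β j + 1 : ℕ) : ℝ) ≤ 2 ^ β.degree := by exact_mod_cast h2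
  calc ((β j + 1 : ℕ) : ℝ) * ((r / 2) ^ β.degree * r)
      ≤ 2 ^ β.degree * ((r / 2) ^ β.degree * r) := by gcongr
    _ = r ^ (β.degree + 1) := by
      rw [div_pow, pow_succ]
      field_simp

end Derivative

/-! ### The universal unipotent solution -/

section Solution
variable {σ : Type*} [Fintype σ] [DecidableEq σ]

/-- The formal solution of `A ∘ w = c` in unipotent maps `w`. There is a universal candidate for
`w`, depending polynomially on the Taylor coefficients of `c`, with a fixed loss `s` of derivatives;
it is convergent with uniform bounds whenever `c` is. -/
theorem exists_unipotent_solution {A : σ → MvPowerSeries σ ℂ} (hD : (jac A).det ≠ 0)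
    {r₀ : ℝ} (hr₀ : 0 < r₀)
    (hA : ∀ l, wnorm (fun _ => ENNReal.ofReal r₀) (A l) ≠ ⊤) :
    ∃ s : ℕ, ∀ (Y : Type) (F : ℕ → Subalgebra ℂ (Y → ℂ)) (_ : Monotone F)
      (c : Y → σ → MvPowerSeries σ ℂ) (_ : ∀ i, HasCoeffs F fun y => c y i),
      ∃ w : Y → σ → MvPowerSeries σ ℂ, (∀ y, IsUnip (w y)) ∧
        (∀ i, HasCoeffs (fun k => F (k + s)) fun y => w y i) ∧
        (∀ y w', IsUnip w' → (∀ i, subst w' (A i) = c y i) → w' = w y) ∧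
        ∀ Z : Set Y, (∀ k, ∀ f ∈ F k, ∃ b : ℝ, ∀ y ∈ Z, ‖f y‖ ≤ b) →
          (∀ i, UnifBdd (fun _ => 1) Z fun y => c y i) →
          ∀ i, UnifBdd (fun _ => 1) Z fun y => w y i := by
  classical
  set Δ := (jac A).det with hΔ
  set d := Δ.order.toNat with hd
  have hord : Δ ∈ ordIdeal σ d := by
    rw [mem_ordIdeal_iff_le_order, hd, ne_zero_iff_order_finite.1 hD]
  set D := homogeneousComponent d Δ with hDdef
  have hDhom : ∀ β : σ →₀ ℕ, β.degree ≠ d → coeff β D = 0 := fun β hβ => by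
    rw [hDdef, coeff_homogeneousComponent, if_neg hβ]
  have hD0 : D ≠ 0 := by
    obtain ⟨β, hβ, hβd⟩ := exists_coeff_ne_zero_and_order (ne_zero_iff_order_finite.1 hD)
    intro h
    apply hβ
    have h1 : β.degree = d := by
      rw [← ne_zero_iff_order_finite.1 hD] at hβd
      exact_mod_cast hβd
    have h2 := congrArg (coeff β) h
    rwa [hDdef, coeff_homogeneousComponent, if_pos h1, map_zero] at h2
  have hDΔ : D - Δ ∈ ordIdeal σ (d + 1) := by
    intro β hβ
    rw [map_sub, hDdef, coeff_homogeneousComponent]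
    split_ifs with h
    · rw [sub_self]
    · rw [hord β (by omega), sub_zero]
  obtain ⟨ω, b, τ, hω, hb, hτ, hT⟩ := exists_division hDhom hD0
  choose H hH hHn using fun l => exists_taylor (A l)
  have hω0 : ∀ i, ω i ≠ 0 := fun i => (hω i).1
  have hωt : ∀ i, ω i ≠ ⊤ := fun i => (hω i).2
  -- `A` determines unipotent maps with the loss of `d` orders, so solving the equation up to order
  -- `2 * d + 2` leaves a correction of order `d + 2`, as the contraction requires
  refine ⟨2 * d + 2 + d, fun Y F hF c hc => ?_⟩
  obtain ⟨γ, hγ, hγS, hγdeg, hγapx⟩ := exists_approx hD (2 * d + 2) (F (2 * d + 2)) (c := c)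
    fun i β hβ => hF hβ (hc i β)
  have hγ1 : ∀ y i, γ y i ∈ ordIdeal σ 1 := fun y => (hγ y).ord
  have hDγ : ∀ y, D - subst (γ y) Δ ∈ ordIdeal σ (d + 1) := fun y => by
    have := Ideal.sub_mem _ hDΔ ((hγ y).subst_sub_mem hord)
    convert this using 1
    ring
  let v : Y → σ → MvPowerSeries σ ℂ := fun y => fixPt (fixOp d (d + 2) τ A H D (γ y) (c y))
  have hctr : ∀ y j v v', (∀ i, v i ∈ ordIdeal σ (d + 2)) → (∀ i, v' i ∈ ordIdeal σ (d + 2)) →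
      (∀ i, v i - v' i ∈ ordIdeal σ j) → ∀ i, fixOp d (d + 2) τ A H D (γ y) (c y) v i -
        fixOp d (d + 2) τ A H D (γ y) (c y) v' i ∈ ordIdeal σ (j + 1) :=
    fun y j v v' hv hv' hvv => fixOp_sub_mem (by omega) (hγ1 y) (hDγ y) hv hv' hvv
  have hv : ∀ y i, v y i ∈ ordIdeal σ (d + 2) := by
    intro y i
    have h1 := fixPt_sub_iterate_mem (f := fixOp d (d + 2) τ A H D (γ y) (c y))
      (fun v i => fixOp_mem _ _ _ _ _) (hctr y) (d + 2) i
    rw [Function.iterate_succ_apply'] at h1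
    have h2 := Ideal.add_mem _ h1 (highPart_mem (d + 2) (degOp d τ (resid A H D (γ y) (c y)
      ((fixOp d (d + 2) τ A H D (γ y) (c y))^[d + 1] 0) i)))
    rwa [fixOp, sub_add_cancel] at h2
  refine ⟨fun y i => γ y i + v y i, fun y => ?_, fun i => ?_, fun y w' hw' hwc => ?_,
    fun Z hZ hcZ i => ?_⟩
  · exact (hγ y).congr (k := d + 2) (by omega) fun i => by simpa using hv y i
  · refine HasCoeffs.add ((hγS i).mono fun k => hF (by omega)) ?_
    exact hasCoeffs_fixPt hF (by omega) hγS hγ1 hDγ hc i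
  · have h1 : ∀ i, w' i - γ y i ∈ ordIdeal σ (d + 2) := fun i => by
      have := hγapx y w' hw' (fun i => by rw [hwc i, sub_self]; exact Ideal.zero_mem _) i
      rw [← hΔ, ← hd] at this
      exact ordIdeal_mono (by omega) this
    have h2 : (fun i => w' i - γ y i) = v y :=
      eq_fixPt (f := fixOp d (d + 2) τ A H D (γ y) (c y))
        (fun v i => fixOp_mem _ _ _ _ _) (hctr y) h1
        (fixOp_eq_self (by omega) hτ hH (hγ1 y) h1 (by simpa using hwc))
    funext i
    change w' i = γ y i + v y i
    rw [← congrFun h2 i]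
    ring
  · have hγb : ∀ i, UnifBdd ω Z fun y => γ y i := fun i =>
      UnifBdd.of_coeff (k := 2 * d + 3) hωt (fun y β hβ => hγdeg y i β (by omega))
        fun β => hZ _ _ (hγS i β)
    have hcb : ∀ i, UnifBdd ω Z fun y => c y i := fun i =>
      (hcZ i).congr_weights (by simp) hωt
    have hconst : ∀ {f : MvPowerSeries σ ℂ} {r : ℝ}, 0 < r →
        wnorm (fun _ => ENNReal.ofReal r) f ≠ ⊤ → UnifBdd ω Z fun _ : Y => f := by
      intro f r hr hf
      have h1 : UnifBdd (fun _ => 1) Z fun _ : Y => f :=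
        UnifBdd.const hr (by
          have h2 : scaled (fun _ : σ => 1) r = fun _ => ENNReal.ofReal r := by
            ext; simp [scaled]
          rwa [h2])
      exact h1.congr_weights (by simp) hωt
    -- the Taylor remainder of `A` converges on a polydisc proportional to `(ω, ω)`
    obtain ⟨ρ, hρ, hρω⟩ : ∃ ρ : ℝ, 0 < ρ ∧
        ∀ i, ENNReal.ofReal ρ * ω i ≤ ENNReal.ofReal (r₀ / 2) := by
      have h1 : ∀ i, ENNReal.ofReal (r₀ / 2) / ω i ≠ 0 := fun i =>
        ENNReal.div_ne_zero.2 ⟨by simpa using hr₀, hωt i⟩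
      obtain ⟨ρ, h2, h3⟩ := ((eventually_all.2 fun i => exists_pos_ofReal_le (h1 i)).and
        self_mem_nhdsWithin).exists
      exact ⟨ρ, h3, fun i => (ENNReal.le_div_iff_mul_le (Or.inl (hω0 i)) (Or.inl (hωt i))).1 (h2 i)⟩
    have hHfin : ∀ l j k,
        wnorm (fun q => ENNReal.ofReal ρ * Sum.elim ω ω q) (H l j k) ≠ ⊤ := by
      intro l j k htop
      have h1 := hHn l (fun q => ENNReal.ofReal ρ * Sum.elim ω ω q) j k
      have h0 : ∀ i, ENNReal.ofReal ρ * ω i ≠ 0 := fun i => mul_ne_zero (by simpa using hρ) (hω0 i)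
      simp only [Sum.elim_inl, Sum.elim_inr] at h1
      rw [htop, ENNReal.top_mul (h0 k), ENNReal.top_mul (h0 j), top_le_iff] at h1
      refine hA l (top_le_iff.1 (h1 ▸ wnorm_mono (fun i => ?_) _))
      refine (add_le_add (hρω i) (hρω i)).trans (le_of_eq ?_)
      rw [← ENNReal.ofReal_add (by positivity) (by positivity), add_halves]
    have hAb : ∀ l, UnifBdd ω Z fun _ : Y => A l := fun l => hconst hr₀ (hA l)
    have hjac : ∀ l j, UnifBdd ω Z fun _ : Y => jac A l j := by
      intro l j
      refine hconst (half_pos hr₀) fun htop => ?_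
      have h1 := wnorm_pderiv_le hr₀.le j (A l)
      rw [jac] at htop
      rw [htop, ENNReal.top_mul (by simpa using hr₀), top_le_iff] at h1
      exact hA l h1
    have hjacγ : ∀ l j, UnifBdd ω Z fun y => (jac A).map (subst (γ y)) l j := fun l j =>
      (hjac l j).subst hω0 hγb hγ1
    have hadj : ∀ i l, UnifBdd ω Z fun y => adjAt A (γ y) i l := fun i l =>
      unifBdd_adjugate hjacγ i l
    refine UnifBdd.congr_weights (ω := ω) ((hγb i).add ?_) hω0 (by simp)
    refine unifBdd_fixPt hω hb hT hρ hHfin hγb hγ1 hDγ hadj (fun i => ?_) ?_ i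
    · exact UnifBdd.sum _ fun l _ => (hadj i l).mul ((hcb l).sub ((hAb l).subst hω0 hγb hγ1))
    · refine UnifBdd.sub (UnifBdd.of_coeff (k := d) hωt (fun y β hβ => hDhom β (by omega))
        fun β => ⟨‖coeff β D‖, fun _ _ => le_rfl⟩) ?_
      exact (unifBdd_det hjac).subst hω0 hγb hγ1

end Solution

/-! ### Taylor expansions of finite order -/

section Expansion
variable {n : ℕ}

theorem norm_prod_pow_le (z : Fin n → ℂ) (β : Fin n →₀ ℕ) :
    ‖β.prod fun i e => z i ^ e‖ ≤ ‖z‖ ^ β.degree := by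
  rw [Finsupp.prod_fintype _ _ (by simp), norm_prod, Finsupp.degree_eq_sum,
    ← Finset.prod_pow_eq_pow_sum]
  refine Finset.prod_le_prod (fun _ _ => norm_nonneg _) fun i _ => ?_
  rw [norm_pow]
  exact pow_le_pow_left₀ (norm_nonneg _) (norm_le_pi_norm z i) _

theorem isBigO_norm_pow {N M : ℕ} (h : N ≤ M) :
    (fun z : Fin n → ℂ => ‖z‖ ^ M) =O[𝓝 0] fun z => ‖z‖ ^ N := by
  refine Asymptotics.IsBigO.of_bound 1 ?_
  filter_upwards [Metric.ball_mem_nhds (0 : Fin n → ℂ) one_pos] with z hz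
  rw [mem_ball_zero_iff ] at hz
  rw [one_mul, norm_pow, norm_pow, norm_norm]
  exact pow_le_pow_of_le_one (norm_nonneg _) hz.le h

theorem isBigO_eval {N : ℕ} {q : MvPolynomial (Fin n) ℂ}
    (hq : (q : MvPowerSeries (Fin n) ℂ) ∈ ordIdeal (Fin n) N) :
    (fun z => MvPolynomial.eval z q) =O[𝓝 0] fun z => ‖z‖ ^ N := by
  simp only [MvPolynomial.eval_eq']
  refine Asymptotics.IsBigO.fun_sum fun β hβ => ?_
  have h1 : N ≤ β.degree := by
    by_contra h
    have := hq β (not_le.1 h)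
    rw [MvPolynomial.coeff_coe] at this
    exact (MvPolynomial.mem_support_iff.1 hβ) this
  refine Asymptotics.IsBigO.const_mul_left ?_ _
  refine Asymptotics.IsBigO.trans (Asymptotics.IsBigO.of_bound 1 (Eventually.of_forall fun z => ?_))
    (isBigO_norm_pow h1)
  have := norm_prod_pow_le z β
  rw [Finsupp.prod_fintype _ _ (by simp)] at this
  simpa using this

/-- A homogeneous polynomial that vanishes to higher order than its degree is zero. -/
theorem eq_zero_of_isBigO {k : ℕ} {q : MvPolynomial (Fin n) ℂ} (hq : q.IsHomogeneous k)
    (h : (fun z => MvPolynomial.eval z q) =O[𝓝 0] fun z => ‖z‖ ^ (k + 1)) : q = 0 := by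
  refine MvPolynomial.funext fun z => ?_
  rw [map_zero]
  have h1 : Tendsto (fun t : ℂ => t • z) (𝓝[≠] 0) (𝓝 0) := by
    have : Tendsto (fun t : ℂ => t • z) (𝓝 0) (𝓝 ((0 : ℂ) • z)) :=
      (continuous_id.smul continuous_const).tendsto 0
    rw [zero_smul] at this
    exact this.mono_left nhdsWithin_le_nhds
  obtain ⟨C, hC⟩ := (h.comp_tendsto h1).bound
  have h2 : Tendsto (fun t : ℂ => C * ‖z‖ ^ (k + 1) * ‖t‖) (𝓝[≠] 0) (𝓝 0) := by
    have : Tendsto (fun t : ℂ => C * ‖z‖ ^ (k + 1) * ‖t‖) (𝓝 0)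
        (𝓝 (C * ‖z‖ ^ (k + 1) * ‖(0 : ℂ)‖)) :=
      (continuous_const.mul continuous_norm).tendsto 0
    rw [norm_zero, mul_zero] at this
    exact this.mono_left nhdsWithin_le_nhds
  refine norm_le_zero_iff.1 (ge_of_tendsto h2 ?_)
  filter_upwards [hC, self_mem_nhdsWithin] with t ht ht0
  have h3 : MvPolynomial.eval (t • z) q = t ^ k * MvPolynomial.eval z q := by
    rw [MvPolynomial.eval_eq', MvPolynomial.eval_eq', Finset.mul_sum]
    refine Finset.sum_congr rfl fun β hβ => ?_
    have h4 : β.degree = k := by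
      have := hq (MvPolynomial.mem_support_iff.1 hβ)
      rw [Finsupp.degree_eq_weight_one]
      exact this
    have h5 : ∑ i, β i = k := by rw [← h4, Finsupp.degree_eq_sum]
    simp only [Pi.smul_apply, smul_eq_mul, mul_pow, Finset.prod_mul_distrib,
      Finset.prod_pow_eq_pow_sum, h5]
    ring
  simp only [Function.comp_apply, h3, norm_mul, norm_pow, norm_smul, norm_norm] at ht
  have ht' : 0 < ‖t‖ ^ k := pow_pos (norm_pos_iff.2 ht0) k
  refine le_of_mul_le_mul_left (ht.trans (le_of_eq ?_)) ht'
  ring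

theorem mem_ordIdeal_of_isBigO {N : ℕ} {q : MvPolynomial (Fin n) ℂ}
    (h : (fun z => MvPolynomial.eval z q) =O[𝓝 0] fun z => ‖z‖ ^ N) :
    (q : MvPowerSeries (Fin n) ℂ) ∈ ordIdeal (Fin n) N := by
  suffices hs : ∀ k ≤ N, (q : MvPowerSeries (Fin n) ℂ) ∈ ordIdeal (Fin n) k from hs N le_rfl
  intro k
  induction k with
  | zero => exact fun _ => mem_ordIdeal_zero _
  | succ k ih =>
    intro hk
    have h1 : ((q - MvPolynomial.homogeneousComponent k q : MvPolynomial (Fin n) ℂ) :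
        MvPowerSeries (Fin n) ℂ) ∈ ordIdeal (Fin n) (k + 1) := by
      intro β hβ
      rw [MvPolynomial.coeff_coe, MvPolynomial.coeff_sub, MvPolynomial.coeff_homogeneousComponent]
      split_ifs with h2
      · exact sub_self _
      · have := ih (by omega) β (by omega)
        rw [MvPolynomial.coeff_coe] at this
        rw [this, sub_zero]
    have h2 := (h.trans (isBigO_norm_pow hk)).sub (isBigO_eval h1)
    simp only [map_sub, sub_sub_cancel] at h2
    rw [eq_zero_of_isBigO (MvPolynomial.homogeneousComponent_isHomogeneous k q) h2, sub_zero] at h1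
    exact h1

/-- The formal power series `F` is the Taylor expansion of `f` at `0` up to an error of order
`N`. -/
def HasExpansion (N : ℕ) (f : (Fin n → ℂ) → ℂ) (F : MvPowerSeries (Fin n) ℂ) : Prop :=
  ∃ p : MvPolynomial (Fin n) ℂ, (p : MvPowerSeries (Fin n) ℂ) - F ∈ ordIdeal (Fin n) N ∧
    (fun z => f z - MvPolynomial.eval z p) =O[𝓝 0] fun z => ‖z‖ ^ N

variable {N : ℕ} {f g : (Fin n → ℂ) → ℂ} {F G : MvPowerSeries (Fin n) ℂ}

theorem HasExpansion.unique (hF : HasExpansion N f F) (hG : HasExpansion N f G) :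
    F - G ∈ ordIdeal (Fin n) N := by
  obtain ⟨p, hp, hfp⟩ := hF
  obtain ⟨q, hq, hfq⟩ := hG
  have h1 := hfq.sub hfp
  simp only [sub_sub_sub_cancel_left, ← map_sub] at h1
  have h2 := Ideal.add_mem _ (Ideal.sub_mem _ hq hp) (mem_ordIdeal_of_isBigO h1)
  convert h2 using 1
  rw [← MvPolynomial.coeToMvPowerSeries.ringHom_apply (p - q), map_sub]
  simp only [MvPolynomial.coeToMvPowerSeries.ringHom_apply]
  ring

theorem HasExpansion.congr (hF : HasExpansion N f F) (h : f =ᶠ[𝓝 0] g) : HasExpansion N g F := by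
  obtain ⟨p, hp, hfp⟩ := hF
  exact ⟨p, hp, hfp.congr' (h.sub (EventuallyEq.refl _ _)) (EventuallyEq.refl _ _)⟩

theorem HasExpansion.of_polynomial (N : ℕ) (p : MvPolynomial (Fin n) ℂ) :
    HasExpansion N (fun z => MvPolynomial.eval z p) p :=
  ⟨p, by simp, by simpa using Asymptotics.isBigO_zero _ _⟩

theorem HasExpansion.const (N : ℕ) (a : ℂ) :
    HasExpansion N (fun _ : Fin n → ℂ => a) (MvPowerSeries.C a) := by
  simpa using HasExpansion.of_polynomial (n := n) N (MvPolynomial.C a)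

theorem HasExpansion.add (hF : HasExpansion N f F) (hG : HasExpansion N g G) :
    HasExpansion N (fun z => f z + g z) (F + G) := by
  obtain ⟨p, hp, hfp⟩ := hF
  obtain ⟨q, hq, hgq⟩ := hG
  refine ⟨p + q, ?_, ?_⟩
  · rw [MvPolynomial.coe_add, add_sub_add_comm]
    exact Ideal.add_mem _ hp hq
  · simpa only [map_add, add_sub_add_comm] using hfp.add hgq

theorem isBigO_one_of_continuousAt {f : (Fin n → ℂ) → ℂ} (h : ContinuousAt f 0) :
    f =O[𝓝 0] fun _ => (1 : ℝ) := h.tendsto.isBigO_one ℝ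

theorem HasExpansion.isBigO_one (hF : HasExpansion N f F) : f =O[𝓝 0] fun _ => (1 : ℝ) := by
  obtain ⟨p, -, hfp⟩ := hF
  have h1 := (hfp.trans (isBigO_norm_pow (Nat.zero_le N))).add
    (by simpa only [pow_zero] using
      isBigO_one_of_continuousAt (MvPolynomial.continuous_eval p).continuousAt)
  simpa only [pow_zero, sub_add_cancel] using h1

theorem HasExpansion.mul (hF : HasExpansion N f F) (hG : HasExpansion N g G) :
    HasExpansion N (fun z => f z * g z) (F * G) := by
  have hg1 := hG.isBigO_one
  obtain ⟨p, hp, hfp⟩ := hF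
  obtain ⟨q, hq, hgq⟩ := hG
  refine ⟨p * q, ?_, ?_⟩
  · have h1 := Ideal.add_mem _ (Ideal.mul_mem_right (q : MvPowerSeries (Fin n) ℂ) _ hp)
      (Ideal.mul_mem_left _ F hq)
    rw [MvPolynomial.coe_mul]
    convert h1 using 1
    ring
  · have h2 := hfp.mul hg1
    have h3 := (isBigO_one_of_continuousAt (MvPolynomial.continuous_eval p).continuousAt).mul hgq
    simp only [mul_one, one_mul] at h2 h3
    have h1 := h2.add h3
    refine h1.congr_left fun z => ?_
    rw [map_mul]
    ring

theorem HasExpansion.sum {ι : Type*} (s : Finset ι) {f : ι → (Fin n → ℂ) → ℂ}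
    {F : ι → MvPowerSeries (Fin n) ℂ} (h : ∀ i ∈ s, HasExpansion N (f i) (F i)) :
    HasExpansion N (fun z => ∑ i ∈ s, f i z) (∑ i ∈ s, F i) := by
  classical
  induction s using Finset.induction_on with
  | empty => simpa using HasExpansion.const N 0
  | insert i s hi ih =>
    simp only [Finset.sum_insert hi]
    exact (h i (by simp)).add (ih fun j hj => h j (by simp [hj]))

theorem HasExpansion.prod {ι : Type*} (s : Finset ι) {f : ι → (Fin n → ℂ) → ℂ}
    {F : ι → MvPowerSeries (Fin n) ℂ} (h : ∀ i ∈ s, HasExpansion N (f i) (F i)) :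
    HasExpansion N (fun z => ∏ i ∈ s, f i z) (∏ i ∈ s, F i) := by
  classical
  induction s using Finset.induction_on with
  | empty => simpa using HasExpansion.const N 1
  | insert i s hi ih =>
    simp only [Finset.prod_insert hi]
    exact (h i (by simp)).mul (ih fun j hj => h j (by simp [hj]))

theorem HasExpansion.det {B : (Fin n → ℂ) → Matrix (Fin n) (Fin n) ℂ}
    {M : Matrix (Fin n) (Fin n) (MvPowerSeries (Fin n) ℂ)}
    (h : ∀ i j, HasExpansion N (fun z => B z i j) (M i j)) :
    HasExpansion N (fun z => (B z).det) M.det := by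
  simp only [Matrix.det_apply']
  refine HasExpansion.sum _ fun p _ => HasExpansion.mul ?_ (HasExpansion.prod _ fun i _ => h _ _)
  simpa using HasExpansion.const (n := n) N ((Equiv.Perm.sign p : ℤ) : ℂ)

theorem HasExpansion.isBigO {k : ℕ} (hk : k ≤ N) (hF : HasExpansion N f F)
    (hFk : F ∈ ordIdeal (Fin n) k) : f =O[𝓝 0] fun z => ‖z‖ ^ k := by
  obtain ⟨p, hp, hfp⟩ := hF
  have h1 : (p : MvPowerSeries (Fin n) ℂ) ∈ ordIdeal (Fin n) k := by
    simpa using Ideal.add_mem _ (ordIdeal_mono hk hp) hFk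
  simpa using (hfp.trans (isBigO_norm_pow hk)).add (isBigO_eval h1)

/-- Expansions are compatible with composition. -/
theorem HasExpansion.comp (hN : 1 ≤ N) (hF : HasExpansion N f F)
    {u : (Fin n → ℂ) → Fin n → ℂ} {U : Fin n → MvPowerSeries (Fin n) ℂ}
    (hu : ∀ i, HasExpansion N (fun z => u z i) (U i)) (hU : ∀ i, U i ∈ ordIdeal (Fin n) 1) :
    HasExpansion N (fun z => f (u z)) (subst U F) := by
  obtain ⟨p, hp, hfp⟩ := hF
  have h1 : u =O[𝓝 0] fun z => ‖z‖ := by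
    refine Asymptotics.isBigO_pi.2 fun i => ?_
    simpa using (hu i).isBigO hN (hU i)
  have h2 : Tendsto u (𝓝 0) (𝓝 0) := h1.trans_tendsto (by
    simpa using (continuous_norm (E := Fin n → ℂ)).tendsto 0)
  have h3 : (fun z => f (u z) - MvPolynomial.eval (u z) p) =O[𝓝 0] fun z => ‖z‖ ^ N :=
    (hfp.comp_tendsto h2).trans (h1.norm_left.pow N)
  have hs := hasSubst_of_mem hU
  have h4 : ∀ q : MvPolynomial (Fin n) ℂ, HasExpansion N (fun z => MvPolynomial.eval (u z) q)
      (subst U (q : MvPowerSeries (Fin n) ℂ)) := by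
    intro q
    induction q using MvPolynomial.induction_on with
    | C a => simpa [subst_C_of_mem hU] using HasExpansion.const (n := n) N a
    | add p q hp hq =>
      simp only [map_add, MvPolynomial.coe_add, subst_add hs]
      exact hp.add hq
    | mul_X p i hp =>
      simp only [map_mul, MvPolynomial.coe_mul, subst_mul hs, MvPolynomial.eval_X,
        MvPolynomial.coe_X, subst_X hs]
      exact hp.mul (hu i)
  obtain ⟨q, hq, hpq⟩ := h4 p
  refine ⟨q, ?_, by simpa using h3.add hpq⟩
  have h5 := Ideal.add_mem _ hq (subst_mem_ordIdeal hU hp)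
  rw [subst_sub hs] at h5
  simpa using h5

/-- The Cauchy estimate, applied in complex lines through the points `z` on discs of radius
`‖z‖`. -/
theorem isBigO_fderiv (hf : AnalyticAt ℂ f 0) (h : f =O[𝓝 0] fun z => ‖z‖ ^ (N + 1)) (j : Fin n) :
    (fun z => fderiv ℂ f z (Pi.single j 1)) =O[𝓝 0] fun z => ‖z‖ ^ N := by
  obtain ⟨C, hC0, hC⟩ := h.exists_nonneg
  rw [Asymptotics.isBigOWith_iff] at hC
  obtain ⟨δ, hδ, hball⟩ := Metric.eventually_nhds_iff_ball.1 (hC.and hf.eventually_analyticAt)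
  have hj : ‖(Pi.single j 1 : Fin n → ℂ)‖ = 1 := by rw [Pi.norm_single, norm_one]
  have h1 : ∀ z ∈ Metric.ball (0 : Fin n → ℂ) (δ / 2), z ≠ 0 →
      ‖fderiv ℂ f z (Pi.single j 1)‖ ≤ C * 2 ^ (N + 1) * ‖z‖ ^ N := by
    intro z hz hz0
    rw [mem_ball_zero_iff] at hz
    have hzp : 0 < ‖z‖ := norm_pos_iff.2 hz0
    let c : ℂ → Fin n → ℂ := fun t => z + t • Pi.single j 1
    have hc : ∀ t : ℂ, ‖t‖ ≤ ‖z‖ → ‖c t‖ ≤ 2 * ‖z‖ := fun t ht => by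
      refine (norm_add_le _ _).trans ?_
      rw [norm_smul, hj, mul_one]
      linarith
    have hcb : ∀ t : ℂ, ‖t‖ ≤ ‖z‖ → c t ∈ Metric.ball (0 : Fin n → ℂ) δ := fun t ht => by
      rw [mem_ball_zero_iff]
      linarith [hc t ht]
    have hcd : ∀ t, HasDerivAt c (Pi.single j 1) t := fun t => by
      simpa [c] using ((hasDerivAt_id t).smul_const (Pi.single j (1 : ℂ))).const_add z
    have hgd : ∀ t : ℂ, ‖t‖ ≤ ‖z‖ →
        HasDerivAt (fun t => f (c t)) (fderiv ℂ f (c t) (Pi.single j 1)) t := fun t ht =>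
      ((hball _ (hcb t ht)).2.differentiableAt.hasFDerivAt).comp_hasDerivAt t (hcd t)
    have h2 : DiffContOnCl ℂ (fun t => f (c t)) (Metric.ball 0 ‖z‖) := by
      refine DifferentiableOn.diffContOnCl fun t ht => ?_
      rw [closure_ball _ hzp.ne', mem_closedBall_zero_iff] at ht
      exact (hgd t ht).differentiableAt.differentiableWithinAt
    have h3 := Complex.norm_deriv_le_of_forall_mem_sphere_norm_le hzp h2
      (C := C * (2 * ‖z‖) ^ (N + 1)) fun t ht => by
        rw [mem_sphere_zero_iff_norm] at ht
        have h4 := (hball _ (hcb t ht.le)).1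
        rw [norm_pow, norm_norm] at h4
        exact h4.trans (by gcongr; exact hc t ht.le)
    rw [(hgd 0 (by simp)).deriv] at h3
    simp only [c, zero_smul, add_zero] at h3
    refine h3.trans (le_of_eq ?_)
    rw [mul_pow, pow_succ ‖z‖]
    field_simp
  have h2 : ContinuousAt (fun z => fderiv ℂ f z (Pi.single j 1)) 0 :=
    hf.fderiv.continuousAt.clm_apply continuousAt_const
  have h3 : ∀ᶠ z in 𝓝[≠] (0 : Fin n → ℂ),
      ‖fderiv ℂ f z (Pi.single j 1)‖ ≤ C * 2 ^ (N + 1) * ‖z‖ ^ N := by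
    filter_upwards [nhdsWithin_le_nhds (Metric.ball_mem_nhds (0 : Fin n → ℂ) (half_pos hδ)),
      self_mem_nhdsWithin] with z hz hz0 using h1 z hz hz0
  refine Asymptotics.IsBigO.of_bound (C * 2 ^ (N + 1)) ?_
  filter_upwards [Metric.ball_mem_nhds (0 : Fin n → ℂ) (half_pos hδ)] with z hz
  rw [norm_pow, norm_norm]
  rcases eq_or_ne z 0 with rfl | hz0
  · have : Nonempty (Fin n) := ⟨j⟩
    have h4 : ContinuousAt (fun z : Fin n → ℂ => C * 2 ^ (N + 1) * ‖z‖ ^ N) 0 :=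
      (continuous_const.mul (continuous_norm.pow N)).continuousAt
    exact le_of_tendsto_of_tendsto (h2.norm.tendsto.mono_left nhdsWithin_le_nhds)
      (h4.tendsto.mono_left nhdsWithin_le_nhds) h3
  · exact h1 z hz hz0

theorem analyticAt_eval (p : MvPolynomial (Fin n) ℂ) (z : Fin n → ℂ) :
    AnalyticAt ℂ (fun z : Fin n → ℂ => MvPolynomial.eval z p) z :=
  AnalyticOnNhd.eval_mvPolynomial p z (Set.mem_univ z)

theorem fderiv_eval (p : MvPolynomial (Fin n) ℂ) (z : Fin n → ℂ) (j : Fin n) :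
    fderiv ℂ (fun z : Fin n → ℂ => MvPolynomial.eval z p) z (Pi.single j 1) =
      MvPolynomial.eval z (MvPolynomial.pderiv j p) := by
  have hd : ∀ p : MvPolynomial (Fin n) ℂ, DifferentiableAt ℂ
    (fun z : Fin n → ℂ => MvPolynomial.eval z p) z :=
      fun p => (analyticAt_eval p z).differentiableAt
  induction p using MvPolynomial.induction_on with
  | C a => simp
  | add p q hp hq =>
    simp only [map_add]
    rw [fderiv_fun_add (hd p) (hd q), add_apply, hp, hq]
  | mul_X p i hp =>
    have hX : HasFDerivAt (fun z : Fin n → ℂ => z i)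
      (ContinuousLinearMap.proj i : (Fin n → ℂ) →L[ℂ] ℂ) z := hasFDerivAt_apply i z
    simp only [map_mul, MvPolynomial.eval_X]
    rw [fderiv_fun_mul (hd p) hX.differentiableAt, hX.fderiv]
    by_cases h : i = j <;> simp [hp, h]

/-- Expansions of holomorphic functions may be differentiated, with a loss of one order. -/
theorem HasExpansion.fderiv_apply (hf : AnalyticAt ℂ f 0) (hF : HasExpansion (N + 1) f F)
    (j : Fin n) :
    HasExpansion N (fun z => fderiv ℂ f z (Pi.single j 1)) (pderiv ℂ j F) := by
  obtain ⟨p, hp, hfp⟩ := hF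
  have hpan := analyticAt_eval p 0
  refine ⟨MvPolynomial.pderiv j p, ?_, ?_⟩
  · rw [← pderiv_coe, ← map_sub]
    exact pderiv_mem_ordIdeal j hp
  · refine (isBigO_fderiv (hf.sub hpan) hfp j).congr' ?_ (EventuallyEq.refl _ _)
    filter_upwards [hf.eventually_analyticAt] with z hz
    rw [fderiv_sub hz.differentiableAt (analyticAt_eval p z).differentiableAt,
      sub_apply, fderiv_eval]

end Expansion

/-! ### Taylor series of holomorphic maps -/

section Taylor
variable {n : ℕ}

/-- The exponent of the monomial `∏ m, X (r m)`. -/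
noncomputable def expo {k : ℕ} (r : Fin k → Fin n) : Fin n →₀ ℕ := ∑ m, Finsupp.single (r m) 1

theorem degree_expo {k : ℕ} (r : Fin k → Fin n) : (expo r).degree = k := by
  simp [expo, map_sum]

theorem prod_apply_eq {k : ℕ} (r : Fin k → Fin n) (z : Fin n → ℂ) :
    ∏ m, z (r m) = (expo r).prod fun i e => z i ^ e := by
  classical
  rw [expo, ← Finsupp.prod_finsetSum_index (by simp) (by simp [pow_add])]
  simp

/-- Sorting the directions of a word recovers the list of directions used to define partial
derivatives. -/
theorem sort_toMultiset_expo {k : ℕ} (r : Fin k → Fin n) :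
    (Finsupp.toMultiset (expo r)).sort (· ≤ ·) = List.ofFn (r ∘ Tuple.sort r) := by
  have h1 : Finsupp.toMultiset (expo r) = (List.ofFn r : Multiset (Fin n)) := by
    rw [expo, Finsupp.toMultiset_sum]
    simp only [Finsupp.toMultiset_single, one_smul]
    rw [← Fin.univ_val_map, ← Multiset.sum_map_singleton (Multiset.map r _), Multiset.map_map]
    rfl
  refine List.Perm.eq_of_pairwise' (r := (· ≤ ·)) (Multiset.pairwise_sort _ _)
    (Tuple.monotone_sort r).sortedLE_ofFn.pairwise ?_
  refine List.Perm.trans ?_ ((Tuple.sort r).ofFn_comp_perm r).symm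
  rw [← Multiset.coe_eq_coe, Multiset.sort_eq, h1]

theorem iteratedFDeriv_get_eq {f : (Fin n → ℂ) → Fin n → ℂ} {k : ℕ} {s : Fin k → Fin n}
    {l : List (Fin n)} (h : l = List.ofFn s) :
    (iteratedFDeriv ℂ l.length f 0 fun m => Pi.single (l.get m) 1) =
      iteratedFDeriv ℂ k f 0 fun m => Pi.single (s m) 1 := by
  obtain rfl : l.length = k := by rw [h, List.length_ofFn]
  have h1 : s = l.get := by
    have := List.ofFn_get l
    exact (List.ofFn_injective (this.trans h)).symm
  rw [h1]

/-- By symmetry of the higher derivatives, the order in which the directions are listed does not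
matter. -/
theorem iteratedFDeriv_eq_partialAtZero {f : (Fin n → ℂ) → Fin n → ℂ} (hf : AnalyticAt ℂ f 0)
    {k : ℕ} (r : Fin k → Fin n) :
    (iteratedFDeriv ℂ k f 0 fun m => Pi.single (r m) 1) = partialAtZero f (expo r) := by
  rw [partialAtZero, iteratedFDeriv_get_eq (sort_toMultiset_expo r)]
  exact (hf.contDiffAt.iteratedFDeriv_comp_perm (fun m => Pi.single (r m) 1) (Tuple.sort r)).symm

open scoped Classical in
/-- The ratio `1 / α!` between Taylor coefficients and derivatives, written as the proportion of
words with content `α` among all permutations. -/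
noncomputable def invFactorial (α : Fin n →₀ ℕ) : ℂ :=
  ((α.degree ! : ℕ) : ℂ)⁻¹ * ({r : Fin α.degree → Fin n | expo r = α} : Finset _).card

/-- The Taylor series at `0` of a component of a map. -/
noncomputable def taylor (f : (Fin n → ℂ) → Fin n → ℂ) (i : Fin n) : MvPowerSeries (Fin n) ℂ :=
  fun α => invFactorial α * partialAtZero f α i

theorem coeff_taylor (f : (Fin n → ℂ) → Fin n → ℂ) (i : Fin n) (α : Fin n →₀ ℕ) :
    coeff α (taylor f i) = invFactorial α * partialAtZero f α i := rfl

theorem homogeneousPart_apply {f : (Fin n → ℂ) → Fin n → ℂ} (hf : AnalyticAt ℂ f 0) (k : ℕ)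
    (z : Fin n → ℂ) (i : Fin n) :
    homogeneousPart f k z i =
      ∑ α ∈ homDegrees (Fin n) k, coeff α (taylor f i) * α.prod fun i e => z i ^ e := by
  classical
  have h1 : iteratedFDeriv ℂ k f 0 (fun _ => z) =
      ∑ r : Fin k → Fin n, (∏ m, z (r m)) • partialAtZero f (expo r) := by
    have h2 : z = ∑ j, z j • (Pi.single j 1 : Fin n → ℂ) := by
      funext i
      simp [Finset.sum_apply, Pi.single_apply]
    conv_lhs => rw [h2]
    rw [ContinuousMultilinearMap.map_sum]
    refine Finset.sum_congr rfl fun r _ => ?_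
    rw [ContinuousMultilinearMap.map_smul_univ, iteratedFDeriv_eq_partialAtZero hf]
  rw [homogeneousPart, h1, Pi.smul_apply, Finset.sum_apply, smul_eq_mul,
    ← Finset.sum_fiberwise_of_maps_to (g := expo) (t := homDegrees (Fin n) k)
      fun r _ => mem_homDegrees.2 (degree_expo r), Finset.mul_sum]
  refine Finset.sum_congr rfl fun α hα => ?_
  obtain rfl := mem_homDegrees.1 hα
  rw [Finset.sum_congr rfl (g := fun _ => (α.prod fun i e => z i ^ e) * partialAtZero f α i)]
  · rw [Finset.sum_const, nsmul_eq_mul, coeff_taylor, invFactorial]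
    ring
  · intro r hr
    rw [Finset.mem_filter] at hr
    rw [Pi.smul_apply, smul_eq_mul, prod_apply_eq, hr.2]

theorem hasExpansion_taylor {f : (Fin n → ℂ) → Fin n → ℂ} (hf : AnalyticAt ℂ f 0) (N : ℕ)
    (i : Fin n) : HasExpansion N (fun z => f z i) (taylor f i) := by
  classical
  let p : MvPolynomial (Fin n) ℂ := ∑ k ∈ Finset.range N, ∑ α ∈ homDegrees (Fin n) k,
    MvPolynomial.monomial α (coeff α (taylor f i))
  have hp : ∀ z, MvPolynomial.eval z p = ∑ k ∈ Finset.range N, homogeneousPart f k z i := by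
    intro z
    simp only [p, map_sum, MvPolynomial.eval_monomial, homogeneousPart_apply hf]
  refine ⟨p, fun β hβ => ?_, ?_⟩
  · rw [map_sub, MvPolynomial.coeff_coe, sub_eq_zero]
    simp only [p, MvPolynomial.coeff_sum, MvPolynomial.coeff_monomial]
    rw [Finset.sum_eq_single_of_mem β.degree (Finset.mem_range.2 hβ),
      Finset.sum_eq_single_of_mem β (mem_homDegrees.2 rfl), if_pos rfl]
    · intro γ _ hγ
      exact if_neg hγ
    · intro k _ hk
      refine Finset.sum_eq_zero fun γ hγ => if_neg ?_
      rintro rfl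
      exact hk (mem_homDegrees.1 hγ).symm
  · obtain ⟨q, r, hq⟩ := hf
    have h1 := (hq.hasFPowerSeriesAt.isBigO_sub_partialSum_pow N)
    refine (Asymptotics.isBigO_pi.1 h1 i).congr_left fun z => ?_
    rw [hp, zero_add, FormalMultilinearSeries.partialSum, Pi.sub_apply, Finset.sum_apply]
    congr 1
    refine Finset.sum_congr rfl fun k _ => ?_
    rw [homogeneousPart, ← hq.factorial_smul, ← Nat.cast_smul_eq_nsmul ℂ, smul_smul,
      inv_mul_cancel₀ (Nat.cast_ne_zero.2 (Nat.factorial_ne_zero k)), one_smul]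

theorem HasExpansion.constantCoeff_eq {N : ℕ} (hN : 1 ≤ N) {f : (Fin n → ℂ) → ℂ}
    {F : MvPowerSeries (Fin n) ℂ} (h : HasExpansion N f F) : coeff 0 F = f 0 := by
  obtain ⟨p, hp, hfp⟩ := h
  have h1 := hp 0 (by rw [map_zero]; omega)
  rw [map_sub, MvPolynomial.coeff_coe, sub_eq_zero] at h1
  have h2 : f 0 - MvPolynomial.eval 0 p = 0 := by
    refine Asymptotics.IsBigO.eq_zero_of_norm_pow (f := fun z => f z - MvPolynomial.eval z p)
      (n := N) (x₀ := (0 : Fin n → ℂ)) ?_ (by omega)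
    simpa using hfp
  rw [← h1, sub_eq_zero.1 h2]
  simp [MvPolynomial.constantCoeff_eq]

/-- A holomorphic function with zero Taylor expansion vanishes near `0`. -/
theorem eventually_eq_zero_of_isBigO {f : (Fin n → ℂ) → ℂ} (hf : AnalyticAt ℂ f 0)
    (h : ∀ N, f =O[𝓝 0] fun z => ‖z‖ ^ N) : ∀ᶠ z in 𝓝 0, f z = 0 := by
  obtain ⟨p, hp⟩ := hf
  have h1 : ∀ k z, p k (fun _ => z) = 0 := by
    intro k
    induction k using Nat.strong_induction_on with
    | _ k ih =>
      refine Asymptotics.IsBigO.continuousMultilinearMap_apply_eq_zero ?_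
      have h2 := (h (k + 1)).sub (hp.isBigO_sub_partialSum_pow (k + 1))
      refine h2.congr_left fun z => ?_
      rw [zero_add, sub_sub_cancel, FormalMultilinearSeries.partialSum, Finset.sum_range_succ,
        Finset.sum_eq_zero fun j hj => ih j (Finset.mem_range.1 hj) z, zero_add]
  filter_upwards [hp.eventually_hasSum] with z hz
  simp only [h1, zero_add] at hz
  exact hz.unique hasSum_zero

theorem jacobian_apply {f : (Fin n → ℂ) → Fin n → ℂ} {z : Fin n → ℂ}
    (hf : DifferentiableAt ℂ f z) (i j : Fin n) :
    jacobian f z i j = fderiv ℂ (fun z => f z i) z (Pi.single j 1) := by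
  rw [jacobian, LinearMap.toMatrix'_apply]
  have h1 := ((ContinuousLinearMap.proj i : (Fin n → ℂ) →L[ℂ] ℂ).hasFDerivAt.comp z
    hf.hasFDerivAt).fderiv
  exact (DFunLike.congr_fun h1 (Pi.single j 1)).symm

theorem analyticAt_apply {f : (Fin n → ℂ) → Fin n → ℂ} {z : Fin n → ℂ} (hf : AnalyticAt ℂ f z)
    (i : Fin n) : AnalyticAt ℂ (fun z => f z i) z :=
  analyticAt_pi_iff.1 hf i

theorem hasExpansion_jacobian {f : (Fin n → ℂ) → Fin n → ℂ} (hf : AnalyticAt ℂ f 0) (N : ℕ)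
    (i j : Fin n) : HasExpansion N (fun z => jacobian f z i j) (jac (taylor f) i j) := by
  refine ((hasExpansion_taylor hf (N + 1) i).fderiv_apply (analyticAt_apply hf i) j).congr ?_
  filter_upwards [hf.eventually_analyticAt] with z hz
  exact (jacobian_apply hz.differentiableAt i j).symm

theorem coeff_taylor_zero {f : (Fin n → ℂ) → Fin n → ℂ} (hf : AnalyticAt ℂ f 0) (i : Fin n) :
    coeff 0 (taylor f i) = f 0 i := (hasExpansion_taylor hf 1 i).constantCoeff_eq le_rfl

theorem coeff_taylor_single {f : (Fin n → ℂ) → Fin n → ℂ} (hf : AnalyticAt ℂ f 0) (i j : Fin n) :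
    coeff (Finsupp.single j 1) (taylor f i) = jacobian f 0 i j := by
  rw [← (hasExpansion_jacobian hf 1 i j).constantCoeff_eq le_rfl, jac, coeff_pderiv]
  simp

/-- A Jacobian determinant with zero Taylor series would vanish near `0`, so that the rank would be
less than `n` there. -/
theorem det_jac_taylor_ne_zero {f : (Fin n → ℂ) → Fin n → ℂ} (hf : AnalyticAt ℂ f 0)
    (hr : ∃ᶠ z in 𝓝 (0 : Fin n → ℂ), (jacobian f z).rank = n) : (jac (taylor f)).det ≠ 0 := by
  intro h0
  have h1 : AnalyticAt ℂ (fun z => (jacobian f z).det) 0 := by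
    have h2 : ∀ i j, AnalyticAt ℂ (fun z => jacobian f z i j) 0 := fun i j => by
      refine (((ContinuousLinearMap.apply ℂ ℂ (Pi.single j 1 : Fin n → ℂ)).analyticAt _).comp
        (analyticAt_apply hf i).fderiv).congr ?_
      filter_upwards [hf.eventually_analyticAt] with z hz
      exact (jacobian_apply hz.differentiableAt i j).symm
    simp only [Matrix.det_apply']
    exact Finset.analyticAt_fun_sum _ fun p _ => analyticAt_const.mul
      (Finset.analyticAt_fun_prod _ fun i _ => h2 _ _)
  have h2 : ∀ N, (fun z => (jacobian f z).det) =O[𝓝 0] fun z => ‖z‖ ^ N := fun N => by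
    refine (HasExpansion.det fun i j => hasExpansion_jacobian hf N i j).isBigO le_rfl ?_
    rw [h0]
    exact Ideal.zero_mem _
  obtain ⟨z, hz, hz0⟩ := (hr.and_eventually (eventually_eq_zero_of_isBigO h1 h2)).exists
  obtain ⟨v, hv, hv0⟩ := Matrix.exists_mulVec_eq_zero_iff.2 hz0
  have h3 := LinearMap.finrank_range_add_finrank_ker (jacobian f z).mulVecLin
  rw [← Matrix.rank, hz, Module.finrank_fin_fun, Nat.add_eq_left, Submodule.finrank_eq_zero] at h3
  exact hv ((Submodule.eq_bot_iff _).1 h3 v (by simpa using hv0))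

/-- An equation between holomorphic germs passes to their Taylor series. -/
theorem subst_taylor {f u g : (Fin n → ℂ) → Fin n → ℂ} (hf : AnalyticAt ℂ f 0)
    (hu : AnalyticAt ℂ u 0) (hu0 : u 0 = 0) (hg : AnalyticAt ℂ g 0)
    (h : ∀ᶠ z in 𝓝 (0 : Fin n → ℂ), f (u z) = g z) (i : Fin n) :
    subst (taylor u) (taylor f i) = taylor g i := by
  have hU : ∀ i, taylor u i ∈ ordIdeal (Fin n) 1 := fun i => by
    rw [mem_ordIdeal_one, ← coeff_zero_eq_constantCoeff_apply, coeff_taylor_zero hu, hu0]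
    rfl
  refine sub_eq_zero.1 (eq_zero_of_forall_mem_ordIdeal fun k => ?_)
  refine ordIdeal_mono (Nat.le_succ k) (HasExpansion.unique (N := k + 1) ?_
    (hasExpansion_taylor hg (k + 1) i))
  refine ((hasExpansion_taylor hf (k + 1) i).comp (by omega)
    (fun i => hasExpansion_taylor hu (k + 1) i) hU).congr ?_
  filter_upwards [h] with z hz
  rw [hz]

theorem isUnit_det_jacobian {u : (Fin n → ℂ) → Fin n → ℂ} (hu : IsBiholomorphismGerm u) :
    IsUnit (jacobian u 0).det := by
  obtain ⟨hu, hu0, v, hv, hv0, hvu, -⟩ := hu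
  have h1 : (fderiv ℂ v 0).comp (fderiv ℂ u 0) = ContinuousLinearMap.id ℂ (Fin n → ℂ) := by
    have h3 : HasFDerivAt v (fderiv ℂ v 0) (u 0) := by
      rw [hu0]
      exact hv.differentiableAt.hasFDerivAt
    have h2 := h3.comp 0 hu.differentiableAt.hasFDerivAt
    refine (h2.congr_of_eventuallyEq ?_).unique (hasFDerivAt_id _)
    filter_upwards [hvu] with z hz using hz.symm
  have h2 : jacobian v 0 * jacobian u 0 = 1 := by
    rw [jacobian, jacobian, ← LinearMap.toMatrix'_comp, ← LinearMap.toMatrix'_id]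
    exact congrArg (fun g : (Fin n → ℂ) →L[ℂ] (Fin n → ℂ) =>
      LinearMap.toMatrix' (g : (Fin n → ℂ) →ₗ[ℂ] (Fin n → ℂ))) h1
  refine IsUnit.of_mul_eq_one_right (jacobian v 0).det ?_
  rw [← Matrix.det_mul, h2, Matrix.det_one]

end Taylor

/-! ### Cauchy estimates -/

section Cauchy
variable {n : ℕ}

theorem sum_pow_mul_inv_pow {M : ℕ} {ζ : ℂ} (hζ : IsPrimitiveRoot ζ M) {a b : ℕ} (ha : a < M)
    (hb : b < M) : ∑ t : Fin M, (ζ ^ (t : ℕ)) ^ a * ((ζ ^ (t : ℕ)) ^ b)⁻¹ =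
      if a = b then (M : ℂ) else 0 := by
  have hζ0 : ζ ≠ 0 := hζ.ne_zero (by omega)
  have h1 : ∀ t : ℕ, (ζ ^ t) ^ a * ((ζ ^ t) ^ b)⁻¹ = (ζ ^ a * (ζ ^ b)⁻¹) ^ t := fun t => by
    rw [mul_pow, inv_pow, ← pow_mul, ← pow_mul, ← pow_mul, ← pow_mul, mul_comm a, mul_comm b]
  simp only [h1]
  rw [Fin.sum_univ_eq_sum_range fun t => (ζ ^ a * (ζ ^ b)⁻¹) ^ t]
  split_ifs with h
  · subst h
    simp [mul_inv_cancel₀ (pow_ne_zero a hζ0)]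
  · have h2 : ζ ^ a * (ζ ^ b)⁻¹ ≠ 1 := fun h2 => h (hζ.pow_inj ha hb (by
      rwa [mul_inv_eq_one₀ (pow_ne_zero b hζ0)] at h2))
    rw [geom_sum_eq h2, mul_pow, inv_pow, ← pow_mul, ← pow_mul, mul_comm a, mul_comm b, pow_mul,
      pow_mul, hζ.pow_eq_one]
    simp

/-- Cauchy's estimate for the coefficients of a homogeneous polynomial that is bounded on a torus,
by averaging over roots of unity. -/
theorem norm_coeff_mul_pow_le {a : (Fin n →₀ ℕ) → ℂ} {k : ℕ} {s B : ℝ}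
    (h : ∀ z : Fin n → ℂ, (∀ j, ‖z j‖ = |s|) →
      ‖∑ α ∈ homDegrees (Fin n) k, a α * α.prod fun i e => z i ^ e‖ ≤ B)
    {β : Fin n →₀ ℕ} (hβ : β.degree = k) : ‖a β‖ * |s| ^ k ≤ B := by
  classical
  set M := k + 1 with hM
  obtain ⟨ζ, hζ⟩ : ∃ ζ : ℂ, IsPrimitiveRoot ζ M := ⟨_, Complex.isPrimitiveRoot_exp M (by omega)⟩
  have hζ1 : ‖ζ‖ = 1 := hζ.norm'_eq_one (by omega)
  let z : (Fin n → Fin M) → Fin n → ℂ := fun x j => s * ζ ^ (x j : ℕ)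
  let e : (Fin n → Fin M) → ℂ := fun x => ∏ j, ((ζ ^ (x j : ℕ)) ^ β j)⁻¹
  have he : ∀ x, ‖e x‖ = 1 := fun x => by
    simp [e, norm_prod, hζ1]
  have hz : ∀ x j, ‖z x j‖ = |s| := fun x j => by
    simp [z, hζ1]
  have hle : ∀ α : Fin n →₀ ℕ, α.degree = k → ∀ j, α j < M := fun α hα j =>
    Nat.lt_succ_of_le (hα ▸ Finsupp.le_degree j α)
  have h1 : ∀ α : Fin n →₀ ℕ, α.degree = k →
      ∑ x, e x * α.prod (fun i m => z x i ^ m) = if α = β then (M : ℂ) ^ n * s ^ k else 0 := by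
    intro α hα
    have h2 : ∀ x, e x * α.prod (fun i m => z x i ^ m) =
        s ^ k * ∏ j, ((ζ ^ (x j : ℕ)) ^ α j * ((ζ ^ (x j : ℕ)) ^ β j)⁻¹) := fun x => by
      rw [Finsupp.prod_fintype _ _ (by simp)]
      simp only [z, e, mul_pow, Finset.prod_mul_distrib]
      rw [Finset.prod_pow_eq_pow_sum, ← Finsupp.degree_eq_sum, hα]
      ring
    simp only [h2]
    rw [← Finset.mul_sum, ← Fintype.piFinset_univ, ← Finset.prod_univ_sum
      (fun _ => Finset.univ) fun j (t : Fin M) => (ζ ^ (t : ℕ)) ^ α j * ((ζ ^ (t : ℕ)) ^ β j)⁻¹]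
    simp only [fun j => sum_pow_mul_inv_pow hζ (hle α hα j) (hle β hβ j)]
    split_ifs with hαβ
    · subst hαβ
      simp [mul_comm]
    · obtain ⟨j, hj⟩ : ∃ j, α j ≠ β j := by
        by_contra hj
        push Not at hj
        exact hαβ (Finsupp.ext hj)
      rw [Finset.prod_eq_zero (Finset.mem_univ j) (if_neg hj), mul_zero]
  have h3 : ∑ x, e x * ∑ α ∈ homDegrees (Fin n) k, a α * α.prod (fun i m => z x i ^ m) =
      a β * ((M : ℂ) ^ n * s ^ k) := by
    simp only [Finset.mul_sum, mul_left_comm (e _)]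
    rw [Finset.sum_comm, Finset.sum_eq_single_of_mem β (mem_homDegrees.2 hβ)]
    · rw [← Finset.mul_sum, h1 β hβ, if_pos rfl]
    · intro α hα hαβ
      rw [← Finset.mul_sum, h1 α (mem_homDegrees.1 hα), if_neg hαβ, mul_zero]
  have h4 : ‖a β * ((M : ℂ) ^ n * s ^ k)‖ ≤ (M : ℝ) ^ n * B := by
    rw [← h3]
    refine (norm_sum_le _ _).trans ((Finset.sum_le_sum (g := fun _ => B) fun x _ => ?_).trans
      (le_of_eq ?_))
    · rw [norm_mul, he, one_mul]
      exact h _ (hz x)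
    · simp
  rw [norm_mul, norm_mul, norm_pow, norm_pow, Complex.norm_natCast, Complex.norm_real,
    Real.norm_eq_abs, mul_left_comm] at h4
  exact le_of_mul_le_mul_left h4 (by positivity)

/-- The weighted norm of a series with geometrically bounded coefficients, by comparison with
`∑ 2 ^ (-|α|) = 2 ^ n`. -/
theorem wnorm_le_of_norm_coeff_le {f : MvPowerSeries (Fin n) ℂ} {B C : ℝ} (hB : 0 ≤ B) (hC : 0 < C)
    (h : ∀ α, ‖coeff α f‖ ≤ B * C ^ α.degree) :
    wnorm (fun _ => ENNReal.ofReal (1 / (2 * C))) f ≤ ENNReal.ofReal B * 2 ^ n := by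
  classical
  have h1 : ∀ α : Fin n →₀ ℕ, ‖coeff α f‖ₑ * wmon (fun _ => ENNReal.ofReal (1 / (2 * C))) α ≤
      ENNReal.ofReal B * ∏ j, (2⁻¹ : ℝ≥0∞) ^ α j := by
    intro α
    have h2 : (2⁻¹ : ℝ≥0∞) = ENNReal.ofReal (1 / 2) := by
      rw [one_div, ENNReal.ofReal_inv_of_pos two_pos]
      simp
    rw [wmon_const, Finset.prod_pow_eq_pow_sum, ← Finsupp.degree_eq_sum, h2, ← ofReal_norm,
      ← ENNReal.ofReal_pow (by positivity), ← ENNReal.ofReal_mul (norm_nonneg _),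
      ← ENNReal.ofReal_pow (by positivity), ← ENNReal.ofReal_mul hB]
    refine ENNReal.ofReal_le_ofReal ?_
    calc ‖coeff α f‖ * (1 / (2 * C)) ^ α.degree
        ≤ B * C ^ α.degree * (1 / (2 * C)) ^ α.degree := by gcongr; exact h α
      _ = B * (1 / 2) ^ α.degree := by
        rw [mul_assoc, ← mul_pow]
        congr 2
        field_simp
  refine (ENNReal.tsum_le_tsum h1).trans ?_
  rw [ENNReal.tsum_mul_left]
  refine mul_le_mul_right ?_ _
  rw [ENNReal.tsum_eq_iSup_sum]
  refine iSup_le fun S => ?_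
  obtain ⟨N, hN⟩ : ∃ N, ∀ α ∈ S, ∀ j, α j < N := by
    refine ⟨S.sup Finsupp.degree + 1, fun α hα j => Nat.lt_succ_of_le ?_⟩
    exact (Finsupp.le_degree j α).trans (Finset.le_sup (f := Finsupp.degree) hα)
  calc ∑ α ∈ S, ∏ j, (2⁻¹ : ℝ≥0∞) ^ α j
      = ∑ x ∈ S.image fun α : Fin n →₀ ℕ => (α : Fin n → ℕ), ∏ j, (2⁻¹ : ℝ≥0∞) ^ x j := by
        rw [Finset.sum_image fun α _ β _ hαβ => DFunLike.coe_injective hαβ]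
    _ ≤ ∑ x ∈ Fintype.piFinset fun _ : Fin n => Finset.range N, ∏ j, (2⁻¹ : ℝ≥0∞) ^ x j := by
        refine Finset.sum_le_sum_of_subset fun x hx => ?_
        obtain ⟨α, hα, rfl⟩ := Finset.mem_image.1 hx
        simpa using hN α hα
    _ = ∏ _j : Fin n, ∑ t ∈ Finset.range N, (2⁻¹ : ℝ≥0∞) ^ t :=
        (Finset.prod_univ_sum (fun _ => Finset.range N) fun _ t => (2⁻¹ : ℝ≥0∞) ^ t).symm
    _ ≤ ∏ _j : Fin n, 2 := by
        refine Finset.prod_le_prod' fun j _ => (ENNReal.sum_le_tsum _).trans (le_of_eq ?_)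
        rw [ENNReal.tsum_geometric, ENNReal.one_sub_inv_two, inv_inv]
    _ = 2 ^ n := by simp

theorem exists_wnorm_taylor_ne_top {f : (Fin n → ℂ) → Fin n → ℂ} (hf : AnalyticAt ℂ f 0) :
    ∃ r : ℝ, 0 < r ∧ ∀ i, wnorm (fun _ => ENNReal.ofReal r) (taylor f i) ≠ ⊤ := by
  obtain ⟨p, r, hp⟩ := hf
  obtain ⟨B, C, hB, hC, hbd⟩ := p.le_mul_pow_of_radius_pos (hp.r_pos.trans_le hp.r_le)
  refine ⟨1 / (2 * C), by positivity, fun i => ne_top_of_le_ne_top ?_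
    (wnorm_le_of_norm_coeff_le hB.le hC fun α => ?_)⟩
  · exact ENNReal.mul_ne_top ENNReal.ofReal_ne_top (ENNReal.pow_ne_top (by simp))
  · have h1 := norm_coeff_mul_pow_le (a := fun α => coeff α (taylor f i)) (k := α.degree) (s := 1)
      (B := B * C ^ α.degree) (fun z hz => ?_) rfl
    · simpa using h1
    · rw [← homogeneousPart_apply ⟨p, r, hp⟩]
      refine (norm_le_pi_norm _ i).trans ?_
      rw [homogeneousPart, ← hp.factorial_smul, ← Nat.cast_smul_eq_nsmul ℂ, smul_smul,
        inv_mul_cancel₀ (Nat.cast_ne_zero.2 (Nat.factorial_ne_zero _)), one_smul]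
      refine ((p α.degree).le_opNorm _).trans ?_
      refine (mul_le_of_le_one_right (norm_nonneg _) (Finset.prod_le_one
        (fun _ _ => norm_nonneg _) fun _ _ => ?_)).trans (hbd _)
      exact (pi_norm_le_iff_of_nonneg zero_le_one).2 fun j => by simp [hz j]

/-- The torus of radius `1 / 2` lies in the open unit polydisc, whence the constant `2 * C`. -/
theorem norm_coeff_taylor_le {f : (Fin n → ℂ) → Fin n → ℂ} (hf : AnalyticAt ℂ f 0) {C : ℝ}
    (hC : 0 ≤ C)
    (h : ∀ k, supNorm (polydisc fun _ => 1) (homogeneousPart f k) ≤ ENNReal.ofReal (C ^ k))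
    (i : Fin n) (α : Fin n →₀ ℕ) : ‖coeff α (taylor f i)‖ ≤ 1 * (2 * C) ^ α.degree := by
  have h1 := norm_coeff_mul_pow_le (a := fun α => coeff α (taylor f i)) (k := α.degree)
    (s := 1 / 2) (B := C ^ α.degree) (fun z hz => ?_) rfl
  · rw [one_mul, mul_pow, mul_comm, ← div_le_iff₀ (by positivity)]
    refine le_trans (le_of_eq ?_) h1
    rw [abs_of_pos (by norm_num), one_div, inv_pow, div_eq_mul_inv]
  · rw [← homogeneousPart_apply hf]
    have hz1 : z ∈ polydisc fun _ : Fin n => (1 : ℝ) := fun j => by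
      rw [hz, abs_of_pos (by norm_num)]
      norm_num
    have h2 : ‖homogeneousPart f α.degree z i‖ₑ ≤ ENNReal.ofReal (C ^ α.degree) :=
      (le_iSup₂ (f := fun z (_ : z ∈ polydisc fun _ : Fin n => (1 : ℝ)) =>
        ‖homogeneousPart f α.degree z i‖ₑ) z hz1).trans
        ((le_iSup (fun j => ⨆ z ∈ polydisc fun _ : Fin n => (1 : ℝ),
          ‖homogeneousPart f α.degree z j‖ₑ) i).trans (h α.degree))
    rw [← ofReal_norm] at h2
    exact (ENNReal.ofReal_le_ofReal_iff (by positivity)).1 h2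

end Cauchy

/-! ### Linear substitutions -/

section Linear
variable {σ : Type*} [Fintype σ]

/-- The linear map with matrix `B`, as a formal map. -/
noncomputable def linMap (B : Matrix σ σ ℂ) (i : σ) : MvPowerSeries σ ℂ := ∑ j, B i j • X j

theorem linMap_mem (B : Matrix σ σ ℂ) (i : σ) : linMap B i ∈ ordIdeal σ 1 :=
  Ideal.sum_mem _ fun j _ => smul_mem_ordIdeal _ (X_mem_ordIdeal_one j)

theorem coeff_linMap [DecidableEq σ] (B : Matrix σ σ ℂ) (i : σ) (β : σ →₀ ℕ) :
    coeff β (linMap B i) = ∑ j, B i j * if β = Finsupp.single j 1 then 1 else 0 := by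
  simp [linMap, coeff_X]

theorem linMap_one [DecidableEq σ] : linMap (1 : Matrix σ σ ℂ) = X := by
  funext i
  simp [linMap, Matrix.one_apply]

theorem subst_linMap_linMap (B B' : Matrix σ σ ℂ) (i : σ) :
    subst (linMap B) (linMap B' i) = linMap (B' * B) i := by
  have hs := hasSubst_of_mem (linMap_mem B)
  rw [linMap, ← coe_substAlgHom hs]
  simp only [map_sum, map_smul]
  simp only [coe_substAlgHom hs, subst_X hs]
  simp only [linMap, Finset.smul_sum, smul_smul, Matrix.mul_apply, Finset.sum_smul]
  exact Finset.sum_comm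

theorem subst_linMap_subst_linMap [DecidableEq σ] {B B' : Matrix σ σ ℂ} (h : B' * B = 1)
    (f : MvPowerSeries σ ℂ) : subst (linMap B) (subst (linMap B') f) = f := by
  rw [subst_comp_subst_apply (hasSubst_of_mem (linMap_mem B')) (hasSubst_of_mem (linMap_mem B))]
  simp only [subst_linMap_linMap, h, linMap_one]
  rw [subst_self]
  rfl

omit [Fintype σ] in
theorem exists_eq_single_of_degree_eq_one {β : σ →₀ ℕ} (h : β.degree = 1) :
    ∃ j, β = Finsupp.single j 1 := by
  classical
  obtain ⟨j, hj⟩ : ∃ j, β j ≠ 0 := by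
    by_contra! h0
    rw [show β = 0 from Finsupp.ext h0, map_zero] at h
    exact zero_ne_one h
  have h1 : Finsupp.single j 1 ≤ β := by
    rw [Finsupp.single_le_iff]
    omega
  have h2 := congrArg Finsupp.degree (add_tsub_cancel_of_le h1)
  rw [map_add, Finsupp.degree_single, h, Nat.add_eq_left, Finsupp.degree_eq_zero_iff] at h2
  refine ⟨j, ?_⟩
  rw [← add_tsub_cancel_of_le h1, h2, add_zero]

theorem sub_linMap_mem [DecidableEq σ] {f : MvPowerSeries σ ℂ} (hf : f ∈ ordIdeal σ 1)
    {B : Matrix σ σ ℂ} {i : σ} (h : ∀ j, coeff (Finsupp.single j 1) f = B i j) :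
    f - linMap B i ∈ ordIdeal σ 2 := by
  intro β hβ
  rw [map_sub, coeff_linMap, sub_eq_zero]
  rcases Nat.lt_or_ge β.degree 1 with h1 | h1
  · rw [hf β h1]
    refine (Finset.sum_eq_zero fun j _ => ?_).symm
    rw [if_neg, mul_zero]
    rintro rfl
    simp at h1
  · obtain ⟨j, rfl⟩ := exists_eq_single_of_degree_eq_one (by omega : β.degree = 1)
    rw [h, Finset.sum_eq_single_of_mem j (Finset.mem_univ j), if_pos rfl, mul_one]
    intro k _ hk
    rw [if_neg, mul_zero]
    exact fun h2 => hk ((Finsupp.single_left_inj one_ne_zero).1 h2).symm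

end Linear

/-! ### The algebra of parameters -/

section Parameters
variable (n : ℕ)

/-- The parameters: a linear part and the coordinates `Λ α` of an infinite jet. -/
abbrev Param : Type := GL (Fin n) ℂ × ((Fin n →₀ ℕ) → Fin n → ℂ)

variable {n}

/-- The formal map with jet coordinates `Λ`. -/
noncomputable def jetSeries (Λ : (Fin n →₀ ℕ) → Fin n → ℂ) (i : Fin n) :
    MvPowerSeries (Fin n) ℂ :=
  fun α => invFactorial α * Λ α i

theorem coeff_jetSeries (Λ : (Fin n →₀ ℕ) → Fin n → ℂ) (i : Fin n) (α : Fin n →₀ ℕ) :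
    coeff α (jetSeries Λ i) = invFactorial α * Λ α i := rfl

/-- Generators of the algebra of functions that are polynomial in the entries of `lam` and its
inverse and in the jet coordinates of order at most `k`. -/
inductive IsGenerator (k : ℕ) : (Param n → ℂ) → Prop
  | entry (i j : Fin n) : IsGenerator k fun y => (y.1 : Matrix (Fin n) (Fin n) ℂ) i j
  | inv (i j : Fin n) :
    IsGenerator k fun y => ((y.1⁻¹ : GL (Fin n) ℂ) : Matrix (Fin n) (Fin n) ℂ) i j
  | jet (α : Fin n →₀ ℕ) (i : Fin n) (h : α.degree ≤ k) :
    IsGenerator k fun y => coeff α (jetSeries y.2 i)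

variable (n) in
/-- The algebra of functions that are polynomial in the entries of `lam` and its inverse and in the
jet coordinates of order at most `k`. -/
noncomputable def jetAlg (k : ℕ) : Subalgebra ℂ (Param n → ℂ) :=
  Algebra.adjoin ℂ {f | IsGenerator k f}

theorem jetAlg_mono : Monotone (jetAlg n) := by
  intro k l hkl
  refine Algebra.adjoin_mono ?_
  rintro f (⟨i, j⟩ | ⟨i, j⟩ | ⟨α, i, h⟩)
  · exact .entry i j
  · exact .inv i j
  · exact .jet α i (h.trans hkl)

theorem hasCoeffs_jetSeries (i : Fin n) : HasCoeffs (jetAlg n) fun y => jetSeries y.2 i :=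
  fun β => Algebra.subset_adjoin (.jet β i le_rfl)

theorem hasCoeffs_linMap {Y : Type*} {F : ℕ → Subalgebra ℂ (Y → ℂ)}
    {B : Y → Matrix (Fin n) (Fin n) ℂ} (hB : ∀ k i j, (fun y => B y i j) ∈ F k) (i : Fin n) :
    HasCoeffs F fun y => linMap (B y) i := by
  intro β
  simp only [coeff_linMap]
  exact sum_fun_mem _ _ fun j _ => Subalgebra.mul_mem _ (hB _ i j) (const_fun_mem _ _)

theorem unifBdd_linMap {Y : Type*} {Z : Set Y} {B : Y → Matrix (Fin n) (Fin n) ℂ}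
    (hB : ∀ i j, ∃ b : ℝ, ∀ y ∈ Z, ‖B y i j‖ ≤ b) (i : Fin n) :
    UnifBdd (fun _ => 1) Z fun y => linMap (B y) i := by
  refine UnifBdd.of_coeff (k := 1) (by simp) (fun y β hβ => ?_) fun β => ?_
  · rw [coeff_linMap]
    refine Finset.sum_eq_zero fun j _ => ?_
    rw [if_neg, mul_zero]
    rintro rfl
    simp at hβ
  · choose b hb using hB
    refine ⟨∑ j, b i j, fun y hy => ?_⟩
    rw [coeff_linMap]
    refine (norm_sum_le _ _).trans (Finset.sum_le_sum fun j _ => ?_)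
    split_ifs
    · simpa using hb i j y hy
    · simpa using (norm_nonneg _).trans (hb i j y hy)

/-- The matrix whose entries are the coordinates of the matrix variable. -/
noncomputable def genericMatrix (n k : ℕ) :
    Matrix (Fin n) (Fin n) (MvPolynomial ((Fin n × Fin n) ⊕ (JetIndex n k × Fin n)) ℂ) :=
  Matrix.of fun i j => MvPolynomial.X (Sum.inl (i, j))

/-- Evaluation of polynomials in the matrix entries and the jet coordinates of order at most `k`. -/
noncomputable def evalAt {k : ℕ} (y : Param n) :
    MvPolynomial ((Fin n × Fin n) ⊕ (JetIndex n k × Fin n)) ℂ →+* ℂ :=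
  MvPolynomial.eval (Sum.elim (fun i => (y.1 : Matrix (Fin n) (Fin n) ℂ) i.1 i.2)
    fun i => y.2 i.1 i.2)

theorem evalAt_genericMatrix {k : ℕ} (y : Param n) :
    (evalAt y).mapMatrix (genericMatrix n k) = (y.1 : Matrix (Fin n) (Fin n) ℂ) := by
  ext i j
  simp [evalAt, genericMatrix]

theorem evalAt_det {k : ℕ} (y : Param n) :
    evalAt y (genericMatrix n k).det = (y.1 : Matrix (Fin n) (Fin n) ℂ).det := by
  rw [RingHom.map_det, evalAt_genericMatrix]

/-- Functions in `jetAlg n k` are quotients of polynomials by powers of the determinant. -/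
theorem exists_polynomial_of_mem {k : ℕ} {f : Param n → ℂ} (hf : f ∈ jetAlg n k) :
    ∃ κ : ℕ, ∃ P : MvPolynomial ((Fin n × Fin n) ⊕ (JetIndex n k × Fin n)) ℂ, ∀ y : Param n,
      f y * (y.1 : Matrix (Fin n) (Fin n) ℂ).det ^ κ = evalAt y P := by
  induction hf using Algebra.adjoin_induction with
  | mem f hf =>
    obtain (⟨i, j⟩ | ⟨i, j⟩ | ⟨α, i, h⟩) := hf
    · exact ⟨0, MvPolynomial.X (Sum.inl (i, j)), fun y => by simp [evalAt]⟩
    · refine ⟨1, (genericMatrix n k).adjugate i j, fun y => ?_⟩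
      have h1 := congrFun (congrFun
        (RingHom.map_adjugate (evalAt (k := k) y) (genericMatrix n k)) i) j
      rw [evalAt_genericMatrix, RingHom.mapMatrix_apply, Matrix.map_apply] at h1
      rw [h1, pow_one, mul_comm]
      have h2 : (y.1 : Matrix (Fin n) (Fin n) ℂ).adjugate =
          (y.1 : Matrix (Fin n) (Fin n) ℂ).det •
            ((y.1⁻¹ : GL (Fin n) ℂ) : Matrix (Fin n) (Fin n) ℂ) := by
        have h3 := congrArg (· * ((y.1⁻¹ : GL (Fin n) ℂ) : Matrix (Fin n) (Fin n) ℂ))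
          (Matrix.adjugate_mul (y.1 : Matrix (Fin n) (Fin n) ℂ))
        simpa [Matrix.mul_assoc] using h3
      rw [h2]
      rfl
    · refine ⟨0, MvPolynomial.C (invFactorial α) * MvPolynomial.X (Sum.inr (⟨α, h⟩, i)),
        fun y => ?_⟩
      simp [evalAt, coeff_jetSeries]
  | algebraMap c => exact ⟨0, MvPolynomial.C c, fun y => by simp [evalAt]⟩
  | add f g _ _ hf hg =>
    obtain ⟨κ, P, hP⟩ := hf
    obtain ⟨κ', P', hP'⟩ := hg
    refine ⟨κ + κ', P * (genericMatrix n k).det ^ κ' + P' * (genericMatrix n k).det ^ κ,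
      fun y => ?_⟩
    rw [map_add, map_mul, map_mul, map_pow, map_pow, evalAt_det, ← hP, ← hP', Pi.add_apply]
    ring
  | mul f g _ _ hf hg =>
    obtain ⟨κ, P, hP⟩ := hf
    obtain ⟨κ', P', hP'⟩ := hg
    refine ⟨κ + κ', P * P', fun y => ?_⟩
    rw [map_mul, ← hP, ← hP', Pi.mul_apply]
    ring

/-- Finitely many functions in `jetAlg n k` have a common denominator. -/
theorem exists_common_denominator {k : ℕ} {ι : Type*} (s : Finset ι) {f : ι → Param n → ℂ}
    (hf : ∀ a ∈ s, f a ∈ jetAlg n k) :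
    ∃ κ : ℕ, ∀ a ∈ s, ∃ P : MvPolynomial ((Fin n × Fin n) ⊕ (JetIndex n k × Fin n)) ℂ,
      ∀ y : Param n, f a y * (y.1 : Matrix (Fin n) (Fin n) ℂ).det ^ κ = evalAt y P := by
  choose! κ P hP using fun a ha => exists_polynomial_of_mem (hf a ha)
  refine ⟨s.sup κ, fun a ha => ⟨P a * (genericMatrix n k).det ^ (s.sup κ - κ a), fun y => ?_⟩⟩
  rw [map_mul, map_pow, evalAt_det, ← hP a ha, mul_assoc, ← pow_add,
    Nat.add_sub_cancel' (Finset.le_sup ha)]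

/-- The value at `z` of the homogeneous part of degree `ℓ` of a power series. -/
noncomputable def homEval (ℓ : ℕ) (f : MvPowerSeries (Fin n) ℂ) (z : Fin n → ℂ) : ℂ :=
  ∑ β ∈ homDegrees (Fin n) ℓ, coeff β f * β.prod fun i e => z i ^ e

theorem homEval_one {f : MvPowerSeries (Fin n) ℂ} {B : Matrix (Fin n) (Fin n) ℂ} {i : Fin n}
    (hf : f - linMap B i ∈ ordIdeal (Fin n) 2) (z : Fin n → ℂ) : homEval 1 f z = (B *ᵥ z) i := by
  classical
  have h1 : homDegrees (Fin n) 1 = Finset.univ.image fun j : Fin n => Finsupp.single j 1 := by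
    ext β
    rw [mem_homDegrees, Finset.mem_image]
    constructor
    · intro h
      obtain ⟨j, rfl⟩ := exists_eq_single_of_degree_eq_one h
      exact ⟨j, Finset.mem_univ j, rfl⟩
    · rintro ⟨j, -, rfl⟩
      simp
  rw [homEval, h1, Finset.sum_image fun a _ b _ h => (Finsupp.single_left_inj one_ne_zero).1 h,
    Matrix.mulVec, dotProduct]
  refine Finset.sum_congr rfl fun j _ => ?_
  have h2 := hf (Finsupp.single j 1) (by simp)
  rw [map_sub, sub_eq_zero] at h2
  simp [h2, coeff_linMap, Finsupp.single_left_inj]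

theorem enorm_homEval_mul_le (ℓ : ℕ) (f : MvPowerSeries (Fin n) ℂ) {z : Fin n → ℂ}
    (hz : z ∈ polydisc fun _ => 1) (t : ℝ≥0∞) :
    ‖homEval ℓ f z‖ₑ * t ^ ℓ ≤ wnorm (fun _ => t) f := by
  have hz1 : ‖z‖ ≤ 1 := (pi_norm_le_iff_of_nonneg zero_le_one).2 fun j => (hz j).le
  refine le_trans ?_ (ENNReal.sum_le_tsum (homDegrees (Fin n) ℓ))
  rw [homEval]
  refine (mul_le_mul_left (enorm_sum_le _ _) _).trans ?_
  rw [Finset.sum_mul]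
  refine Finset.sum_le_sum fun β hβ => ?_
  rw [wmon_const, mem_homDegrees.1 hβ, enorm_mul]
  refine mul_le_mul_left (mul_le_of_le_one_right' ?_) _
  rw [← ofReal_norm, ENNReal.ofReal_le_one]
  exact (norm_prod_pow_le z β).trans (pow_le_one₀ (norm_nonneg _) hz1)

theorem isWeightedHomogeneous_rename_inr {ι κ : Type*} (P : MvPolynomial κ ℂ) :
    MvPolynomial.IsWeightedHomogeneous (Sum.elim (fun _ => 1) (fun _ => 0) : ι ⊕ κ → ℕ)
      (MvPolynomial.rename Sum.inr P) 0 := by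
  induction P using MvPolynomial.induction_on with
  | C a => simpa using MvPolynomial.isWeightedHomogeneous_C _ a
  | add p q hp hq =>
    rw [map_add]
    exact hp.add hq
  | mul_X p i hp =>
    rw [map_mul, MvPolynomial.rename_X]
    exact hp.mul (MvPolynomial.isWeightedHomogeneous_X ℂ _ (Sum.inr i))

/-- A family of homogeneous polynomials whose coefficients are polynomials in the parameters, up to
a common power of the determinant, is a polynomial map. -/
theorem exists_polyMap {k ℓ κ : ℕ} {f : Param n → Fin n → MvPowerSeries (Fin n) ℂ}
    (hf : ∀ (i : Fin n), ∀ β ∈ homDegrees (Fin n) ℓ,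
      ∃ P : MvPolynomial ((Fin n × Fin n) ⊕ (JetIndex n k × Fin n)) ℂ, ∀ y : Param n,
        coeff β (f y i) * (y.1 : Matrix (Fin n) (Fin n) ℂ).det ^ κ = evalAt y P) :
    ∃ p : PolyMap n k, p.IsHomogeneousInFirst ℓ ∧ ∀ (y : Param n) z i,
      p.value z (y.1 : Matrix (Fin n) (Fin n) ℂ) (fun α => y.2 α) i =
        (y.1 : Matrix (Fin n) (Fin n) ℂ).det ^ κ * homEval ℓ (f y i) z := by
  choose! P hP using hf
  refine ⟨fun i => ∑ β ∈ homDegrees (Fin n) ℓ,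
    (β.prod fun j e => MvPolynomial.X (Sum.inl j) ^ e) * MvPolynomial.rename Sum.inr (P i β),
    fun i => ?_, fun y z i => ?_⟩
  · refine MvPolynomial.IsWeightedHomogeneous.sum _ _ _ fun β hβ => ?_
    rw [← add_zero ℓ]
    refine MvPolynomial.IsWeightedHomogeneous.mul ?_ (isWeightedHomogeneous_rename_inr _)
    rw [Finsupp.prod_fintype _ _ (by simp), ← mem_homDegrees.1 hβ, Finsupp.degree_eq_sum]
    refine MvPolynomial.IsWeightedHomogeneous.prod _ _ _ fun j _ => ?_
    simpa using (MvPolynomial.isWeightedHomogeneous_X ℂ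
      (Sum.elim (fun _ => 1) (fun _ => 0) : PolyVar n k → ℕ) (Sum.inl j)).pow (β j)
  · rw [PolyMap.value, map_sum, homEval, Finset.mul_sum]
    refine Finset.sum_congr rfl fun β hβ => ?_
    rw [map_mul, MvPolynomial.eval_rename, Sum.elim_comp_inr, map_finsuppProd]
    simp only [map_pow, MvPolynomial.eval_X, Sum.elim_inl]
    rw [show MvPolynomial.eval _ (P i β) = evalAt y (P i β) from rfl, ← hP i β hβ]
    ring

end Parameters

/-! ### The universal family of solutions -/

section Family
variable {n : ℕ}

/-- The right-hand side `b ∘ lam⁻¹` of the equation for the unipotent part `w = u ∘ lam⁻¹`, when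
`b` has jet coordinates `y.2` and `lam = y.1`. -/
noncomputable def rhs (y : Param n) (i : Fin n) : MvPowerSeries (Fin n) ℂ :=
  subst (linMap ((y.1⁻¹ : GL (Fin n) ℂ) : Matrix (Fin n) (Fin n) ℂ)) (jetSeries y.2 i)

theorem hasCoeffs_rhs (i : Fin n) : HasCoeffs (jetAlg n) fun y => rhs y i :=
  (hasCoeffs_jetSeries i).subst jetAlg_mono
    (hasCoeffs_linMap fun _ i j => Algebra.subset_adjoin (.inv i j)) fun _ => linMap_mem _

/-- The parameters whose linear part lies in `L` and whose jets satisfy the Cauchy estimates with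
constant `C`. -/
def boundedParams (L : Set (GL (Fin n) ℂ)) (C : ℝ) : Set (Param n) :=
  {y | y.1 ∈ L ∧ ∀ i α, ‖coeff α (jetSeries y.2 i)‖ ≤ 1 * C ^ α.degree}

theorem bounded_of_mem_jetAlg {L : Set (GL (Fin n) ℂ)} (hL : IsCompact L) {C : ℝ} (k : ℕ)
    {f : Param n → ℂ} (hf : f ∈ jetAlg n k) : ∃ b : ℝ, ∀ y ∈ boundedParams L C, ‖f y‖ ≤ b := by
  induction hf using Algebra.adjoin_induction with
  | mem f hf =>
    obtain (⟨i, j⟩ | ⟨i, j⟩ | ⟨α, i, h⟩) := hf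
    · obtain ⟨b, hb⟩ := hL.exists_bound_of_continuousOn
        (f := fun lam : GL (Fin n) ℂ => (lam : Matrix (Fin n) (Fin n) ℂ) i j)
        (Units.continuous_val.matrix_elem i j).continuousOn
      exact ⟨b, fun y hy => hb _ hy.1⟩
    · obtain ⟨b, hb⟩ := hL.exists_bound_of_continuousOn
        (f := fun lam : GL (Fin n) ℂ => ((lam⁻¹ : GL (Fin n) ℂ) : Matrix (Fin n) (Fin n) ℂ) i j)
        ((Units.continuous_val.comp continuous_inv).matrix_elem i j).continuousOn
      exact ⟨b, fun y hy => hb _ hy.1⟩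
    · exact ⟨_, fun y hy => hy.2 i α⟩
  | algebraMap c => exact ⟨‖c‖, fun y _ => le_rfl⟩
  | add f g _ _ hf hg =>
    obtain ⟨b, hb⟩ := hf
    obtain ⟨b', hb'⟩ := hg
    exact ⟨b + b', fun y hy => (norm_add_le _ _).trans (add_le_add (hb y hy) (hb' y hy))⟩
  | mul f g _ _ hf hg =>
    obtain ⟨b, hb⟩ := hf
    obtain ⟨b', hb'⟩ := hg
    exact ⟨b * b', fun y hy => (norm_mul_le _ _).trans (mul_le_mul (hb y hy) (hb' y hy)
      (norm_nonneg _) ((norm_nonneg _).trans (hb y hy)))⟩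

theorem unifBdd_rhs {L : Set (GL (Fin n) ℂ)} (hL : IsCompact L) {C : ℝ} (hC : 0 < C) (i : Fin n) :
    UnifBdd (fun _ => 1) (boundedParams L C) fun y => rhs y i := by
  have h1 : ∀ i, UnifBdd (fun _ => 1) (boundedParams L C) fun y => jetSeries y.2 i := fun i => by
    refine ⟨1 / (2 * C), by positivity, ENNReal.ofReal 1 * 2 ^ n,
      ENNReal.mul_ne_top ENNReal.ofReal_ne_top (ENNReal.pow_ne_top (by simp)), fun y hy => ?_⟩
    have h2 := wnorm_le_of_norm_coeff_le zero_le_one hC (hy.2 i)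
    rwa [show (fun _ => ENNReal.ofReal (1 / (2 * C))) = scaled (fun _ : Fin n => 1) (1 / (2 * C)) by
      funext; simp [scaled]] at h2
  refine (h1 i).subst (by simp) (unifBdd_linMap fun i j => ?_) fun _ => linMap_mem _
  exact bounded_of_mem_jetAlg hL 0 (Algebra.subset_adjoin (.inv i j))

/-- The universal formal solution of `A ∘ u = b` with linear part `lam`, as a family depending on
`lam` and the jet of `b`. -/
theorem exists_solution_family {A : (Fin n → ℂ) → Fin n → ℂ} (hA : AnalyticAt ℂ A 0)
    (hr : ∃ᶠ z in 𝓝 (0 : Fin n → ℂ), (jacobian A z).rank = n) :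
    ∃ (s : ℕ) (u : Param n → Fin n → MvPowerSeries (Fin n) ℂ),
      (∀ y i, u y i - linMap (y.1 : Matrix (Fin n) (Fin n) ℂ) i ∈ ordIdeal (Fin n) 2) ∧
      (∀ i, HasCoeffs (fun k => jetAlg n (s + k)) fun y => u y i) ∧
      (∀ y : Param n, ∀ U : Fin n → MvPowerSeries (Fin n) ℂ,
        (∀ i, U i - linMap (y.1 : Matrix (Fin n) (Fin n) ℂ) i ∈ ordIdeal (Fin n) 2) →
        (∀ i, subst U (taylor A i) = jetSeries y.2 i) → U = u y) ∧
      ∀ L : Set (GL (Fin n) ℂ), IsCompact L → ∀ C : ℝ, 0 < C →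
        ∀ i, UnifBdd (fun _ => 1) (boundedParams L C) fun y => u y i := by
  obtain ⟨r₀, hr₀, hr₀A⟩ := exists_wnorm_taylor_ne_top hA
  obtain ⟨s, hs⟩ := exists_unipotent_solution (det_jac_taylor_ne_zero hA hr) hr₀ hr₀A
  obtain ⟨w, hw, hwF, hwu, hwb⟩ := hs (Param n) (jetAlg n) jetAlg_mono rhs hasCoeffs_rhs
  have hmono : Monotone fun k => jetAlg n (s + k) := fun a b h => jetAlg_mono (by omega)
  refine ⟨s, fun y i => subst (linMap (y.1 : Matrix (Fin n) (Fin n) ℂ)) (w y i),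
    fun y i => ?_, fun i => ?_, fun y U hU hUA => ?_, fun L hL C hC i => ?_⟩
  · have hl := hasSubst_of_mem (linMap_mem (y.1 : Matrix (Fin n) (Fin n) ℂ))
    have h1 := subst_mem_ordIdeal (linMap_mem (y.1 : Matrix (Fin n) (Fin n) ℂ)) (hw y i)
    rwa [subst_sub hl, subst_X hl] at h1
  · have h1 : HasCoeffs (fun k => jetAlg n (s + k)) fun y => w y i :=
      (hwF i).mono fun k => jetAlg_mono (by omega)
    exact h1.subst hmono
      (hasCoeffs_linMap fun _ i j => Algebra.subset_adjoin (.entry i j)) fun _ => linMap_mem _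
  · have hU1 : ∀ i, U i ∈ ordIdeal (Fin n) 1 := fun i => by
      have := Ideal.add_mem _ (ordIdeal_mono one_le_two (hU i))
        (linMap_mem (y.1 : Matrix (Fin n) (Fin n) ℂ) i)
      rwa [sub_add_cancel] at this
    have hinv := linMap_mem ((y.1⁻¹ : GL (Fin n) ℂ) : Matrix (Fin n) (Fin n) ℂ)
    have hl := hasSubst_of_mem hinv
    have h1 : (fun i => subst (linMap ((y.1⁻¹ : GL (Fin n) ℂ) : Matrix (Fin n) (Fin n) ℂ)) (U i)) =
        w y := by
      refine hwu y _ (fun i => ?_) fun i => ?_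
      · have h2 := subst_mem_ordIdeal hinv (hU i)
        rwa [subst_sub hl, subst_linMap_linMap, Units.mul_inv, linMap_one] at h2
      · rw [rhs, ← hUA i, subst_comp_subst_apply (hasSubst_of_mem hU1) hl]
    funext i
    change U i = subst _ (w y i)
    rw [← congrFun h1 i]
    exact (subst_linMap_subst_linMap (Units.inv_mul _) _).symm
  · refine (hwb _ (fun k f hf => bounded_of_mem_jetAlg hL k hf) (unifBdd_rhs hL hC) i).subst
      (by simp) (unifBdd_linMap fun i j => ?_) fun _ => linMap_mem _
    exact bounded_of_mem_jetAlg hL 0 (Algebra.subset_adjoin (.entry i j))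

end Family

end JetParam

/-! ### The polynomial maps -/

open JetParam

theorem theorem3p1 (n : ℕ) (A : (Fin n → ℂ) → (Fin n → ℂ)) (hA : AnalyticAt ℂ A 0)
    (hrank : HasGenericRank A n) :
    ∃ (ℓ₀ : ℕ) (p : ∀ ℓ : ℕ, PolyMap n (ℓ₀ + ℓ)) (κ : ℕ → ℕ),
      (∀ ℓ, 1 ≤ ℓ → (p ℓ).IsHomogeneousInFirst ℓ) ∧
      (∀ b u : (Fin n → ℂ) → (Fin n → ℂ), AnalyticAt ℂ b 0 → IsBiholomorphismGerm u →
        (∀ᶠ z in 𝓝 (0 : Fin n → ℂ), A (u z) = b z) →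
        ∀ ℓ, 1 ≤ ℓ → ∀ z : Fin n → ℂ,
          homogeneousPart u ℓ z =
            (1 / (jacobian u 0).det ^ κ ℓ) •
              (p ℓ).value z (jacobian u 0) (jetAtZero (ℓ₀ + ℓ) b)) ∧
      (κ 1 = 0 ∧
        ∀ b : (Fin n → ℂ) → (Fin n → ℂ), AnalyticAt ℂ b 0 →
          ∀ (lam : GL (Fin n) ℂ) (z : Fin n → ℂ),
            (p 1).value z (lam : Matrix (Fin n) (Fin n) ℂ) (jetAtZero (ℓ₀ + 1) b) =
              (lam : Matrix (Fin n) (Fin n) ℂ) *ᵥ z) ∧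
      (∃ ρ : Fin n → ℝ, (∀ j, 0 < ρ j) ∧
        ∀ C : ℝ, 0 < C → ∀ L : Set (GL (Fin n) ℂ), IsCompact L →
          ∃ K : ℝ, 0 < K ∧
            ∀ lam ∈ L, ∀ b : (Fin n → ℂ) → (Fin n → ℂ), AnalyticAt ℂ b 0 →
              (∀ k : ℕ, supNorm (polydisc ρ) (homogeneousPart b k) ≤ ENNReal.ofReal (C ^ k)) →
              ∀ ℓ, 1 ≤ ℓ →
                supNorm (polydisc ρ) (fun z =>
                    (1 / (lam : Matrix (Fin n) (Fin n) ℂ).det ^ κ ℓ) •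
                      (p ℓ).value z (lam : Matrix (Fin n) (Fin n) ℂ) (jetAtZero (ℓ₀ + ℓ) b)) ≤
                  ENNReal.ofReal (K ^ ℓ)) := by
  classical
  obtain ⟨s, u, hu, huF, huu, hub⟩ := exists_solution_family hA hrank.2
  have hdet : ∀ lam : GL (Fin n) ℂ, (lam : Matrix (Fin n) (Fin n) ℂ).det ≠ 0 := fun lam =>
    ((Matrix.isUnit_iff_isUnit_det _).1 lam.isUnit).ne_zero
  have hex : ∀ ℓ : ℕ, ∃ (κ : ℕ) (p : PolyMap n (s + ℓ)), (ℓ = 1 → κ = 0) ∧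
      p.IsHomogeneousInFirst ℓ ∧ ∀ (y : Param n) z i,
        p.value z (y.1 : Matrix (Fin n) (Fin n) ℂ) (fun α => y.2 α) i =
          (y.1 : Matrix (Fin n) (Fin n) ℂ).det ^ κ * homEval ℓ (u y i) z := by
    intro ℓ
    rcases eq_or_ne ℓ 1 with rfl | hℓ
    · -- the coefficients of degree one are the matrix entries, and no denominator is needed
      obtain ⟨p, hp, hpv⟩ := exists_polyMap (k := s + 1) (ℓ := 1) (κ := 0) (f := u) fun i β hβ => by
        obtain ⟨j, rfl⟩ := exists_eq_single_of_degree_eq_one (mem_homDegrees.1 hβ)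
        refine ⟨MvPolynomial.X (Sum.inl (i, j)), fun y => ?_⟩
        have h1 := hu y i (Finsupp.single j 1) (by simp)
        rw [map_sub, sub_eq_zero] at h1
        simp [h1, coeff_linMap, evalAt, Finsupp.single_left_inj]
      exact ⟨0, p, fun _ => rfl, hp, hpv⟩
    · obtain ⟨κ, hκ⟩ := exists_common_denominator (k := s + ℓ)
        ((Finset.univ : Finset (Fin n)) ×ˢ homDegrees (Fin n) ℓ)
        (f := fun a y => MvPowerSeries.coeff a.2 (u y a.1)) fun a ha => by
          have h1 := huF a.1 a.2
          rwa [mem_homDegrees.1 (Finset.mem_product.1 ha).2] at h1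
      obtain ⟨p, hp, hpv⟩ := exists_polyMap (f := u) (κ := κ) fun i β hβ =>
        hκ (i, β) (Finset.mem_product.2 ⟨Finset.mem_univ i, hβ⟩)
      exact ⟨κ, p, fun h => absurd h hℓ, hp, hpv⟩
  choose κ p hκ hp hpv using hex
  have hval : ∀ (ℓ : ℕ) (lam : GL (Fin n) ℂ) (b : (Fin n → ℂ) → (Fin n → ℂ)) (z : Fin n → ℂ),
      (1 / (lam : Matrix (Fin n) (Fin n) ℂ).det ^ κ ℓ) •
        (p ℓ).value z (lam : Matrix (Fin n) (Fin n) ℂ) (jetAtZero (s + ℓ) b) =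
          fun i => homEval ℓ (u (lam, partialAtZero b) i) z := by
    intro ℓ lam b z
    funext i
    have h1 : (p ℓ).value z (lam : Matrix (Fin n) (Fin n) ℂ) (jetAtZero (s + ℓ) b) i = _ :=
      hpv ℓ (lam, partialAtZero b) z i
    rw [Pi.smul_apply, smul_eq_mul, h1, ← mul_assoc, one_div,
      inv_mul_cancel₀ (pow_ne_zero _ (hdet lam)), one_mul]
  refine ⟨s, p, κ, fun ℓ _ => hp ℓ, fun b v hb hv hvb ℓ _ z => ?_, ⟨hκ 1 rfl, fun b _ lam z => ?_⟩,
    fun _ => 1, fun _ => one_pos, fun C hC L hL => ?_⟩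
  · obtain ⟨lam, hlam⟩ := (Matrix.isUnit_iff_isUnit_det _).2 (isUnit_det_jacobian hv)
    rw [← hlam, hval]
    funext i
    rw [homogeneousPart_apply hv.1, ← huu (lam, partialAtZero b) (taylor v) (fun i => ?_)
      fun i => subst_taylor hA hv.1 hv.2.1 hb hvb i]
    · rfl
    · refine sub_linMap_mem ?_ fun j => ?_
      · rw [mem_ordIdeal_one, ← MvPowerSeries.coeff_zero_eq_constantCoeff_apply,
          coeff_taylor_zero hv.1, hv.2.1]
        rfl
      · rw [coeff_taylor_single hv.1, hlam]
  · have h1 := hval 1 lam b z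
    rw [hκ 1 rfl, pow_zero, div_one, one_smul] at h1
    rw [h1]
    funext i
    exact homEval_one (hu _ i) z
  · obtain ⟨r, hr, B, hB, hbd⟩ := UnifBdd.uniform Finset.univ
      fun i (_ : i ∈ Finset.univ) => hub L hL (2 * C) (by positivity) i
    -- the norm bound `B` on the polydisc of radius `r` bounds the part of degree `ℓ` on the unit
    -- polydisc by `B / r ^ ℓ`, and `B ≤ max B 1 ^ ℓ`
    refine ⟨max B.toReal 1 / r, by positivity, fun lam hlam b hb hbC ℓ hℓ => ?_⟩
    refine iSup_le fun i => iSup₂_le fun z hz => ?_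
    simp only [hval]
    have h1 : ((lam, partialAtZero b) : Param n) ∈ boundedParams L (2 * C) :=
      ⟨hlam, fun i α => norm_coeff_taylor_le hb hC.le hbC i α⟩
    have h3 : scaled (fun _ : Fin n => 1) r = fun _ => ENNReal.ofReal r := by
      funext
      simp [scaled]
    rw [h3] at hbd
    have h2 := (enorm_homEval_mul_le ℓ _ hz (ENNReal.ofReal r)).trans
      (hbd i (Finset.mem_univ i) _ h1)
    have hr0 : ENNReal.ofReal r ^ ℓ ≠ 0 := pow_ne_zero _ (by simpa using hr)
    refine (ENNReal.mul_le_mul_iff_left hr0 (ENNReal.pow_ne_top ENNReal.ofReal_ne_top)).1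
      (h2.trans ?_)
    rw [← ENNReal.ofReal_pow hr.le, ← ENNReal.ofReal_mul (by positivity), div_pow,
      div_mul_cancel₀ _ (pow_ne_zero _ hr.ne')]
    refine ENNReal.le_ofReal_iff_toReal_le hB (by positivity) |>.2 ((le_max_left _ 1).trans ?_)
    exact le_self_pow₀ (le_max_right _ _) (by omega)
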